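/- Consider a dynamic stochastic block model with $n$ nodes, $m\ge 1$ classes and $L\ge 2$ time points. At time $l$ node $i$ belongs to class $z^{(l)}(i)\in\{1,\dots,m\}$; $\mathbf G\in[0,1]^{m\times m\times L}$ with $\mathbf G_{k,k',l}=\mathbf G_{k',k,l}$ is the connectivity tensor; $\boldsymbol\Lambda_{i,j,l}=\mathbf G_{z^{(l)}(i),z^{(l)}(j),l}$ for $i\ne j$ and $\boldsymbol\Lambda_{i,i,l}=0$. One observes independent variables $\mathbf B_{i,j,l}\sim\mathrm{Bernoulli}(\boldsymbol\Lambda_{i,j,l})$, $1\le i<j\le n$, $1\le l\le L$ (with $\mathbf B_{j,i,l}=\mathbf B_{i,j,l}$ and $\mathbf B_{i,i,l}=0$); $\mathbb P_{\boldsymbol\Lambda}$ denotes their law, and $\|\mathbf A\|^2$ the sum of the squared entries of a tensor $\mathbf A$. Let $\mathbf H\in\mathbb R^{L\times L}$ be an orthogonal matrix such that $\|\mathbf H^T\omega\|_\infty\le\|\omega\|_1/\sqrt L$ for all $\omega\in\{0,1\}^L$ and $\mathbf H\mathbf 1=\sqrt L\,e_1$. For $\nu_0>1/2$ and $K_0>0$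 let $\mathcal G_{m,L,\nu_0}$ be the set of connectivity tensors $\mathbf G$ for which the matrix $\mathbf D=\mathbf Q\mathbf H^T$, where $\mathbf Q$ has the rows $(\mathbf G_{k_1,k_2,l})_{l=1}^L$, $k_1\le k_2$, satisfies $\sum_{l=1}^L(l-1)^{2\nu_0}\mathbf D_{k,l}^2\le K_0$ for every row $k$. For constants $0<\aleph_1\le1\le\aleph_2<\infty$ and an integer $0\le n_0\le n$, let $\mathcal Z_{bal}$ be the set of all families $z=(z^{(1)},\dots,z^{(L)})$ such that at most $n_0$ nodes change their class between any two consecutive time points and every class has at every time at least $\aleph_1 n/m$ and at most $\aleph_2 n/m$ nodes. Suppose that $n\ge 2m$, that $\mathcal Z_{bal}$ is not empty and, if $n_0\ge1$, that it contains a family that is not constant in time. Then there is a constant $C>0$, depending only on $\nu_0$, $K_0$, $\aleph_1$ and $\aleph_2$ (and not on $n$, $m$, $L$, $n_0$, $\mathbf H$), such that $$\inf_{\widehat{\boldsymbol\Lambda}}\ \sup_{\mathbf G\in\mathcal G_{m,L,\nu_0},\ z\in\mathcal Z_{bal}}\mathbb P_{\boldsymbol\Lambda}\left\{\frac{\|\widehat{\boldsymbol\Lambda}-\boldsymbol\Lambda\|^2}{n^2L}\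 \ge\ C\left[\min\left\{\frac1L\left[\left(\frac mn\right)^2\right]^{\frac{2\nu_0}{2\nu_0+1}},\ \left(\frac mn\right)^2\right\}+\frac{\log m}{nL}+\frac{n_0}{n^2}\log\left(\frac{mne}{n_0}\right)\right]\right\}\ \ge\ \frac14 ,$$ where the infimum is over all estimators $\widehat{\boldsymbol\Lambda}$, i.e. all functions of the observations with values in $\mathbb R^{n\times n\times L}$, and the last term in the bracket is $0$ when $n_0=0$. -/

import Mathlib

open scoped ENNReal unitInterval Matrix

namespace DSBM

/-- A real `L × L` transform: `H` is orthogonal, `‖Hᵀ ω‖_∞ ≤ ‖ω‖₁ / √L` for all binary `ω`, and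
`H 1 = √L e₁` (the first coordinate has index `0` in `Fin L`). -/
structure TransformCond {L : ℕ} (H : Matrix (Fin L) (Fin L) ℝ) : Prop where
  orthogonal : H ∈ Matrix.orthogonalGroup (Fin L) ℝ
  binary_bound : ∀ ω : Fin L → ℝ, (∀ l, ω l = 0 ∨ ω l = 1) →
    ∀ l, |(Hᵀ *ᵥ ω) l| ≤ (∑ j, |ω j|) / √(L : ℝ)
  mulVec_one : H *ᵥ (fun _ => 1) = fun l : Fin L => if (l : ℕ) = 0 then √(L : ℝ) else 0

/-- Indices of the non-redundant pairs of classes `k₁ ≤ k₂`. -/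
abbrev ClassPair (m : ℕ) : Type := {k : Fin m × Fin m // k.1 ≤ k.2}

/-- Indices of the non-redundant pairs of nodes `i < j`. -/
abbrev NodePair (n : ℕ) : Type := {e : Fin n × Fin n // e.1 < e.2}

/-- A tensor of connection probabilities between `m` classes at `L` time points. -/
abbrev ClassTensor (m L : ℕ) : Type := Fin m → Fin m → Fin L → I

/-- The matrix `Q`: its rows are the curves `G k₁ k₂ ·` with `k₁ ≤ k₂`. -/
def rowMatrix {m L : ℕ} (G : ClassTensor m L) : Matrix (ClassPair m) (Fin L) ℝ :=
  Matrix.of fun k l => (G k.1.1 k.1.2 l : ℝ)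

/-- The matrix `D = Q Hᵀ` of transform coefficients (so `Q = D H` for orthogonal `H`). -/
def coefMatrix {m L : ℕ} (H : Matrix (Fin L) (Fin L) ℝ) (G : ClassTensor m L) :
    Matrix (ClassPair m) (Fin L) ℝ :=
  rowMatrix G * Hᵀ

/-- Symmetric tensors of connection probabilities whose coefficient rows satisfy
`∑_{l = 1}^{L} (l - 1) ^ (2 ν₀) (D k l)² ≤ K₀`; an index `l : Fin L` has the value `l - 1` of the
one-based index. -/
def smoothClass (m : ℕ) {L : ℕ} (H : Matrix (Fin L) (Fin L) ℝ) (ν₀ K₀ : ℝ) :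
    Set (ClassTensor m L) :=
  {G | (∀ k₁ k₂ l, G k₁ k₂ l = G k₂ k₁ l) ∧
    ∀ k : ClassPair m, ∑ l : Fin L, ((l : ℕ) : ℝ) ^ (2 * ν₀) * (coefMatrix H G k l) ^ 2 ≤ K₀}

/-- Class memberships over time: `z l i` is the class of node `i` at time `l`. -/
abbrev Clustering (m n L : ℕ) : Type := Fin L → Fin n → Fin m

/-- Clusterings such that at most `n₀` nodes change class between consecutive time points and all
class sizes lie between `a₁ n / m` and `a₂ n / m` at all times. -/
def balancedClusterings (m n n₀ L : ℕ) (a₁ a₂ : ℝ) : Set (Clustering m n L) :=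
  {z | (∀ l l' : Fin L, (l' : ℕ) = (l : ℕ) + 1 →
      (Finset.univ.filter fun i => z l i ≠ z l' i).card ≤ n₀) ∧
    ∀ (l : Fin L) (k : Fin m),
      a₁ * ((n : ℝ) / m) ≤ ((Finset.univ.filter fun i => z l i = k).card : ℝ) ∧
      ((Finset.univ.filter fun i => z l i = k).card : ℝ) ≤ a₂ * ((n : ℝ) / m)}

/-- The tensor `Λ` of connection probabilities between nodes, with zero diagonal (no loops). -/
def probTensor {m n L : ℕ} (G : ClassTensor m L) (z : Clustering m n L) :
    Fin n → Fin n → Fin L → I :=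
  fun i j l => if i = j then 0 else G (z l i) (z l j) l

/-- An observed dynamic undirected network without loops: for each pair of nodes `i < j` and each
time point, whether the edge is present. -/
abbrev Network (n L : ℕ) : Type := NodePair n × Fin L → Bool

/-- The law of the network with edge probabilities `Λ`: all edges with `i < j` at all time points
are independent Bernoulli variables. -/
noncomputable def networkLaw {n L : ℕ} (Λ : Fin n → Fin n → Fin L → I) :
    MeasureTheory.Measure (Network n L) :=
  MeasureTheory.Measure.pi fun e =>
    ProbabilityTheory.bernoulliMeasure true false (Λ e.1.1.1 e.1.1.2 e.2)

/-- An estimator of `Λ` is any function of the observed network. -/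
abbrev Estimator (n L : ℕ) : Type := Network n L → Fin n → Fin n → Fin L → ℝ

/-- The normalized squared error `‖Λ' - Λ‖² / (n² L)`. -/
noncomputable def normError {n L : ℕ} (Λ' : Fin n → Fin n → Fin L → ℝ)
    (Λ : Fin n → Fin n → Fin L → I) : ℝ :=
  (∑ i, ∑ j, ∑ l, (Λ' i j l - (Λ i j l : ℝ)) ^ 2) / ((n : ℝ) ^ 2 * L)

/-- The rate of the lower bound. For `n₀ = 0` the last term is `0`. -/
noncomputable def rate (m n n₀ L : ℕ) (ν₀ : ℝ) : ℝ :=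
  min (1 / (L : ℝ) * (((m : ℝ) / n) ^ 2) ^ (2 * ν₀ / (2 * ν₀ + 1))) (((m : ℝ) / n) ^ 2)
    + Real.log m / (n * L)
    + (n₀ : ℝ) / (n : ℝ) ^ 2 * Real.log (m * n * Real.exp 1 / n₀)

end DSBM

/-! The rate is a sum of three terms. Each is a lower bound by itself, from its own finite set of
hypotheses, and the largest is at least a third of the sum.

All three bounds use one testing principle. `exists_sum_mass_le` is a Fano inequality with the `χ²`
divergence to a fixed reference law. `exists_networkLaw_ge` turns it into an estimation bound: if
the edge probabilities stay within squared distance `χ` of a reference with values in `[1/4, 3/4]`,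
and only a fraction `p` of the hypotheses lies close to any given one, then `p * exp (6 * χ) ≤ 9 /
16` forces an error. No packing is extracted: the fraction `p` comes from a Chernoff bound for a
uniformly random hypothesis.

Smoothness term (`exists_hasLowerBound_smooth`): the labels are fixed, and the transform
coefficients at the lowest `L₀` frequencies of the class pairs with many edges are chosen from `{0,
γ}`. Orthogonality of `H` turns tensor distances into weighted Hamming distances. With `γ` of order
`m / n`, the cutoff `L₀ = min L ⌊(n / m) ^ (2 / (2 ν₀ + 1))⌋` is the largest allowed by the
smoothness class, up to constants; the two cases of this minimum give the two cases in the rate.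

Label terms (`exists_hasLowerBound_labels`, `exists_hasLowerBound_changes`): the probabilities are
`1 / 2 + δ g`, constant in time, and the labeling varies. A `LabelFamily` is a spread-out set of
balanced labelings near a base. One member kept for all times gives the `log m` term; independent
members at every second time, with the base in between, give the `n₀` term. For `n₀ ≥ 2` the members
come from exchanging pairs of nodes, which keeps all class sizes; random matchings of nodes to
labels make the family large enough for the logarithm, and a pattern `g` built from a binary simplex
code makes every relabeling visible on order `n` edges. For `n₀ = 1` no exchange is possible: a
single node moves, and the non-constant balanced family supplies a class which can lose a node and
one which can gain it. -/

namespace DSBM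

/-! ### Reduction to finite sums, the `χ²` divergence and Fano's inequality -/

/-- The mass of `b` under the Bernoulli law with success probability `p`. -/
def edgeMass (p : ℝ) (b : Bool) : ℝ := if b then p else 1 - p

/-- The mass of `B` under the product of Bernoulli laws with success probabilities `p`. -/
def productMass {ι : Type*} [Fintype ι] (p : ι → ℝ) (B : ι → Bool) : ℝ :=
  ∏ e, edgeMass (p e) (B e)

lemma edgeMass_nonneg {p : ℝ} (h0 : 0 ≤ p) (h1 : p ≤ 1) (b : Bool) : 0 ≤ edgeMass p b := by
  unfold edgeMass; split_ifs <;> linarith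

lemma productMass_nonneg {ι : Type*} [Fintype ι] {p : ι → ℝ} (h0 : ∀ e, 0 ≤ p e)
    (h1 : ∀ e, p e ≤ 1) (B : ι → Bool) : 0 ≤ productMass p B :=
  Finset.prod_nonneg fun e _ => edgeMass_nonneg (h0 e) (h1 e) _

lemma sum_prod_pi {ι Θ : Type*} [Fintype ι] [DecidableEq ι] [Fintype Θ] (f : ι → Θ → ℝ) :
    ∑ ω : ι → Θ, ∏ s, f s (ω s) = ∏ s, ∑ θ, f s θ := by
  rw [← Fintype.piFinset_univ, ← Finset.prod_univ_sum]

lemma sum_prod_bool {ι : Type*} [Fintype ι] [DecidableEq ι] (f : ι → Bool → ℝ) :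
    ∑ B : ι → Bool, ∏ e, f e (B e) = ∏ e, (f e true + f e false) := by
  simp [sum_prod_pi]

lemma sum_productMass {ι : Type*} [Fintype ι] [DecidableEq ι] (p : ι → ℝ) :
    ∑ B, productMass p B = 1 := by
  unfold productMass
  rw [sum_prod_bool]
  simp [edgeMass]

/-- The sum is `1` plus the `χ²` divergence and factorizes over edges. One edge gives `1 + (p - q)²
/ (q (1 - q))`, and `q (1 - q) ≥ 3 / 16` on `[1/4, 3/4]`, so the factor is at most `1 + 6 (p - q)² ≤
exp (6 (p - q)²)`. -/
lemma sum_productMass_sq_div_le {ι : Type*} [Fintype ι] [DecidableEq ι] (p q : ι → ℝ)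
    (h0 : ∀ e, 1 / 4 ≤ q e) (h1 : ∀ e, q e ≤ 3 / 4) :
    ∑ B, productMass p B ^ 2 / productMass q B ≤ Real.exp (6 * ∑ e, (p e - q e) ^ 2) := by
  unfold productMass
  simp_rw [← Finset.prod_pow, ← Finset.prod_div_distrib]
  rw [sum_prod_bool (fun e b => edgeMass (p e) b ^ 2 / edgeMass (q e) b), Finset.mul_sum,
    Real.exp_sum]
  refine Finset.prod_le_prod (fun e _ => ?_) (fun e _ => ?_)
  · have := h0 e
    have := h1 e
    have h2 : 0 ≤ edgeMass (q e) true := edgeMass_nonneg (by linarith) (by linarith) _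
    have h3 : 0 ≤ edgeMass (q e) false := edgeMass_nonneg (by linarith) (by linarith) _
    positivity
  · have h2 := h0 e
    have h3 := h1 e
    refine le_trans ?_ (Real.add_one_le_exp _)
    have hq : 0 < q e := by linarith
    have hq' : 0 < 1 - q e := by linarith
    simp only [edgeMass, if_true, Bool.false_eq_true, if_false]
    rw [div_add_div _ _ hq.ne' hq'.ne', div_le_iff₀ (mul_pos hq hq')]
    have h4 : 3 / 16 ≤ q e * (1 - q e) := by nlinarith
    nlinarith [mul_nonneg (sq_nonneg (p e - q e)) (sub_nonneg.2 h4)]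

lemma networkLaw_apply {n L : ℕ} (Λ : Fin n → Fin n → Fin L → I) (S : Finset (Network n L)) :
    networkLaw Λ S = ENNReal.ofReal
      (∑ B ∈ S, productMass (fun e : NodePair n × Fin L => (Λ e.1.1.1 e.1.1.2 e.2 : ℝ)) B) := by
  classical
  rw [← MeasureTheory.sum_measure_singleton, ENNReal.ofReal_sum_of_nonneg]
  · refine Finset.sum_congr rfl fun B _ => ?_
    unfold networkLaw
    rw [MeasureTheory.Measure.pi_singleton]
    unfold productMass
    rw [ENNReal.ofReal_prod_of_nonneg]
    · refine Finset.prod_congr rfl fun e _ => ?_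
      rw [ProbabilityTheory.bernoulliMeasure_apply _ (by simp)]
      have hI : ∀ x : I, (unitInterval.toNNReal x : ℝ≥0∞) = ENNReal.ofReal x := fun x => by
        rw [ENNReal.ofReal_eq_coe_nnreal (unitInterval.nonneg x)]; rfl
      cases h : B e
      · simp only [Set.mem_singleton_iff, edgeMass, Bool.true_eq_false, Bool.false_eq_true,
          if_false, if_true]
        rw [← unitInterval.coe_symm_eq, hI]
      · simp [edgeMass, hI]
    · intro e _
      exact edgeMass_nonneg (unitInterval.nonneg _) (unitInterval.le_one _) _
  · intro B _
    exact productMass_nonneg (fun e => unitInterval.nonneg _) (fun e => unitInterval.le_one _) _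

/-- A Fano inequality with the `χ²` divergence: if no observation lies in more than `N` of the sets
`A ω`, then some hypothesis gives its set at most the mass `3 / 4`. -/
theorem exists_sum_mass_le {β Ω : Type*} [Fintype β] [Fintype Ω] [Nonempty Ω] [DecidableEq β]
    (P : Ω → β → ℝ) (Q : β → ℝ) (hQ : ∀ b, 0 < Q b) (hQ1 : ∑ b, Q b = 1) (A : Ω → Finset β)
    {N X : ℝ} (hN : ∀ b, ((Finset.univ.filter fun ω => b ∈ A ω).card : ℝ) ≤ N)
    (hX : ∀ ω, ∑ b, P ω b ^ 2 / Q b ≤ X) (hNX : N * X ≤ 9 / 16 * Fintype.card Ω) :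
    ∃ ω, ∑ b ∈ A ω, P ω b ≤ 3 / 4 := by
  by_contra! hcon
  set M : ℝ := (Fintype.card Ω : ℝ) with hM
  have hM0 : 0 < M := by simpa [hM] using (Fintype.card_pos : 0 < Fintype.card Ω)
  have h1 : 3 / 4 * M < ∑ ω, ∑ b ∈ A ω, P ω b := by
    have : ∑ _ω : Ω, (3 / 4 : ℝ) < ∑ ω, ∑ b ∈ A ω, P ω b :=
      Finset.sum_lt_sum_of_nonempty Finset.univ_nonempty fun ω _ => hcon ω
    simpa [hM, mul_comm] using this
  -- Splitting `P = √Q * (P / √Q)` prepares Cauchy–Schwarz over pairs `(ω, b)`: one factor measures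
  -- the overlap of the sets `A ω` (at most `N`), the other the divergences (at most `M * X`).
  have h2 : ∑ ω, ∑ b ∈ A ω, P ω b
      = ∑ x : Ω × β, (if x.2 ∈ A x.1 then √(Q x.2) else 0) * (P x.1 x.2 / √(Q x.2)) := by
    rw [Fintype.sum_prod_type]
    refine Finset.sum_congr rfl fun ω _ => ?_
    trans ∑ b, if b ∈ A ω then P ω b else 0
    · simp
    · refine Finset.sum_congr rfl fun b _ => ?_
      split_ifs
      · exact (mul_div_cancel₀ _ (Real.sqrt_pos.2 (hQ b)).ne').symm
      · simp
  have h3 : (∑ x : Ω × β, (if x.2 ∈ A x.1 then √(Q x.2) else 0) * (P x.1 x.2 / √(Q x.2))) ^ 2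
      ≤ (∑ x : Ω × β, (if x.2 ∈ A x.1 then √(Q x.2) else 0) ^ 2)
        * ∑ x : Ω × β, (P x.1 x.2 / √(Q x.2)) ^ 2 := Finset.sum_mul_sq_le_sq_mul_sq _ _ _
  have h4 : ∑ x : Ω × β, (if x.2 ∈ A x.1 then √(Q x.2) else 0) ^ 2 ≤ N := by
    rw [Fintype.sum_prod_type_right]
    calc _ = ∑ b, ((Finset.univ.filter fun ω => b ∈ A ω).card : ℝ) * Q b := by
          refine Finset.sum_congr rfl fun b _ => ?_
          rw [Finset.card_filter, Nat.cast_sum, Finset.sum_mul]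
          refine Finset.sum_congr rfl fun ω _ => ?_
          split_ifs <;> simp [Real.sq_sqrt (hQ b).le]
      _ ≤ ∑ b, N * Q b := Finset.sum_le_sum fun b _ =>
          mul_le_mul_of_nonneg_right (hN b) (hQ b).le
      _ = N := by rw [← Finset.mul_sum, hQ1, mul_one]
  have h5 : ∑ x : Ω × β, (P x.1 x.2 / √(Q x.2)) ^ 2 ≤ M * X := by
    rw [Fintype.sum_prod_type]
    calc _ ≤ ∑ _ω : Ω, X := Finset.sum_le_sum fun ω _ => by
          refine le_trans (le_of_eq ?_) (hX ω)
          refine Finset.sum_congr rfl fun b _ => ?_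
          rw [div_pow, Real.sq_sqrt (hQ b).le]
      _ = M * X := by simp [hM]
  have h6 : 0 ≤ ∑ x : Ω × β, (P x.1 x.2 / √(Q x.2)) ^ 2 :=
    Finset.sum_nonneg fun _ _ => sq_nonneg _
  have h8 : 0 ≤ ∑ x : Ω × β, (if x.2 ∈ A x.1 then √(Q x.2) else 0) ^ 2 :=
    Finset.sum_nonneg fun _ _ => sq_nonneg _
  have h7 := mul_le_mul h4 h5 h6 (h8.trans h4)
  rw [← h2] at h3
  nlinarith [mul_le_mul_of_nonneg_left hNX hM0.le, mul_pos hM0 hM0]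

/-- The squared distance of two tensors. -/
def sqDist {n L : ℕ} (A B : Fin n → Fin n → Fin L → ℝ) : ℝ :=
  ∑ i, ∑ j, ∑ l, (A i j l - B i j l) ^ 2

lemma sqDist_le_two_mul {n L : ℕ} (A B D : Fin n → Fin n → Fin L → ℝ) :
    sqDist B D ≤ 2 * (sqDist A B + sqDist A D) := by
  unfold sqDist
  simp only [← Finset.sum_add_distrib, Finset.mul_sum]
  refine Finset.sum_le_sum fun i _ => Finset.sum_le_sum fun j _ => Finset.sum_le_sum fun l _ => ?_
  nlinarith [sq_nonneg (A i j l - B i j l + (A i j l - D i j l))]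

/-- A lower bound for estimation from a finite family of hypotheses of which only a fraction `p`
lies close to any given one. -/
theorem exists_networkLaw_ge {n L : ℕ} {Ω : Type*} [Fintype Ω] [Nonempty Ω]
    (Λ : Ω → Fin n → Fin n → Fin L → I) (Λ₀ : NodePair n × Fin L → ℝ)
    (h0 : ∀ e, 1 / 4 ≤ Λ₀ e) (h1 : ∀ e, Λ₀ e ≤ 3 / 4) {χ t p : ℝ}
    (hχ : ∀ ω, ∑ e : NodePair n × Fin L, ((Λ ω e.1.1.1 e.1.1.2 e.2 : ℝ) - Λ₀ e) ^ 2 ≤ χ)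
    (hp : ∀ ω', ((Finset.univ.filter fun ω =>
      sqDist (fun i j l => (Λ ω i j l : ℝ)) (fun i j l => (Λ ω' i j l : ℝ)) < 4 * t).card : ℝ)
        ≤ p * Fintype.card Ω) (hp0 : 0 ≤ p)
    (hpχ : p * Real.exp (6 * χ) ≤ 9 / 16) (Λ' : Estimator n L) :
    ∃ ω, (1 / 4 : ℝ≥0∞) ≤
      networkLaw (Λ ω) {B | t ≤ sqDist (Λ' B) (fun i j l => (Λ ω i j l : ℝ))} := by
  classical
  set A : Ω → Finset (Network n L) := fun ω =>
    Finset.univ.filter fun B => sqDist (Λ' B) (fun i j l => (Λ ω i j l : ℝ)) < t with hA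
  obtain ⟨ω, hω⟩ := exists_sum_mass_le
    (fun ω => productMass (fun e : NodePair n × Fin L => (Λ ω e.1.1.1 e.1.1.2 e.2 : ℝ)))
    (productMass Λ₀)
    (fun B => Finset.prod_pos fun e _ => by
      have := h0 e
      have := h1 e
      unfold edgeMass
      split_ifs <;> linarith)
    (sum_productMass _) A (N := p * Fintype.card Ω) (X := Real.exp (6 * χ))
    (by
      intro B
      -- An estimate within `t` of both `Λ ω` and `Λ ω'` puts them within `4 * t` of each other, so
      -- all `ω` with `B ∈ A ω` lie in one ball.
      rcases (Finset.univ.filter fun ω => B ∈ A ω).eq_empty_or_nonempty with h | ⟨ω', hω'⟩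
      · rw [h]; simp; positivity
      · refine le_trans ?_ (hp ω')
        refine Nat.cast_le.2 (Finset.card_le_card fun ω hω => ?_)
        simp only [hA, Finset.mem_filter, Finset.mem_univ, true_and] at hω hω' ⊢
        have := sqDist_le_two_mul (Λ' B) (fun i j l => (Λ ω i j l : ℝ))
          (fun i j l => (Λ ω' i j l : ℝ))
        linarith)
    (fun ω => (sum_productMass_sq_div_le _ _ h0 h1).trans
      (Real.exp_le_exp.2 (mul_le_mul_of_nonneg_left (hχ ω) (by norm_num))))
    (by
      have : (0 : ℝ) ≤ Fintype.card Ω := by positivity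
      nlinarith)
  refine ⟨ω, ?_⟩
  have hset : {B | t ≤ sqDist (Λ' B) (fun i j l => (Λ ω i j l : ℝ))}
      = (((A ω)ᶜ : Finset (Network n L)) : Set (Network n L)) := by
    ext B; simp [hA]
  rw [hset, networkLaw_apply]
  have htot := sum_productMass (fun e : NodePair n × Fin L => (Λ ω e.1.1.1 e.1.1.2 e.2 : ℝ))
  rw [← Finset.sum_add_sum_compl (A ω)] at htot
  have : (1 / 4 : ℝ≥0∞) = ENNReal.ofReal (1 / 4) := by
    rw [ENNReal.ofReal_div_of_pos (by norm_num)]; simp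
  rw [this]
  exact ENNReal.ofReal_le_ofReal (by linarith)

/-! ### Balanced labelings and the lower bound property -/

/-- The class sizes of a labeling lie between `a₁ n / m` and `a₂ n / m`. -/
def IsBalanced {m n : ℕ} (a₁ a₂ : ℝ) (ζ : Fin n → Fin m) : Prop :=
  ∀ k : Fin m, a₁ * ((n : ℝ) / m) ≤ ((Finset.univ.filter fun i => ζ i = k).card : ℝ) ∧
    ((Finset.univ.filter fun i => ζ i = k).card : ℝ) ≤ a₂ * ((n : ℝ) / m)

/-- Every estimator has a normalized error of at least `t` with probability at least `1 / 4` for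
some parameter. -/
def HasLowerBound (m n n₀ : ℕ) {L : ℕ} (H : Matrix (Fin L) (Fin L) ℝ) (ν₀ K₀ a₁ a₂ t : ℝ) : Prop :=
  ∀ Λ' : Estimator n L, ∃ G ∈ smoothClass m H ν₀ K₀, ∃ z ∈ balancedClusterings m n n₀ L a₁ a₂,
    (1 / 4 : ℝ≥0∞) ≤ networkLaw (probTensor G z) {B | t ≤ normError (Λ' B) (probTensor G z)}

lemma HasLowerBound.mono {m n n₀ L : ℕ} {H : Matrix (Fin L) (Fin L) ℝ} {ν₀ K₀ a₁ a₂ t t' : ℝ}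
    (h : HasLowerBound m n n₀ H ν₀ K₀ a₁ a₂ t) (htt : t' ≤ t) :
    HasLowerBound m n n₀ H ν₀ K₀ a₁ a₂ t' := by
  intro Λ'
  obtain ⟨G, hG, z, hz, hle⟩ := h Λ'
  exact ⟨G, hG, z, hz, hle.trans (MeasureTheory.measure_mono fun B hB => htt.trans hB)⟩

lemma normError_eq {n L : ℕ} (Λ' : Fin n → Fin n → Fin L → ℝ) (Λ : Fin n → Fin n → Fin L → I) :
    normError Λ' Λ = sqDist Λ' (fun i j l => (Λ i j l : ℝ)) / ((n : ℝ) ^ 2 * L) := rfl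

/-- By `H 1 = √L e₁` a constant curve has only the coefficient of index `0`, whose weight `0 ^ (2
ν₀)` vanishes. -/
lemma const_mem_smoothClass {m L : ℕ} {H : Matrix (Fin L) (Fin L) ℝ} (hH : TransformCond H)
    {ν₀ K₀ : ℝ} (hν₀ : 1 / 2 < ν₀) (hK₀ : 0 < K₀) (g : Fin m → Fin m → I)
    (hg : ∀ k k', g k k' = g k' k) : (fun k k' _ => g k k') ∈ smoothClass m H ν₀ K₀ := by
  refine ⟨fun k k' _ => hg k k', fun k => ?_⟩
  refine (Finset.sum_nonpos fun l _ => ?_).trans hK₀.le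
  have h1 : coefMatrix H (fun k k' _ => g k k') k l
      = (g k.1.1 k.1.2 : ℝ) * (if (l : ℕ) = 0 then √(L : ℝ) else 0) := by
    have := congrFun hH.mulVec_one l
    rw [← this]
    simp [coefMatrix, rowMatrix, Matrix.mul_apply, Matrix.mulVec, dotProduct, Finset.mul_sum]
  rw [h1]
  split_ifs with h
  · rw [h, Nat.cast_zero, Real.zero_rpow (by linarith)]; simp
  · simp

/-! ### Families of labelings and the bounds they give over time -/

/-- The squared distance of the edge patterns which a pattern `g` on the classes induces under two
labelings, without loops. -/
def patternDist {m n : ℕ} (g : Fin m → Fin m → ℝ) (ζ ζ' : Fin n → Fin m) : ℝ :=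
  ∑ i, ∑ j, if i = j then 0 else (g (ζ i) (ζ j) - g (ζ' i) (ζ' j)) ^ 2

/-- A finite family of labelings that differ from a base labeling in at most `V` nodes and are
spread out: the fraction of the family close to a given member is exponentially small in `ρ`. -/
structure LabelFamily {m n : ℕ} (P : (Fin n → Fin m) → Prop) (V : ℕ) (ρ α : ℝ) where
  Θ : Type
  fintype : Fintype Θ
  nonempty : Nonempty Θ
  base : Fin n → Fin m
  label : Θ → Fin n → Fin m
  g : Fin m → Fin m → ℝ
  gap : Θ → Θ → ℝ
  lam : ℝ
  d : ℝ
  base_prop : P base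
  label_prop : ∀ θ, P (label θ)
  g_symm : ∀ k k', g k k' = g k' k
  g_nonneg : ∀ k k', 0 ≤ g k k'
  g_le_one : ∀ k k', g k k' ≤ 1
  card_ne_le : ∀ θ, (Finset.univ.filter fun i => label θ i ≠ base i).card ≤ V
  gap_le : ∀ θ θ', gap θ θ' ≤ patternDist g (label θ) (label θ')
  lam_pos : 0 < lam
  -- Spread is stated as an exponential moment because this form tensorizes over independent
  -- coordinates; a plain bound on the fraction with `gap < d` would not.
  sum_exp_le : ∀ θ', ∑ θ, Real.exp (-lam * gap θ θ') ≤ Real.exp (-lam * d - ρ) * Fintype.card Θ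
  -- Up to `δ²`, a member costs at most `2 * n * V` in divergence and gains `d` in separation; `α`
  -- bounds the gain per cost from below. The upper bound on `ρ` keeps `δ ≤ 1 / 4`.
  le_d : α * n * V ≤ d
  le_rho : 3 / 5 ≤ ρ
  rho_le : ρ ≤ n * V

namespace LabelFamily

variable {m n : ℕ} {P : (Fin n → Fin m) → Prop} {V : ℕ} {ρ α : ℝ}

attribute [instance] LabelFamily.fintype LabelFamily.nonempty

/-- The labelings over time: `τ l` says which free coordinate determines the labeling at time `l`,
and the base labeling is used if there is none. -/
def clustering (F : LabelFamily P V ρ α) {L : ℕ} {S : Type} (τ : Fin L → Option S) (ω : S → F.Θ) :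
    Clustering m n L :=
  fun l => (τ l).elim F.base fun s => F.label (ω s)

/-- The constant-in-time connection probabilities `1 / 2 + δ g`. -/
noncomputable def tensor (F : LabelFamily P V ρ α) (L : ℕ) (δ : ℝ) (h0 : 0 ≤ δ) (h1 : δ ≤ 1 / 4) :
    ClassTensor m L :=
  fun k k' _ => ⟨1 / 2 + δ * F.g k k', by
    have := F.g_nonneg k k'
    have := F.g_le_one k k'
    constructor <;> nlinarith⟩

lemma tensor_mem_smoothClass (F : LabelFamily P V ρ α) {L : ℕ} {H : Matrix (Fin L) (Fin L) ℝ}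
    (hH : TransformCond H) {ν₀ K₀ : ℝ} (hν₀ : 1 / 2 < ν₀) (hK₀ : 0 < K₀) (δ : ℝ) (h0 : 0 ≤ δ)
    (h1 : δ ≤ 1 / 4) : F.tensor L δ h0 h1 ∈ smoothClass m H ν₀ K₀ :=
  const_mem_smoothClass hH hν₀ hK₀ (fun k k' => ⟨1 / 2 + δ * F.g k k', _⟩)
    fun k k' => Subtype.ext (by simp [F.g_symm k k'])

lemma sum_option_comp {L : ℕ} {S : Type} [Fintype S] [DecidableEq S] (τ : Fin L → Option S) {r : ℕ}
    (hτ : ∀ s, (Finset.univ.filter fun l => τ l = some s).card = r) (f : S → ℝ) :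
    ∑ l, (τ l).elim 0 f = r * ∑ s, f s := by
  rw [← Finset.sum_fiberwise Finset.univ τ, Fintype.sum_option, Finset.mul_sum]
  have h1 : ∑ l with τ l = none, (τ l).elim 0 f = 0 :=
    Finset.sum_eq_zero fun l hl => by rw [(Finset.mem_filter.1 hl).2]; rfl
  rw [h1, zero_add]
  refine Finset.sum_congr rfl fun s _ => ?_
  rw [← hτ s, ← nsmul_eq_mul, ← Finset.sum_const]
  refine Finset.sum_congr rfl fun l hl => ?_
  rw [(Finset.mem_filter.1 hl).2]; rfl

lemma sqDist_probTensor (F : LabelFamily P V ρ α) {L : ℕ} {S : Type} [Fintype S] [DecidableEq S]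
    (τ : Fin L → Option S) {r : ℕ}
    (hτ : ∀ s, (Finset.univ.filter fun l => τ l = some s).card = r) (δ : ℝ) (h0 : 0 ≤ δ)
    (h1 : δ ≤ 1 / 4) (ω ω' : S → F.Θ) :
    δ ^ 2 * (r * ∑ s, F.gap (ω s) (ω' s)) ≤
      sqDist (fun i j l => (probTensor (F.tensor L δ h0 h1) (F.clustering τ ω) i j l : ℝ))
        (fun i j l => (probTensor (F.tensor L δ h0 h1) (F.clustering τ ω') i j l : ℝ)) := by
  have hswap : ∀ f : Fin n → Fin n → Fin L → ℝ, ∑ i, ∑ j, ∑ l, f i j l = ∑ l, ∑ i, ∑ j, f i j l :=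
    fun f => (Finset.sum_congr rfl fun i _ => Finset.sum_comm).trans Finset.sum_comm
  unfold sqDist
  rw [hswap, ← sum_option_comp τ hτ, Finset.mul_sum]
  refine Finset.sum_le_sum fun l _ => ?_
  cases hl : τ l with
  | none => simpa using Finset.sum_nonneg fun i _ => Finset.sum_nonneg fun j _ => sq_nonneg _
  | some s =>
    refine (mul_le_mul_of_nonneg_left (F.gap_le (ω s) (ω' s)) (sq_nonneg δ)).trans (le_of_eq ?_)
    unfold patternDist
    rw [Finset.mul_sum]
    refine Finset.sum_congr rfl fun i _ => ?_
    rw [Finset.mul_sum]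
    refine Finset.sum_congr rfl fun j _ => ?_
    simp only [probTensor, tensor, clustering, hl, Option.elim]
    split_ifs
    · simp
    · simp only
      ring

lemma sum_nodePair_le (f : Fin n → ℝ) (hf : ∀ i, 0 ≤ f i) :
    ∑ e : NodePair n, (f e.1.1 + f e.1.2) ≤ 2 * n * ∑ i, f i := by
  have h1 : ∑ e : NodePair n, (f e.1.1 + f e.1.2)
      ≤ ∑ x : Fin n × Fin n, (f x.1 + f x.2) := by
    refine le_trans (le_of_eq (Finset.sum_map Finset.univ (Function.Embedding.subtype _)
      fun x : Fin n × Fin n => f x.1 + f x.2).symm) ?_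
    exact Finset.sum_le_sum_of_subset_of_nonneg (Finset.subset_univ _)
      fun x _ _ => add_nonneg (hf _) (hf _)
  refine h1.trans (le_of_eq ?_)
  rw [Fintype.sum_prod_type]
  simp only [Finset.sum_add_distrib, Finset.sum_const, Finset.card_univ, Fintype.card_fin,
    nsmul_eq_mul, ← Finset.mul_sum]
  ring

/-- An edge probability differs from the base only if an endpoint is relabeled, and at most `2 * n *
V` pairs are counted this way at each time governed by a free coordinate. -/
lemma sum_sub_base_sq_le (F : LabelFamily P V ρ α) {L : ℕ} {S : Type} [Fintype S] [DecidableEq S]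
    (τ : Fin L → Option S) {r : ℕ}
    (hτ : ∀ s, (Finset.univ.filter fun l => τ l = some s).card = r) (δ : ℝ) (h0 : 0 ≤ δ)
    (h1 : δ ≤ 1 / 4) (ω : S → F.Θ) :
    ∑ e : NodePair n × Fin L,
      ((probTensor (F.tensor L δ h0 h1) (F.clustering τ ω) e.1.1.1 e.1.1.2 e.2 : ℝ)
        - (1 / 2 + δ * F.g (F.base e.1.1.1) (F.base e.1.1.2))) ^ 2
      ≤ δ ^ 2 * (r * (Fintype.card S * (2 * n * V))) := by
  rw [Fintype.sum_prod_type_right]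
  have h2 : (Fintype.card S * (2 * n * V) : ℝ) = ∑ _s : S, (2 * n * V : ℝ) := by simp
  rw [h2, ← sum_option_comp τ hτ, Finset.mul_sum]
  refine Finset.sum_le_sum fun l _ => ?_
  have hne : ∀ e : NodePair n, e.1.1 ≠ e.1.2 := fun e => e.2.ne
  cases hl : τ l with
  | none => simp [probTensor, tensor, clustering, hl, hne]
  | some s =>
    set f : Fin n → ℝ := fun i => if F.label (ω s) i ≠ F.base i then 1 else 0 with hf
    have hf0 : ∀ i, 0 ≤ f i := fun i => by simp only [hf]; split_ifs <;> norm_num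
    have hsum : ∑ i, f i ≤ V := by
      have := F.card_ne_le (ω s)
      rw [Finset.card_filter] at this
      simp only [hf]
      exact_mod_cast this
    calc _ ≤ ∑ e : NodePair n, δ ^ 2 * (f e.1.1 + f e.1.2) := by
          refine Finset.sum_le_sum fun e _ => ?_
          simp only [probTensor, tensor, clustering, hl, Option.elim, hne e, if_false]
          have e1 : (1 / 2 + δ * F.g (F.label (ω s) e.1.1) (F.label (ω s) e.1.2) -
              (1 / 2 + δ * F.g (F.base e.1.1) (F.base e.1.2))) ^ 2
              = δ ^ 2 * (F.g (F.label (ω s) e.1.1) (F.label (ω s) e.1.2) -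
                F.g (F.base e.1.1) (F.base e.1.2)) ^ 2 := by ring
          rw [e1]
          refine mul_le_mul_of_nonneg_left ?_ (sq_nonneg δ)
          have b1 := F.g_nonneg (F.label (ω s) e.1.1) (F.label (ω s) e.1.2)
          have b2 := F.g_le_one (F.label (ω s) e.1.1) (F.label (ω s) e.1.2)
          have b3 := F.g_nonneg (F.base e.1.1) (F.base e.1.2)
          have b4 := F.g_le_one (F.base e.1.1) (F.base e.1.2)
          by_cases c1 : F.label (ω s) e.1.1 = F.base e.1.1
          · by_cases c2 : F.label (ω s) e.1.2 = F.base e.1.2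
            · rw [c1, c2]; simpa using add_nonneg (hf0 _) (hf0 _)
            · have : f e.1.2 = 1 := by simp [hf, c2]
              have := hf0 e.1.1
              nlinarith
          · have : f e.1.1 = 1 := by simp [hf, c1]
            have := hf0 e.1.2
            nlinarith
      _ ≤ δ ^ 2 * (2 * n * V) := by
          rw [← Finset.mul_sum]
          refine mul_le_mul_of_nonneg_left ((sum_nodePair_le f hf0).trans ?_) (sq_nonneg δ)
          gcongr

/-- Chernoff's bound for a uniform `ω`: its coordinates are independent, so the exponential moment
of the total gap is a product, and each factor is bounded by `sum_exp_le`. -/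
lemma card_close_le (F : LabelFamily P V ρ α) {S : Type} [Fintype S] [DecidableEq S]
    (ω' : S → F.Θ) :
    ((Finset.univ.filter fun ω : S → F.Θ =>
      ∑ s, F.gap (ω s) (ω' s) < F.d * Fintype.card S).card : ℝ)
      ≤ Real.exp (-ρ * Fintype.card S) * Fintype.card (S → F.Θ) := by
  have h1 : ((Finset.univ.filter fun ω : S → F.Θ =>
      ∑ s, F.gap (ω s) (ω' s) < F.d * Fintype.card S).card : ℝ)
      ≤ ∑ ω : S → F.Θ, Real.exp (F.lam * F.d * Fintype.card S) *
        ∏ s, Real.exp (-F.lam * F.gap (ω s) (ω' s)) := by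
    rw [Finset.card_filter, Nat.cast_sum]
    refine Finset.sum_le_sum fun ω _ => ?_
    rw [← Real.exp_sum, ← Real.exp_add, ← Finset.mul_sum]
    split_ifs with h
    · rw [Nat.cast_one]
      refine Real.one_le_exp ?_
      nlinarith [F.lam_pos]
    · rw [Nat.cast_zero]; positivity
  refine h1.trans ?_
  rw [← Finset.mul_sum, sum_prod_pi (fun s θ => Real.exp (-F.lam * F.gap θ (ω' s)))]
  have h2 : ∏ s, ∑ θ, Real.exp (-F.lam * F.gap θ (ω' s))
      ≤ (Real.exp (-F.lam * F.d - ρ) * Fintype.card F.Θ) ^ Fintype.card S := by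
    rw [← Finset.card_univ (α := S), ← Finset.prod_const]
    exact Finset.prod_le_prod (fun s _ => Finset.sum_nonneg fun θ _ => (Real.exp_pos _).le)
      fun s _ => F.sum_exp_le (ω' s)
  refine (mul_le_mul_of_nonneg_left h2 (Real.exp_pos _).le).trans (le_of_eq ?_)
  rw [mul_pow, ← mul_assoc, ← Real.exp_nat_mul, ← Real.exp_add, Fintype.card_fun, Nat.cast_pow]
  congr 2
  ring

/-- The fraction of close hypotheses is `exp (-ρ |S|)`, so a divergence budget proportional to `ρ
|S|` is affordable. This fixes `δ²` of order `ρ / (n V r)` and yields an error of order `α ρ |S|`,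
free of `V` and `r`. -/
theorem exists_networkLaw_ge (F : LabelFamily P V ρ α) {L : ℕ} {S : Type} [Fintype S]
    [DecidableEq S] [Nonempty S] (τ : Fin L → Option S) {r : ℕ} (hr : r ≠ 0)
    (hτ : ∀ s, (Finset.univ.filter fun l => τ l = some s).card = r) :
    ∃ (δ : ℝ) (h0 : 0 ≤ δ) (h1 : δ ≤ 1 / 4), ∀ Λ' : Estimator n L, ∃ ω : S → F.Θ,
      (1 / 4 : ℝ≥0∞) ≤ networkLaw (probTensor (F.tensor L δ h0 h1) (F.clustering τ ω))
        {B | α * ρ * Fintype.card S / 2400 ≤ sqDist (Λ' B)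
          (fun i j l => (probTensor (F.tensor L δ h0 h1) (F.clustering τ ω) i j l : ℝ))} := by
  have hρ := F.le_rho
  have hnV : (0 : ℝ) < n * V := by have := F.rho_le; linarith
  have hr1 : (1 : ℝ) ≤ r := by exact_mod_cast Nat.one_le_iff_ne_zero.2 hr
  have hS : (1 : ℝ) ≤ Fintype.card S := by exact_mod_cast Fintype.card_pos (α := S)
  have hq : 0 < ρ / (600 * (n * V) * r) := by positivity
  set δ : ℝ := √(ρ / (600 * (n * V) * r)) with hδ
  have hδ2 : δ ^ 2 = ρ / (600 * (n * V) * r) := Real.sq_sqrt hq.le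
  have h1 : δ ≤ 1 / 4 := by
    rw [hδ, Real.sqrt_le_left (by norm_num), div_le_iff₀ (by positivity)]
    have := F.rho_le
    nlinarith [mul_le_mul_of_nonneg_left hr1 hnV.le]
  refine ⟨δ, Real.sqrt_nonneg _, h1, fun Λ' => ?_⟩
  have hδ2' : δ ^ 2 * (r * (n * V)) = ρ / 600 := by
    rw [hδ2, div_mul_eq_mul_div, div_eq_div_iff (by positivity) (by norm_num)]; ring
  have hδr : 0 < δ ^ 2 * r := by rw [hδ2]; positivity
  obtain ⟨ω, hω⟩ := DSBM.exists_networkLaw_ge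
    (fun ω : S → F.Θ => probTensor (F.tensor L δ (Real.sqrt_nonneg _) h1) (F.clustering τ ω))
    (fun e => 1 / 2 + δ * F.g (F.base e.1.1.1) (F.base e.1.1.2))
    (fun e => by
      have := F.g_nonneg (F.base e.1.1.1) (F.base e.1.1.2)
      have := Real.sqrt_nonneg (ρ / (600 * (n * V) * r))
      rw [← hδ] at this
      nlinarith)
    (fun e => by
      have := F.g_le_one (F.base e.1.1.1) (F.base e.1.1.2)
      have := Real.sqrt_nonneg (ρ / (600 * (n * V) * r))
      rw [← hδ] at this
      nlinarith)
    (χ := ρ * Fintype.card S / 300) (t := α * ρ * Fintype.card S / 2400)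
    (p := Real.exp (-ρ * Fintype.card S))
    (fun ω => (F.sum_sub_base_sq_le τ hτ δ (Real.sqrt_nonneg _) h1 ω).trans (le_of_eq (by
      linear_combination (2 * Fintype.card S : ℝ) * hδ2')))
    (fun ω' => by
      refine le_trans (Nat.cast_le.2 (Finset.card_le_card fun ω hω => ?_)) (F.card_close_le ω')
      simp only [Finset.mem_filter, Finset.mem_univ, true_and] at hω ⊢
      have h3 := (F.sqDist_probTensor τ hτ δ (Real.sqrt_nonneg _) h1 ω ω').trans_lt hω
      have h4 : 4 * (α * ρ * Fintype.card S / 2400) ≤ δ ^ 2 * r * (F.d * Fintype.card S) := by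
        have h5 := mul_le_mul_of_nonneg_left F.le_d
          (mul_nonneg hδr.le (zero_le_one.trans hS))
        have h6 : 4 * (α * ρ * Fintype.card S / 2400)
          = δ ^ 2 * r * Fintype.card S * (α * n * V) := by
          linear_combination (-α * Fintype.card S : ℝ) * hδ2'
        rw [h6]
        linarith
      have h7 := h3.trans_le h4
      rw [← mul_assoc] at h7
      exact lt_of_mul_lt_mul_left h7 hδr.le)
    (Real.exp_pos _).le
    (by
      rw [← Real.exp_add]
      have h8 : (1 : ℝ) / 9 * 16 ≤ Real.exp 0.588 := by
        have := Real.sum_le_exp_of_nonneg (x := 0.588) (by norm_num) 4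
        norm_num [Finset.sum_range_succ, Nat.factorial] at this ⊢
        linarith
      -- The divergence costs `6 / 300 = 1 / 50` of the exponent, and `0.588 = (3 / 5) * (49 / 50)`
      -- uses the lower bounds on `ρ` and `|S|`.
      have h9 : Real.exp (-ρ * Fintype.card S + 6 * (ρ * Fintype.card S / 300))
          ≤ Real.exp (-0.588) := by
        refine Real.exp_le_exp.2 ?_
        nlinarith [mul_le_mul hρ hS zero_le_one (by linarith)]
      refine h9.trans ?_
      rw [Real.exp_neg, inv_le_comm₀ (Real.exp_pos _) (by norm_num)]
      linarith)
    Λ'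
  exact ⟨ω, hω⟩

variable {a₁ a₂ : ℝ}

/-- A family of balanced labelings gives a lower bound with clusterings constant in time. -/
theorem hasLowerBound_static (F : LabelFamily (m := m) (n := n) (IsBalanced a₁ a₂) V ρ α) {L : ℕ}
    (hL : 2 ≤ L) {H : Matrix (Fin L) (Fin L) ℝ} (hH : TransformCond H) {ν₀ K₀ : ℝ}
    (hν₀ : 1 / 2 < ν₀) (hK₀ : 0 < K₀) (n₀ : ℕ) :
    HasLowerBound m n n₀ H ν₀ K₀ a₁ a₂ (α * ρ / 2400 / ((n : ℝ) ^ 2 * L)) := by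
  obtain ⟨δ, h0, h1, h⟩ := F.exists_networkLaw_ge (S := Unit) (L := L) (fun _ => some ())
    (r := L) (by omega) (by simp)
  intro Λ'
  obtain ⟨ω, hω⟩ := h Λ'
  refine ⟨_, F.tensor_mem_smoothClass hH hν₀ hK₀ δ h0 h1,
    F.clustering (fun _ => some ()) ω, ⟨fun l l' _ => ?_, fun l => ?_⟩, hω.trans ?_⟩
  · simp [clustering]
  · exact F.label_prop _
  · refine MeasureTheory.measure_mono fun B hB => ?_
    simp only [Set.mem_ofPred_eq, normError_eq] at hB ⊢
    refine div_le_div_of_nonneg_right (le_trans (by simp) hB) (by positivity)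

/-- A family of balanced labelings close to a base gives a lower bound with clusterings that
alternate between the base and members of the family. -/
theorem hasLowerBound_dynamic (F : LabelFamily (m := m) (n := n) (IsBalanced a₁ a₂) V ρ α) {L : ℕ}
    (hL : 2 ≤ L) {H : Matrix (Fin L) (Fin L) ℝ} (hH : TransformCond H) {ν₀ K₀ : ℝ}
    (hν₀ : 1 / 2 < ν₀) (hK₀ : 0 < K₀) (hα : 0 ≤ α) {n₀ : ℕ} (hV : V ≤ n₀) :
    HasLowerBound m n n₀ H ν₀ K₀ a₁ a₂ (α * ρ / 7200 / (n : ℝ) ^ 2) := by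
  have : Nonempty (Fin (L / 2)) := ⟨⟨0, by omega⟩⟩
  -- Zero-based even times carry the base and odd times carry independent members. Of two
  -- consecutive times one is always the base, so at most `V` nodes change.
  set τ : Fin L → Option (Fin (L / 2)) := fun l =>
    if h : (l : ℕ) % 2 = 1 then some ⟨l / 2, by omega⟩ else none with hτ
  obtain ⟨δ, h0, h1, h⟩ := F.exists_networkLaw_ge τ (r := 1) one_ne_zero (by
    intro s
    rw [Finset.card_eq_one]
    refine ⟨⟨2 * s + 1, by omega⟩, ?_⟩
    ext l
    simp only [hτ, Finset.mem_filter, Finset.mem_univ, true_and, Finset.mem_singleton, Fin.ext_iff]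
    split_ifs with hl
    · simp only [Option.some.injEq, Fin.ext_iff]; omega
    · simp; omega)
  intro Λ'
  obtain ⟨ω, hω⟩ := h Λ'
  refine ⟨_, F.tensor_mem_smoothClass hH hν₀ hK₀ δ h0 h1,
    F.clustering τ ω, ⟨fun l l' hll => ?_, fun l => ?_⟩, hω.trans ?_⟩
  · refine le_trans ?_ hV
    rcases Nat.mod_two_eq_zero_or_one l with hl | hl
    · have e1 : τ l = none := by simp [hτ, hl]
      have e2 : (l' : ℕ) % 2 = 1 := by omega
      have e3 : τ l' = some ⟨l' / 2, by omega⟩ := by simp [hτ, e2]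
      simp only [clustering, e1, e3, Option.elim]
      simpa only [ne_comm] using F.card_ne_le (ω ⟨l' / 2, by omega⟩)
    · have e1 : τ l = some ⟨l / 2, by omega⟩ := by simp [hτ, hl]
      have e2 : (l' : ℕ) % 2 = 0 := by omega
      have e3 : τ l' = none := by simp [hτ, e2]
      simp only [clustering, e1, e3, Option.elim]
      exact F.card_ne_le _
  · unfold clustering
    cases hl : τ l with
    | none => exact F.base_prop
    | some s => exact F.label_prop _
  · refine MeasureTheory.measure_mono fun B hB => ?_
    simp only [Set.mem_ofPred_eq, normError_eq] at hB ⊢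
    have hL0 : (0 : ℝ) < L := by exact_mod_cast (by omega : 0 < L)
    -- For `L ≥ 2` at least a third of the times are odd, hence `7200 = 3 * 2400`.
    have hL2 : (L : ℝ) ≤ 3 * (L / 2 : ℕ) := by exact_mod_cast (by omega : L ≤ 3 * (L / 2))
    rw [mul_comm ((n : ℝ) ^ 2), ← div_div]
    refine div_le_div_of_nonneg_right (le_trans ?_ (div_le_div_of_nonneg_right hB hL0.le))
      (by positivity)
    rw [le_div_iff₀ hL0, Fintype.card_fin]
    have hρ := F.le_rho
    have : 0 ≤ α * ρ := mul_nonneg hα (by linarith)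
    nlinarith

end LabelFamily

/-! ### Exponential moments of the Hamming distance -/

lemma exp_neg_four_le : Real.exp (-4) ≤ 0.0184 := by
  have : (-4 : ℝ) = ((4 : ℕ) : ℝ) * (-1) := by norm_num
  rw [this, Real.exp_nat_mul]
  have h := Real.exp_neg_one_lt_d9
  calc Real.exp (-1) ^ 4 ≤ 0.36788 ^ 4 :=
        pow_le_pow_left₀ (Real.exp_pos _).le (h.le.trans (by norm_num)) 4
    _ ≤ 0.0184 := by norm_num

/-- The contribution of one fair bit with `λ = 4`: the moment `(1 + exp (-4)) / 2` pays for the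
distance threshold `1 / 100`, which costs `4 / 100 = 1 / 25`, and for the rate `5 / 8`, just above
the `3 / 5` needed later. -/
lemma one_add_exp_neg_four_div_two_mul_le :
    (1 + Real.exp (-4)) / 2 * Real.exp (1 / 25 + 5 / 8) ≤ 1 := by
  have h1 := exp_neg_four_le
  have h2 : Real.exp (1 / 25 + 5 / 8) ≤ 1.945 := by
    have h3 := Real.exp_bound' (x := 1 / 25 + 5 / 8) (by norm_num) (by norm_num) (n := 6)
      (by norm_num)
    refine h3.trans ?_
    norm_num [Finset.sum_range_succ, Nat.factorial]
  have h3 := Real.exp_pos (-4)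
  have h4 := Real.exp_pos (1 / 25 + 5 / 8)
  calc (1 + Real.exp (-4)) / 2 * Real.exp (1 / 25 + 5 / 8)
      ≤ (1 + 0.0184) / 2 * 1.945 := by gcongr
    _ ≤ 1 := by norm_num

/-- An exponential moment bound for the Hamming distance of a random binary word to a fixed one. -/
lemma sum_exp_hammingDist_le {E : Type*} [Fintype E] [DecidableEq E] (θ' : E → Bool) :
    ∑ θ : E → Bool, Real.exp (-4 * (hammingDist θ θ' : ℝ))
      ≤ Real.exp (-(Fintype.card E / 25 : ℝ) - 5 / 8 * Fintype.card E)
        * Fintype.card (E → Bool) := by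
  have h1 : ∀ θ : E → Bool, Real.exp (-4 * (hammingDist θ θ' : ℝ))
      = ∏ e, (if θ e = θ' e then 1 else Real.exp (-4)) := by
    intro θ
    unfold hammingDist
    rw [Finset.prod_ite, Finset.prod_const_one, one_mul, Finset.prod_const, ← Real.exp_nat_mul,
      mul_comm]
  simp_rw [h1]
  rw [sum_prod_pi fun e b => if b = θ' e then (1 : ℝ) else Real.exp (-4)]
  have h2 : ∀ e, ∑ b, (if b = θ' e then (1 : ℝ) else Real.exp (-4)) = 1 + Real.exp (-4) := by
    intro e
    cases θ' e <;> simp [add_comm]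
  simp_rw [h2]
  rw [Finset.prod_const, Finset.card_univ, Fintype.card_fun, Fintype.card_bool, Nat.cast_pow]
  have h3 := one_add_exp_neg_four_div_two_mul_le
  have h4 : Real.exp (-(Fintype.card E / 25 : ℝ) - 5 / 8 * Fintype.card E)
      = (Real.exp (1 / 25 + 5 / 8))⁻¹ ^ Fintype.card E := by
    rw [← Real.exp_neg, ← Real.exp_nat_mul]; congr 1; ring
  rw [h4, ← mul_pow]
  refine pow_le_pow_left₀ (by positivity) ?_ _
  rw [inv_mul_eq_div, le_div_iff₀ (Real.exp_pos _)]
  push_cast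
  linarith

/-! ### Class pairs and the orthogonal transform -/

/-- The unordered pair of two classes. -/
def pairOf {m : ℕ} (k k' : Fin m) : ClassPair m :=
  if h : k ≤ k' then ⟨(k, k'), h⟩ else ⟨(k', k), (not_le.1 h).le⟩

lemma pairOf_comm {m : ℕ} (k k' : Fin m) : pairOf k k' = pairOf k' k := by
  unfold pairOf
  rcases lt_trichotomy k k' with h | h | h
  · simp [h.le, not_le.2 h]
  · subst h; rfl
  · simp [h.le, not_le.2 h]

lemma pairOf_coe {m : ℕ} (k : ClassPair m) : pairOf k.1.1 k.1.2 = k := by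
  unfold pairOf; rw [dif_pos k.2]

lemma eq_or_eq_of_pairOf_eq {m : ℕ} {k k' : Fin m} {p : ClassPair m} (h : pairOf k k' = p) :
    (k = p.1.1 ∧ k' = p.1.2) ∨ (k = p.1.2 ∧ k' = p.1.1) := by
  subst h
  unfold pairOf
  split_ifs <;> simp

namespace TransformCond

variable {L : ℕ} {H : Matrix (Fin L) (Fin L) ℝ}

lemma mul_transpose_self (hH : TransformCond H) : H * Hᵀ = 1 := by
  have := Matrix.mem_orthogonalGroup_iff (Fin L) ℝ |>.1 hH.orthogonal
  simpa [Matrix.star_eq_conjTranspose] using this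

/-- The binary bound at the basis vector `e_j` gives `|H j l| ≤ 1 / √L`. The cruder bound `1` is
enough, because `ν₀ > 1 / 2` keeps `γ * L₀` bounded. -/
lemma abs_apply_le_one (hH : TransformCond H) (j l : Fin L) : |H j l| ≤ 1 := by
  have h := hH.binary_bound (Pi.single j 1) (fun l => by
    by_cases h : l = j
    · subst h; simp
    · simp [h]) l
  have h1 : (∑ i, |(Pi.single j 1 : Fin L → ℝ) i|) = 1 := by
    rw [Finset.sum_eq_single j] <;> simp +contextual
  rw [h1, Matrix.mulVec_single_one] at h
  refine (h : |H j l| ≤ _).trans ?_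
  have hL : (1 : ℝ) ≤ √L := by
    rw [Real.one_le_sqrt]; exact_mod_cast (by have := j.2; omega : 1 ≤ L)
  exact div_le_one_of_le₀ hL (by positivity)

lemma sum_row_mul_row (hH : TransformCond H) (j j' : Fin L) :
    ∑ l, H j l * H j' l = if j = j' then 1 else 0 := by
  have := congrFun (congrFun hH.mul_transpose_self j) j'
  simpa [Matrix.mul_apply, Matrix.one_apply] using this

lemma sum_row (hH : TransformCond H) (j : Fin L) :
    ∑ l, H j l = if (j : ℕ) = 0 then √(L : ℝ) else 0 := by
  have := congrFun hH.mulVec_one j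
  simpa [Matrix.mulVec, dotProduct] using this

lemma sum_comb_mul_row (hH : TransformCond H) (a : Fin L → ℝ) (j' : Fin L) :
    ∑ l, (∑ j, a j * H j l) * H j' l = a j' := by
  simp_rw [Finset.sum_mul]
  rw [Finset.sum_comm]
  simp_rw [mul_assoc, ← Finset.mul_sum, hH.sum_row_mul_row]
  simp

/-- Parseval's identity for the rows of `H`. -/
lemma sum_comb_sq (hH : TransformCond H) (a : Fin L → ℝ) :
    ∑ l, (∑ j, a j * H j l) ^ 2 = ∑ j, a j ^ 2 := by
  have h : ∀ l, (∑ j, a j * H j l) ^ 2 = ∑ j', a j' * ((∑ j, a j * H j l) * H j' l) := by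
    intro l
    generalize hS : ∑ j, a j * H j l = S
    conv_lhs => rw [sq]; enter [2]; rw [← hS]
    rw [Finset.mul_sum]
    exact Finset.sum_congr rfl fun j' _ => by ring
  simp_rw [h]
  rw [Finset.sum_comm]
  simp_rw [← Finset.mul_sum, hH.sum_comb_mul_row, sq]

end TransformCond

/-! ### Curves with few low-frequency coefficients -/

section Curves

variable {m L : ℕ} {H : Matrix (Fin L) (Fin L) ℝ} {γ : ℝ} {L₀ : ℕ} {x : ClassPair m → Fin L → ℝ}

lemma abs_comb_le (hH : TransformCond H) (hγ0 : 0 ≤ γ) (hγ : γ * L₀ ≤ 1 / 4) (hL₀ : L₀ ≤ L)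
    (h0 : ∀ k j, 0 ≤ x k j) (h1 : ∀ k j, x k j ≤ 1) (h2 : ∀ k (j : Fin L), L₀ ≤ (j : ℕ) → x k j = 0)
    (k : ClassPair m) (l : Fin L) : |γ * ∑ j, x k j * H j l| ≤ 1 / 4 := by
  rw [abs_mul, abs_of_nonneg hγ0]
  refine le_trans (mul_le_mul_of_nonneg_left ?_ hγ0) hγ
  calc |∑ j, x k j * H j l| ≤ ∑ j, |x k j * H j l| := Finset.abs_sum_le_sum_abs _ _
    _ ≤ ∑ j : Fin L, if (j : ℕ) < L₀ then (1 : ℝ) else 0 := by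
        refine Finset.sum_le_sum fun j _ => ?_
        split_ifs with hj
        · rw [abs_mul, abs_of_nonneg (h0 k j)]
          exact mul_le_one₀ (h1 k j) (abs_nonneg _) (hH.abs_apply_le_one j l)
        · rw [h2 k j (not_lt.1 hj)]; simp
    _ = L₀ := by
        rw [← Finset.sum_filter, Finset.sum_const, nsmul_eq_mul, mul_one, Fin.card_filter_val_lt,
          min_eq_right hL₀]

/-- The connection probabilities `1 / 2 + γ ∑ⱼ x k j H j l`. -/
noncomputable def curveTensor (hH : TransformCond H) (hγ0 : 0 ≤ γ) (hγ : γ * L₀ ≤ 1 / 4)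
    (hL₀ : L₀ ≤ L) (h0 : ∀ k j, 0 ≤ x k j) (h1 : ∀ k j, x k j ≤ 1)
    (h2 : ∀ k (j : Fin L), L₀ ≤ (j : ℕ) → x k j = 0) : ClassTensor m L :=
  fun k k' l => ⟨1 / 2 + γ * ∑ j, x (pairOf k k') j * H j l, by
    have := abs_le.1 (abs_comb_le hH hγ0 hγ hL₀ h0 h1 h2 (pairOf k k') l)
    constructor <;> linarith⟩

/-- The level `1 / 2` only enters the unweighted coefficient of index `0`. The remaining
coefficients are at most `γ`, at fewer than `L₀` frequencies of weight at most `L₀ ^ (2 ν₀)`. -/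
lemma curveTensor_mem (hH : TransformCond H) (hγ0 : 0 ≤ γ) (hγ : γ * L₀ ≤ 1 / 4)
    (hL₀ : L₀ ≤ L) (h0 : ∀ k j, 0 ≤ x k j) (h1 : ∀ k j, x k j ≤ 1)
    (h2 : ∀ k (j : Fin L), L₀ ≤ (j : ℕ) → x k j = 0) {ν₀ K₀ : ℝ} (hν₀ : 1 / 2 < ν₀)
    (hK : γ ^ 2 * (L₀ : ℝ) ^ (2 * ν₀ + 1) ≤ K₀) :
    curveTensor hH hγ0 hγ hL₀ h0 h1 h2 ∈ smoothClass m H ν₀ K₀ := by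
  refine ⟨fun k k' l => by simp [curveTensor, pairOf_comm k k'], fun k => ?_⟩
  have hcoef : ∀ j', coefMatrix H (curveTensor hH hγ0 hγ hL₀ h0 h1 h2) k j'
      = 1 / 2 * (if (j' : ℕ) = 0 then √(L : ℝ) else 0) + γ * x k j' := by
    intro j'
    simp only [coefMatrix, rowMatrix, Matrix.mul_apply, Matrix.of_apply, Matrix.transpose_apply,
      curveTensor, pairOf_coe]
    simp_rw [add_mul, mul_assoc]
    rw [Finset.sum_add_distrib, ← Finset.mul_sum, ← Finset.mul_sum, hH.sum_row,
      hH.sum_comb_mul_row]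
  calc _ ≤ ∑ j : Fin L, if (j : ℕ) < L₀ then γ ^ 2 * (L₀ : ℝ) ^ (2 * ν₀) else 0 := by
        refine Finset.sum_le_sum fun j _ => ?_
        rw [hcoef]
        have hnn : 0 ≤ γ ^ 2 * (L₀ : ℝ) ^ (2 * ν₀) := by positivity
        rcases Nat.eq_zero_or_pos (j : ℕ) with hj | hj
        · rw [hj, Nat.cast_zero, Real.zero_rpow (by linarith), zero_mul]
          split_ifs
          · exact hnn
          · rfl
        · rw [if_neg hj.ne', mul_zero, zero_add]
          split_ifs with hjL
          · have e1 : ((j : ℕ) : ℝ) ^ (2 * ν₀) ≤ (L₀ : ℝ) ^ (2 * ν₀) :=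
              Real.rpow_le_rpow (by positivity) (by exact_mod_cast hjL.le) (by linarith)
            have e2 : (γ * x k j) ^ 2 ≤ γ ^ 2 := by
              rw [mul_pow]
              exact mul_le_of_le_one_right (sq_nonneg _) (pow_le_one₀ (h0 k j) (h1 k j))
            rw [mul_comm (γ ^ 2)]
            exact mul_le_mul e1 e2 (sq_nonneg _) (by positivity)
          · rw [h2 k j (not_lt.1 hjL)]; simp
    _ = γ ^ 2 * ((L₀ : ℝ) ^ (2 * ν₀) * L₀) := by
        rw [← Finset.sum_filter, Finset.sum_const, nsmul_eq_mul, Fin.card_filter_val_lt,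
          min_eq_right hL₀]
        ring
    _ ≤ K₀ := by
        rcases Nat.eq_zero_or_pos L₀ with h | h
        · refine le_trans (le_of_eq ?_) hK
          rw [h, Nat.cast_zero, Real.zero_rpow (by linarith : 2 * ν₀ + 1 ≠ 0)]; simp
        · rw [Real.rpow_add_one (by positivity)] at hK
          exact hK

end Curves

/-! ### Numbers of node pairs per class pair -/

section Blocks

variable {m n : ℕ} (ζ : Fin n → Fin m)

/-- The ordered pairs of distinct nodes whose classes form the pair `k`. -/
def block (k : ClassPair m) : Finset (Fin n × Fin n) :=
  Finset.univ.offDiag.filter fun x => pairOf (ζ x.1) (ζ x.2) = k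

lemma sum_offDiag (f : Fin n → Fin n → ℝ) :
    ∑ x ∈ Finset.univ.offDiag, f x.1 x.2 = ∑ i, ∑ j, if i = j then 0 else f i j := by
  rw [← Fintype.sum_prod_type' fun i j => if i = j then 0 else f i j]
  have : (Finset.univ.offDiag : Finset (Fin n × Fin n))
      = Finset.univ.filter fun x => ¬ x.1 = x.2 := by ext; simp
  rw [this, Finset.sum_filter]
  exact Finset.sum_congr rfl fun x _ => by split_ifs <;> rfl

lemma sum_pairOf (f : ClassPair m → ℝ) :
    ∑ i, ∑ j, (if i = j then 0 else f (pairOf (ζ i) (ζ j))) = ∑ k, (block ζ k).card * f k := by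
  rw [← sum_offDiag fun i j => f (pairOf (ζ i) (ζ j)),
    ← Finset.sum_fiberwise _ fun x : Fin n × Fin n => pairOf (ζ x.1) (ζ x.2)]
  refine Finset.sum_congr rfl fun k _ => ?_
  rw [← nsmul_eq_mul, ← Finset.sum_const]
  exact Finset.sum_congr rfl fun x hx => by rw [(Finset.mem_filter.1 hx).2]

lemma sum_card_block : ∑ k, ((block ζ k).card : ℝ) = n * n - n := by
  have h := sum_pairOf ζ fun _ => 1
  simp only [mul_one] at h
  rw [← h, ← sum_offDiag fun _ _ => 1]
  simp [Finset.offDiag_card, Nat.cast_sub (Nat.le_mul_self n)]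

lemma card_block_le {a₁ a₂ : ℝ} (hζ : IsBalanced a₁ a₂ ζ) (k : ClassPair m) :
    ((block ζ k).card : ℝ) ≤ 2 * (a₂ * (n / m)) ^ 2 := by
  set c : Fin m → Finset (Fin n) := fun k => Finset.univ.filter fun i => ζ i = k with hc
  have hsub : block ζ k ⊆ c k.1.1 ×ˢ c k.1.2 ∪ c k.1.2 ×ˢ c k.1.1 := by
    intro x hx
    have := eq_or_eq_of_pairOf_eq (Finset.mem_filter.1 hx).2
    simpa [hc] using this
  have hcard : (block ζ k).card ≤ (c k.1.1).card * (c k.1.2).card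
      + (c k.1.2).card * (c k.1.1).card := by
    refine (Finset.card_le_card hsub).trans ((Finset.card_union_le _ _).trans ?_)
    simp [Finset.card_product]
  have h1 := (hζ k.1.1).2
  have h2 := (hζ k.1.2).2
  have h3 : ((c k.1.1).card : ℝ) * (c k.1.2).card ≤ (a₂ * (n / m)) * (a₂ * (n / m)) :=
    mul_le_mul h1 h2 (by positivity) ((Nat.cast_nonneg _).trans h1)
  calc ((block ζ k).card : ℝ) ≤ (c k.1.1).card * (c k.1.2).card
      + (c k.1.2).card * (c k.1.1).card := by exact_mod_cast hcard
    _ ≤ _ := by nlinarith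

/-- The class pairs with large blocks. -/
noncomputable def largePairs : Finset (ClassPair m) :=
  Finset.univ.filter fun k => ((n : ℝ) / m) ^ 2 / 4 ≤ (block ζ k).card

/-- Pigeonhole: all blocks together hold at least `n² / 2` ordered pairs and the small ones at most
`n² / 4`, so the large ones hold the rest, each at most `2 (a₂ n / m)²`. Restricting to large blocks
is needed since, for example, the diagonal block of a one-node class is empty; it also keeps the
constant independent of `a₁`. -/
lemma card_largePairs_ge {a₁ a₂ : ℝ} (hm : 1 ≤ m) (hmn : 2 * m ≤ n) (hζ : IsBalanced a₁ a₂ ζ) :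
    (m : ℝ) ^ 2 ≤ 8 * a₂ ^ 2 * (largePairs ζ).card := by
  have hm0 : (0 : ℝ) < m := by exact_mod_cast hm
  have hn2 : (2 : ℝ) ≤ n := by exact_mod_cast (by omega : 2 ≤ n)
  have h1 : (n : ℝ) ^ 2 / 2 ≤ ∑ k, ((block ζ k).card : ℝ) := by rw [sum_card_block]; nlinarith
  rw [← Finset.sum_filter_add_sum_filter_not Finset.univ (fun k => k ∈ largePairs ζ)] at h1
  have h2 : ∑ k with k ∈ largePairs ζ, ((block ζ k).card : ℝ)
      ≤ (largePairs ζ).card * (2 * (a₂ * (n / m)) ^ 2) := by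
    rw [Finset.filter_mem_eq_inter, Finset.univ_inter, ← nsmul_eq_mul]
    exact Finset.sum_le_card_nsmul _ _ _ fun k _ => card_block_le ζ hζ k
  have h3 : ∑ k with k ∉ largePairs ζ, ((block ζ k).card : ℝ)
      ≤ (m : ℝ) ^ 2 * (((n : ℝ) / m) ^ 2 / 4) := by
    have hle := Finset.sum_le_card_nsmul (Finset.univ.filter fun k => k ∉ largePairs ζ)
      (fun k => ((block ζ k).card : ℝ)) (((n : ℝ) / m) ^ 2 / 4) (fun k hk => by
        simp only [largePairs, Finset.mem_filter, Finset.mem_univ, true_and, not_le] at hk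
        exact hk.le)
    refine hle.trans ?_
    rw [nsmul_eq_mul]
    refine mul_le_mul_of_nonneg_right ?_ (by positivity)
    have : (Finset.univ.filter fun k => k ∉ largePairs ζ).card ≤ m ^ 2 := by
      refine (Finset.card_le_univ _).trans ((Fintype.card_subtype_le _).trans ?_)
      simp [sq]
    exact_mod_cast this
  have h4 : (m : ℝ) ^ 2 * (((n : ℝ) / m) ^ 2 / 4) = n ^ 2 / 4 := by field_simp
  have h5 : (n : ℝ) ^ 2 / 4 ≤ (largePairs ζ).card * (2 * (a₂ * (n / m)) ^ 2) := by linarith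
  have h6 : (largePairs ζ).card * (2 * (a₂ * (n / m)) ^ 2)
      = (n : ℝ) ^ 2 * (2 * a₂ ^ 2 * (largePairs ζ).card) / m ^ 2 := by field_simp
  rw [h6, le_div_iff₀ (by positivity)] at h5
  have h7 : (0 : ℝ) < n ^ 2 := by positivity
  nlinarith

end Blocks

/-! ### The lower bound from unknown smooth curves -/

section SmoothHypotheses

variable {m n L : ℕ} {H : Matrix (Fin L) (Fin L) ℝ} {γ : ℝ} {L₀ : ℕ}

/-- By Parseval the time sum for a node pair depends only on the coefficients of its class pair, and
each class pair counts with the size of its block. -/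
lemma sqDist_curveTensor (hH : TransformCond H) (hγ0 : 0 ≤ γ) (hγ : γ * L₀ ≤ 1 / 4)
    (hL₀ : L₀ ≤ L) (ζ : Fin n → Fin m) {x y : ClassPair m → Fin L → ℝ}
    (hx0 : ∀ k j, 0 ≤ x k j) (hx1 : ∀ k j, x k j ≤ 1)
    (hx2 : ∀ k (j : Fin L), L₀ ≤ (j : ℕ) → x k j = 0) (hy0 : ∀ k j, 0 ≤ y k j)
    (hy1 : ∀ k j, y k j ≤ 1) (hy2 : ∀ k (j : Fin L), L₀ ≤ (j : ℕ) → y k j = 0) :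
    sqDist (fun i j l =>
        (probTensor (curveTensor hH hγ0 hγ hL₀ hx0 hx1 hx2) (fun _ => ζ) i j l : ℝ))
      (fun i j l => (probTensor (curveTensor hH hγ0 hγ hL₀ hy0 hy1 hy2) (fun _ => ζ) i j l : ℝ))
      = γ ^ 2 * ∑ k, (block ζ k).card * ∑ j, (x k j - y k j) ^ 2 := by
  rw [← sum_pairOf ζ fun k => ∑ j, (x k j - y k j) ^ 2, Finset.mul_sum]
  unfold sqDist
  refine Finset.sum_congr rfl fun i _ => ?_
  rw [Finset.mul_sum]
  refine Finset.sum_congr rfl fun j _ => ?_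
  split_ifs with hij
  · simp [probTensor, hij]
  · rw [← hH.sum_comb_sq fun l => x (pairOf (ζ i) (ζ j)) l - y (pairOf (ζ i) (ζ j)) l,
      Finset.mul_sum]
    refine Finset.sum_congr rfl fun l _ => ?_
    simp only [probTensor, hij, if_false, curveTensor, sub_mul, Finset.sum_sub_distrib]
    ring

lemma sum_sub_half_sq_le (hH : TransformCond H) (hγ0 : 0 ≤ γ) (hγ : γ * L₀ ≤ 1 / 4)
    (hL₀ : L₀ ≤ L) (ζ : Fin n → Fin m) {x : ClassPair m → Fin L → ℝ}
    (hx0 : ∀ k j, 0 ≤ x k j) (hx1 : ∀ k j, x k j ≤ 1)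
    (hx2 : ∀ k (j : Fin L), L₀ ≤ (j : ℕ) → x k j = 0) :
    ∑ e : NodePair n × Fin L,
      ((probTensor (curveTensor hH hγ0 hγ hL₀ hx0 hx1 hx2) (fun _ => ζ) e.1.1.1 e.1.1.2 e.2 : ℝ)
        - 1 / 2) ^ 2 ≤ γ ^ 2 * ∑ k, (block ζ k).card * ∑ j, x k j ^ 2 := by
  rw [← sum_pairOf ζ fun k => ∑ j, x k j ^ 2,
    ← sum_offDiag fun i j => ∑ l, x (pairOf (ζ i) (ζ j)) l ^ 2, Fintype.sum_prod_type,
    Finset.mul_sum]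
  have h1 : ∀ e : NodePair n, ∑ l,
      ((probTensor (curveTensor hH hγ0 hγ hL₀ hx0 hx1 hx2) (fun _ => ζ) e.1.1 e.1.2 l : ℝ)
        - 1 / 2) ^ 2 = γ ^ 2 * ∑ l, x (pairOf (ζ e.1.1) (ζ e.1.2)) l ^ 2 := by
    intro e
    rw [← hH.sum_comb_sq fun l => x (pairOf (ζ e.1.1) (ζ e.1.2)) l, Finset.mul_sum]
    refine Finset.sum_congr rfl fun l _ => ?_
    simp only [probTensor, e.2.ne, if_false, curveTensor]
    ring
  simp_rw [h1]
  refine le_trans (le_of_eq (Finset.sum_map Finset.univ (Function.Embedding.subtype _)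
      fun e : Fin n × Fin n => γ ^ 2 * ∑ l, x (pairOf (ζ e.1) (ζ e.2)) l ^ 2).symm) ?_
  refine Finset.sum_le_sum_of_subset_of_nonneg (fun e he => ?_) fun e _ _ => by positivity
  obtain ⟨e', -, rfl⟩ := Finset.mem_map.1 he
  simpa using e'.2.ne

/-- The free coefficients: those of the large blocks at the lowest frequencies. -/
abbrev FreeCoef (ζ : Fin n → Fin m) (L L₀ : ℕ) : Type :=
  {e : ClassPair m × Fin L // e.1 ∈ largePairs ζ ∧ (e.2 : ℕ) < L₀}

lemma card_freeCoef (ζ : Fin n → Fin m) (hL₀ : L₀ ≤ L) :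
    Fintype.card (FreeCoef ζ L L₀) = (largePairs ζ).card * L₀ := by
  have h : (Finset.univ.filter fun j : Fin L => (j : ℕ) < L₀).card = L₀ := by
    rw [Fin.card_filter_val_lt, min_eq_right hL₀]
  rw [Fintype.card_subtype, ← h, ← Finset.card_product]
  congr 1
  ext e
  simp [h]

open Classical in
/-- The coefficients in `{0, 1}` described by a binary word. -/
noncomputable def coefOfWord (ζ : Fin n → Fin m) (L L₀ : ℕ) (θ : FreeCoef ζ L L₀ → Bool)
    (k : ClassPair m) (j : Fin L) : ℝ :=
  if h : k ∈ largePairs ζ ∧ (j : ℕ) < L₀ then (if θ ⟨(k, j), h⟩ then 1 else 0) else 0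

variable (ζ : Fin n → Fin m)

lemma coefOfWord_nonneg (θ : FreeCoef ζ L L₀ → Bool) (k : ClassPair m) (j : Fin L) :
    0 ≤ coefOfWord ζ L L₀ θ k j := by
  unfold coefOfWord; split_ifs <;> norm_num

lemma coefOfWord_le_one (θ : FreeCoef ζ L L₀ → Bool) (k : ClassPair m) (j : Fin L) :
    coefOfWord ζ L L₀ θ k j ≤ 1 := by
  unfold coefOfWord; split_ifs <;> norm_num

lemma coefOfWord_eq_zero (θ : FreeCoef ζ L L₀ → Bool) (k : ClassPair m) (j : Fin L)
    (h : L₀ ≤ (j : ℕ)) : coefOfWord ζ L L₀ θ k j = 0 := by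
  unfold coefOfWord; rw [dif_neg (fun h' => by omega)]

lemma coefOfWord_coe (θ : FreeCoef ζ L L₀ → Bool) (e : FreeCoef ζ L L₀) :
    coefOfWord ζ L L₀ θ e.1.1 e.1.2 = if θ e then 1 else 0 := by
  unfold coefOfWord; rw [dif_pos e.2]

lemma sum_freeCoef_le (f : ClassPair m × Fin L → ℝ) (hf : ∀ e, 0 ≤ f e) :
    ∑ e : FreeCoef ζ L L₀, f e.1 ≤ ∑ e, f e := by
  refine le_trans (le_of_eq (Finset.sum_map Finset.univ (Function.Embedding.subtype _) f).symm) ?_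
  exact Finset.sum_le_sum_of_subset_of_nonneg (Finset.subset_univ _) fun e _ _ => hf e

lemma le_sum_coefOfWord_sub_sq (θ θ' : FreeCoef ζ L L₀ → Bool) :
    ((n : ℝ) / m) ^ 2 / 4 * hammingDist θ θ' ≤ ∑ k, (block ζ k).card *
      ∑ j, (coefOfWord ζ L L₀ θ k j - coefOfWord ζ L L₀ θ' k j) ^ 2 := by
  simp_rw [Finset.mul_sum]
  rw [← Fintype.sum_prod_type' fun k j => ((block ζ k).card : ℝ) *
    (coefOfWord ζ L L₀ θ k j - coefOfWord ζ L L₀ θ' k j) ^ 2]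
  refine le_trans ?_ (sum_freeCoef_le (L₀ := L₀) ζ _ fun e => by positivity)
  unfold hammingDist
  rw [Finset.card_filter, Nat.cast_sum, Finset.mul_sum]
  refine Finset.sum_le_sum fun e _ => ?_
  rw [coefOfWord_coe, coefOfWord_coe]
  have h := (Finset.mem_filter.1 e.2.1).2
  cases θ e <;> cases θ' e <;> simp <;> linarith

lemma sum_coefOfWord_sq_le {M : ℝ} (hM : ∀ k, ((block ζ k).card : ℝ) ≤ M)
    (θ : FreeCoef ζ L L₀ → Bool) :
    ∑ k, (block ζ k).card * ∑ j, coefOfWord ζ L L₀ θ k j ^ 2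
      ≤ M * Fintype.card (FreeCoef ζ L L₀) := by
  simp_rw [Finset.mul_sum]
  rw [← Fintype.sum_prod_type' fun k j => ((block ζ k).card : ℝ) * coefOfWord ζ L L₀ θ k j ^ 2,
    Fintype.card_subtype, Finset.card_filter, Nat.cast_sum, Finset.mul_sum]
  refine Finset.sum_le_sum fun e _ => ?_
  split_ifs with h
  · rw [Nat.cast_one]
    exact mul_le_mul (hM _) (pow_le_one₀ (coefOfWord_nonneg ζ θ _ _) (coefOfWord_le_one ζ θ _ _))
      (sq_nonneg _) ((Nat.cast_nonneg _).trans (hM e.1))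
  · unfold coefOfWord
    rw [dif_neg h]; simp

/-- The lower bound from the unknown curves, at a given cutoff frequency `L₀`. -/
lemma hasLowerBound_of_cutoff (hH : TransformCond H) (hL : 2 ≤ L) (hm : 1 ≤ m) (hmn : 2 * m ≤ n)
    {a₁ a₂ : ℝ} (ha₂ : 1 ≤ a₂) (hζ : IsBalanced a₁ a₂ ζ) {ν₀ K₀ c₀ : ℝ} (hν₀ : 1 / 2 < ν₀)
    (hc₀ : 0 < c₀) (hc₀a : c₀ * a₂ ≤ 1 / 20) (hL₀ : L₀ ≤ L) (hL₀1 : 1 ≤ L₀)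
    (hγ : c₀ * (m / n) * L₀ ≤ 1 / 4)
    (hK : (c₀ * (m / n)) ^ 2 * (L₀ : ℝ) ^ (2 * ν₀ + 1) ≤ K₀) (n₀ : ℕ) :
    HasLowerBound m n n₀ H ν₀ K₀ a₁ a₂
      (c₀ ^ 2 / (12800 * a₂ ^ 2) * (((m : ℝ) / n) ^ 2 * L₀ / L)) := by
  intro Λ'
  have hm0 : (0 : ℝ) < m := by exact_mod_cast hm
  have hn0 : (0 : ℝ) < n := by exact_mod_cast (by omega : 0 < n)
  have hL0 : (0 : ℝ) < L := by exact_mod_cast (by omega : 0 < L)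
  have hL₀0 : (1 : ℝ) ≤ L₀ := by exact_mod_cast hL₀1
  have ha₂0 : 0 < a₂ := by linarith
  have hγ0 : 0 ≤ c₀ * (m / n) := by positivity
  have hlarge := card_largePairs_ge ζ hm hmn hζ
  set N : ℝ := (Fintype.card (FreeCoef ζ L L₀) : ℝ) with hN
  have hN' : N = (largePairs ζ).card * L₀ := by rw [hN, card_freeCoef ζ hL₀]; push_cast; ring
  have hN1 : 1 ≤ N := by
    have hpos : 0 < (largePairs ζ).card := by
      by_contra hcon
      have : (largePairs ζ).card = 0 := by omega
      rw [this] at hlarge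
      have : (0 : ℝ) < (m : ℝ) ^ 2 := by positivity
      simp at hlarge
      linarith
    rw [hN, card_freeCoef ζ hL₀]
    exact_mod_cast Nat.mul_pos hpos hL₀1
  -- With `γ = c₀ m / n` the factors `n / m` of the block sizes cancel: the divergence is at most `2
  -- (c₀ a₂)² N ≤ N / 200`, and Hamming distance `N / 100` on large blocks gives squared distance at
  -- least `c₀² N / 400 = 4 t`.
  obtain ⟨θ, hθ⟩ := exists_networkLaw_ge
    (fun θ : FreeCoef ζ L L₀ → Bool => probTensor (curveTensor hH hγ0 hγ hL₀
      (coefOfWord_nonneg ζ θ) (coefOfWord_le_one ζ θ) (coefOfWord_eq_zero ζ θ)) fun _ => ζ)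
    (fun _ => 1 / 2) (fun _ => by norm_num) (fun _ => by norm_num) (χ := N / 200)
    (t := c₀ ^ 2 * N / 1600) (p := Real.exp (-(5 / 8) * N))
    (fun θ => by
      refine (sum_sub_half_sq_le hH hγ0 hγ hL₀ ζ _ _ _).trans ?_
      refine (mul_le_mul_of_nonneg_left (sum_coefOfWord_sq_le ζ (card_block_le ζ hζ) θ)
        (sq_nonneg _)).trans ?_
      rw [← hN]
      have e1 : (c₀ * (m / n)) ^ 2 * (2 * (a₂ * (n / m)) ^ 2 * N) = (c₀ * a₂) ^ 2 * (2 * N) := by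
        field_simp
      rw [e1]
      have e2 : (c₀ * a₂) ^ 2 ≤ (1 / 20) ^ 2 := pow_le_pow_left₀ (by positivity) hc₀a 2
      nlinarith)
    (fun θ' => by
      have h1 : ((Finset.univ.filter fun θ : FreeCoef ζ L L₀ → Bool =>
          (hammingDist θ θ' : ℝ) < N / 100).card : ℝ)
          ≤ ∑ θ : FreeCoef ζ L L₀ → Bool, Real.exp (N / 25) *
            Real.exp (-4 * (hammingDist θ θ' : ℝ)) := by
        rw [Finset.card_filter, Nat.cast_sum]
        refine Finset.sum_le_sum fun θ _ => ?_
        rw [← Real.exp_add]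
        split_ifs with h
        · rw [Nat.cast_one]
          exact Real.one_le_exp (by linarith)
        · rw [Nat.cast_zero]; positivity
      have h2 := sum_exp_hammingDist_le θ'
      refine le_trans (Nat.cast_le.2 (Finset.card_le_card fun θ hθ => ?_)) (h1.trans ?_)
      · simp only [Finset.mem_filter, Finset.mem_univ, true_and] at hθ ⊢
        rw [sqDist_curveTensor] at hθ
        have h3 := (mul_le_mul_of_nonneg_left (le_sum_coefOfWord_sub_sq ζ θ θ')
          (sq_nonneg (c₀ * ((m : ℝ) / n)))).trans_lt hθ
        have e1 : (c₀ * ((m : ℝ) / n)) ^ 2 * (((n : ℝ) / m) ^ 2 / 4 * hammingDist θ θ')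
          = c₀ ^ 2 / 4 * hammingDist θ θ' := by field_simp
        have e2 : 4 * (c₀ ^ 2 * N / 1600) = c₀ ^ 2 / 4 * (N / 100) := by ring
        rw [e1, e2] at h3
        exact lt_of_mul_lt_mul_left h3 (by positivity)
      · rw [← Finset.mul_sum]
        refine (mul_le_mul_of_nonneg_left h2 (Real.exp_pos _).le).trans (le_of_eq ?_)
        rw [← hN, ← mul_assoc, ← Real.exp_add]
        congr 2
        ring)
    (Real.exp_pos _).le
    (by
      rw [← Real.exp_add]
      have h8 : (1 : ℝ) / 9 * 16 ≤ Real.exp 0.588 := by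
        have := Real.sum_le_exp_of_nonneg (x := 0.588) (by norm_num) 4
        norm_num [Finset.sum_range_succ, Nat.factorial] at this ⊢
        linarith
      have h9 : Real.exp (-(5 / 8) * N + 6 * (N / 200)) ≤ Real.exp (-0.588) :=
        Real.exp_le_exp.2 (by linarith)
      refine h9.trans ?_
      rw [Real.exp_neg, inv_le_comm₀ (Real.exp_pos _) (by norm_num)]
      linarith) Λ'
  refine ⟨_, curveTensor_mem hH hγ0 hγ hL₀ (coefOfWord_nonneg ζ θ) (coefOfWord_le_one ζ θ)
    (coefOfWord_eq_zero ζ θ) hν₀ hK, fun _ => ζ, ⟨fun l l' _ => by simp, fun _ => hζ⟩, hθ.trans ?_⟩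
  refine MeasureTheory.measure_mono fun B hB => ?_
  simp only [Set.mem_ofPred_eq, normError_eq] at hB ⊢
  rw [le_div_iff₀ (by positivity)]
  refine le_trans ?_ hB
  have e1 : c₀ ^ 2 / (12800 * a₂ ^ 2) * (((m : ℝ) / n) ^ 2 * L₀ / L) * ((n : ℝ) ^ 2 * L)
      = c₀ ^ 2 * L₀ / (12800 * a₂ ^ 2) * (m : ℝ) ^ 2 := by field_simp
  rw [e1, hN']
  refine (mul_le_mul_of_nonneg_left hlarge (by positivity)).trans (le_of_eq ?_)
  field_simp
  ring

/-- The lower bound from the unknown curves. -/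
theorem exists_hasLowerBound_smooth {ν₀ K₀ a₂ : ℝ} (hν₀ : 1 / 2 < ν₀) (hK₀ : 0 < K₀)
    (ha₂ : 1 ≤ a₂) : ∃ C : ℝ, 0 < C ∧ ∀ (a₁ : ℝ) (m n n₀ L : ℕ) (H : Matrix (Fin L) (Fin L) ℝ)
      (ζ : Fin n → Fin m), TransformCond H → 2 ≤ L → 1 ≤ m → 2 * m ≤ n → IsBalanced a₁ a₂ ζ →
      HasLowerBound m n n₀ H ν₀ K₀ a₁ a₂
        (C * min (1 / (L : ℝ) * (((m : ℝ) / n) ^ 2) ^ (2 * ν₀ / (2 * ν₀ + 1)))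
          (((m : ℝ) / n) ^ 2)) := by
  have ha₂0 : 0 < a₂ := by linarith
  set c₀ : ℝ := min (√K₀) (1 / (20 * a₂)) with hc₀
  have hc₀0 : 0 < c₀ := lt_min (Real.sqrt_pos.2 hK₀) (by positivity)
  have hc₀a : c₀ * a₂ ≤ 1 / 20 := by
    refine (mul_le_mul_of_nonneg_right (min_le_right _ _) ha₂0.le).trans (le_of_eq ?_)
    field_simp
  have hc₀K : c₀ ^ 2 ≤ K₀ := by
    rw [← Real.sq_sqrt hK₀.le]
    exact pow_le_pow_left₀ hc₀0.le (min_le_left _ _) 2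
  refine ⟨c₀ ^ 2 / (12800 * a₂ ^ 2) / 2, by positivity, ?_⟩
  intro a₁ m n n₀ L H ζ hH hL hm hmn hζ
  have hm0 : (0 : ℝ) < m := by exact_mod_cast hm
  have hn0 : (0 : ℝ) < n := by exact_mod_cast (by omega : 0 < n)
  have hL0 : (0 : ℝ) < L := by exact_mod_cast (by omega : 0 < L)
  set x : ℝ := (m : ℝ) / n with hx
  have hx0 : 0 < x := by positivity
  have hx1 : x ≤ 1 := by
    rw [hx, div_le_one hn0]; exact_mod_cast (by omega : m ≤ n)
  -- `X` solves `x² X ^ (2 ν₀ + 1) = 1`, so it is the largest cutoff compatible with the smoothness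
  -- constraint when `γ` is proportional to `x`.
  set X : ℝ := x ^ (-(2 / (2 * ν₀ + 1))) with hX
  have hX1 : 1 ≤ X := Real.one_le_rpow_of_pos_of_le_one_of_nonpos hx0 hx1
    (neg_nonpos.2 (div_nonneg (by norm_num) (by linarith)))
  have hfl := Nat.floor_le (zero_le_one.trans hX1)
  have hL₀X : ((min L ⌊X⌋₊ : ℕ) : ℝ) ≤ X := (Nat.cast_le.2 (min_le_right _ _)).trans hfl
  -- This is where `ν₀ > 1 / 2` enters: the exponent `1 - 2 / (2 ν₀ + 1)` is positive, so the curves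
  -- remain within `1 / 4` of `1 / 2`.
  have hxX : x * X ≤ 1 := by
    rw [hX, ← Real.rpow_one_add' hx0.le (by
      have : 2 / (2 * ν₀ + 1) < 1 := by rw [div_lt_one] <;> linarith
      linarith)]
    refine Real.rpow_le_one hx0.le hx1 ?_
    have : 2 / (2 * ν₀ + 1) < 1 := by rw [div_lt_one] <;> linarith
    linarith
  refine (hasLowerBound_of_cutoff (L₀ := min L ⌊X⌋₊) ζ hH hL hm hmn ha₂ hζ hν₀ hc₀0 hc₀a
    (min_le_left _ _) (le_min (by omega) (Nat.le_floor (by simpa using hX1))) ?_ ?_ n₀).mono ?_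
  · calc c₀ * x * ((min L ⌊X⌋₊ : ℕ) : ℝ) ≤ c₀ * x * X :=
          mul_le_mul_of_nonneg_left hL₀X (by positivity)
      _ = c₀ * (x * X) := by ring
      _ ≤ c₀ * 1 := mul_le_mul_of_nonneg_left hxX hc₀0.le
      _ ≤ 1 / 4 := by nlinarith
  · have h1 : ((min L ⌊X⌋₊ : ℕ) : ℝ) ^ (2 * ν₀ + 1) ≤ X ^ (2 * ν₀ + 1) :=
      Real.rpow_le_rpow (by positivity) hL₀X (by linarith)
    have h2 : X ^ (2 * ν₀ + 1) = (x ^ 2)⁻¹ := by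
      rw [hX, ← Real.rpow_mul hx0.le, neg_mul, div_mul_cancel₀ _ (by linarith), Real.rpow_neg hx0.le,
        Real.rpow_two]
    calc (c₀ * x) ^ 2 * ((min L ⌊X⌋₊ : ℕ) : ℝ) ^ (2 * ν₀ + 1) ≤ (c₀ * x) ^ 2 * (x ^ 2)⁻¹ :=
          mul_le_mul_of_nonneg_left (h1.trans h2.le) (sq_nonneg _)
      _ = c₀ ^ 2 := by field_simp
      _ ≤ K₀ := hc₀K
  · have h3 : (x ^ 2) ^ (2 * ν₀ / (2 * ν₀ + 1)) = x ^ 2 * X := by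
      rw [hX, ← Real.rpow_natCast, ← Real.rpow_mul hx0.le, ← Real.rpow_add hx0]
      congr 1
      field_simp
      push_cast
      ring
    rw [h3, div_mul_eq_mul_div, mul_div_assoc]
    refine mul_le_mul_of_nonneg_left ?_ (by positivity)
    -- If all frequencies are free, the parametric rate `x²` appears; otherwise the rate is `x² X /
    -- L`, and the floor costs a factor `2`.
    rcases le_total L ⌊X⌋₊ with h | h
    · rw [min_eq_left h, mul_div_cancel_right₀ _ hL0.ne']
      have := min_le_right (1 / (L : ℝ) * (x ^ 2 * X)) (x ^ 2)
      nlinarith [sq_nonneg x]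
    · rw [min_eq_right h]
      have h4 : X / 2 ≤ ⌊X⌋₊ := by
        have h5 := Nat.lt_floor_add_one X
        have h6 : (1 : ℝ) ≤ ⌊X⌋₊ := by exact_mod_cast Nat.le_floor (by simpa using hX1)
        linarith
      calc min (1 / (L : ℝ) * (x ^ 2 * X)) (x ^ 2) / 2 ≤ 1 / (L : ℝ) * (x ^ 2 * X) / 2 :=
            div_le_div_of_nonneg_right (min_le_left _ _) (by norm_num)
        _ = x ^ 2 * (X / 2) / L := by ring
        _ ≤ _ := by gcongr

end SmoothHypotheses

/-! ### Exponential moments for random matchings -/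

lemma card_perm_fixing {κ : Type*} [Fintype κ] [DecidableEq κ] (S : Finset κ) :
    (Finset.univ.filter fun π : Equiv.Perm κ => ∀ i ∈ S, π i = i).card
      = (Fintype.card κ - S.card).factorial := by
  have h := Fintype.card_congr (Equiv.Perm.subtypeEquivSubtypePerm fun i : κ => i ∉ S)
  rw [Fintype.card_perm, Fintype.card_subtype_compl, Fintype.card_coe, Fintype.card_subtype] at h
  rw [h]
  congr 1
  ext π
  simp

/-- The number of agreements of a random permutation with a fixed one has exponential moments
bounded by those of a Poisson variable. -/
lemma sum_perm_prod_le {κ : Type*} [Fintype κ] [DecidableEq κ] (π' : Equiv.Perm κ) {t : ℝ}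
    (ht : 0 ≤ t) :
    ∑ π : Equiv.Perm κ, ∏ i, (if π i = π' i then 1 + t else 1)
      ≤ (Fintype.card κ).factorial * Real.exp t := by
  set q := Fintype.card κ with hq
  have h1 : ∑ π : Equiv.Perm κ, ∏ i, (if π i = π' i then 1 + t else 1)
      = ∑ π : Equiv.Perm κ, ∏ i, (1 + if π i = i then t else 0) := by
    rw [← Equiv.sum_comp (Equiv.mulLeft π')]
    refine Finset.sum_congr rfl fun π _ => Finset.prod_congr rfl fun i _ => ?_
    simp only [Equiv.coe_mulLeft, Equiv.Perm.mul_apply, EmbeddingLike.apply_eq_iff_eq]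
    split_ifs <;> simp
  rw [h1]
  simp_rw [Finset.prod_one_add]
  rw [Finset.sum_comm]
  -- After translation by `π'`, agreements are fixed points. Expanding the product over sets `S` of
  -- forced fixed points and counting `(q - |S|)!` permutations for each leaves `q!` times a partial
  -- sum of the exponential series.
  have h2 : ∀ S : Finset κ, ∑ π : Equiv.Perm κ, ∏ i ∈ S, (if π i = i then t else 0)
      = t ^ S.card * (q - S.card).factorial := by
    intro S
    rw [hq, ← card_perm_fixing S, Finset.card_filter, Nat.cast_sum, Finset.mul_sum]
    refine Finset.sum_congr rfl fun π _ => ?_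
    rw [Finset.prod_ite_zero]
    split_ifs <;> simp
  simp_rw [h2]
  rw [Finset.sum_powerset_apply_card fun k => t ^ k * ((q - k).factorial : ℝ)]
  rw [Finset.card_univ, ← hq]
  have h3 : ∀ k ∈ Finset.range (q + 1), q.choose k • (t ^ k * ((q - k).factorial : ℝ))
      = q.factorial * (t ^ k / k.factorial) := by
    intro k hk
    have hk' : k ≤ q := by simpa [Nat.lt_succ_iff] using hk
    have h4 : (q.choose k : ℝ) * k.factorial * (q - k).factorial = q.factorial := by
      exact_mod_cast Nat.choose_mul_factorial_mul_factorial hk'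
    rw [nsmul_eq_mul, ← h4]
    have : (k.factorial : ℝ) ≠ 0 := by positivity
    field_simp
  rw [Finset.sum_congr rfl h3, ← Finset.mul_sum]
  exact mul_le_mul_of_nonneg_left (Real.sum_le_exp_of_nonneg ht _) (by positivity)

/-- Exponential moments of the number of agreements of a random sparse permutation. -/
lemma sum_agree_le {b q w : ℕ} (hw : 0 < w)
    (θ' : (Fin b → Equiv.Perm (Fin q)) × (Fin b × Fin q → Fin w)) {y : ℝ} (hy : 0 ≤ y) :
    ∑ θ : (Fin b → Equiv.Perm (Fin q)) × (Fin b × Fin q → Fin w),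
      ∏ j, (if θ.2 j = θ'.2 j ∧ θ.1 j.1 j.2 = θ'.1 j.1 j.2 then 1 + y else 1)
      ≤ Real.exp (b * (y / w)) *
        Fintype.card ((Fin b → Equiv.Perm (Fin q)) × (Fin b × Fin q → Fin w)) := by
  have hw0 : (w : ℝ) ≠ 0 := by positivity
  rw [Fintype.sum_prod_type]
  -- Summing over the choice of nodes first: a slot where the permutations agree keeps its weight
  -- with probability `1 / w`, which replaces `y` by `y / w`.
  have h1 : ∀ π : Fin b → Equiv.Perm (Fin q), ∑ f : Fin b × Fin q → Fin w,
      ∏ j, (if f j = θ'.2 j ∧ π j.1 j.2 = θ'.1 j.1 j.2 then 1 + y else 1)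
      = (w : ℝ) ^ (b * q) * ∏ β, ∏ i, (if π β i = θ'.1 β i then 1 + y / w else 1) := by
    intro π
    rw [sum_prod_pi fun (j : Fin b × Fin q) (v : Fin w) =>
      if v = θ'.2 j ∧ π j.1 j.2 = θ'.1 j.1 j.2 then 1 + y else (1 : ℝ)]
    have h2 : ∀ j : Fin b × Fin q, ∑ v : Fin w,
        (if v = θ'.2 j ∧ π j.1 j.2 = θ'.1 j.1 j.2 then 1 + y else (1 : ℝ))
        = w * (if π j.1 j.2 = θ'.1 j.1 j.2 then 1 + y / w else 1) := by
      intro j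
      by_cases hj : π j.1 j.2 = θ'.1 j.1 j.2
      · have h3 : ∀ v : Fin w, (if v = θ'.2 j then 1 + y else (1 : ℝ))
            = 1 + if v = θ'.2 j then y else 0 := fun v => by split_ifs <;> ring
        simp only [hj, and_true, if_true, h3, Finset.sum_add_distrib]
        simp
        field_simp
      · simp [hj]
    simp_rw [h2]
    rw [Finset.prod_mul_distrib, Finset.prod_const, Fintype.prod_prod_type]
    simp
  simp_rw [h1]
  rw [← Finset.mul_sum, sum_prod_pi fun (β : Fin b) (π : Equiv.Perm (Fin q)) =>
    ∏ i, (if π i = θ'.1 β i then 1 + y / w else 1)]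
  have h4 : ∏ β : Fin b, ∑ π : Equiv.Perm (Fin q), ∏ i, (if π i = θ'.1 β i then 1 + y / w else 1)
      ≤ ((q.factorial : ℝ) * Real.exp (y / w)) ^ b := by
    have h5 : ∀ β : Fin b, ∑ π : Equiv.Perm (Fin q),
        ∏ i, (if π i = θ'.1 β i then 1 + y / w else 1) ≤ (q.factorial : ℝ) * Real.exp (y / w) :=
      fun β => by simpa using sum_perm_prod_le (θ'.1 β) (div_nonneg hy (Nat.cast_nonneg w))
    refine (Finset.prod_le_prod (fun β _ => ?_) fun β _ => h5 β).trans (le_of_eq (by simp))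
    exact Finset.sum_nonneg fun π _ => Finset.prod_nonneg fun i _ => by split_ifs <;> positivity
  refine (mul_le_mul_of_nonneg_left h4 (by positivity)).trans (le_of_eq ?_)
  rw [mul_pow, ← Real.exp_nat_mul]
  simp [Fintype.card_perm]
  ring

/-! ### Exchanges of nodes and their visibility -/

section Swap

variable {J N : Type*} (x y : J → N)

open Classical in
/-- The map which exchanges `x j` and `y j` for all `j`. -/
noncomputable def swapMap (i : N) : N :=
  if h : ∃ j, x j = i then y h.choose else if h : ∃ j, y j = i then x h.choose else i

variable {x y}

lemma swapMap_left (hx : Function.Injective x) (j : J) : swapMap x y (x j) = y j := by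
  have h : ∃ j', x j' = x j := ⟨j, rfl⟩
  unfold swapMap
  rw [dif_pos h, hx h.choose_spec]

lemma swapMap_right (hy : Function.Injective y) (hxy : ∀ j j', x j ≠ y j') (j : J) :
    swapMap x y (y j) = x j := by
  have h : ∃ j', y j' = y j := ⟨j, rfl⟩
  unfold swapMap
  rw [dif_neg (fun ⟨j', h'⟩ => hxy _ _ h'), dif_pos h, hy h.choose_spec]

lemma swapMap_of_ne {i : N} (h1 : ∀ j, x j ≠ i) (h2 : ∀ j, y j ≠ i) : swapMap x y i = i := by
  unfold swapMap
  rw [dif_neg (fun ⟨j, h⟩ => h1 j h), dif_neg (fun ⟨j, h⟩ => h2 j h)]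

lemma swapMap_involutive (hx : Function.Injective x) (hy : Function.Injective y)
    (hxy : ∀ j j', x j ≠ y j') : Function.Involutive (swapMap x y) := by
  intro i
  by_cases h1 : ∃ j, x j = i
  · obtain ⟨j, rfl⟩ := h1
    rw [swapMap_left hx, swapMap_right hy hxy]
  · by_cases h2 : ∃ j, y j = i
    · obtain ⟨j, rfl⟩ := h2
      rw [swapMap_right hy hxy, swapMap_left hx]
    · push Not at h1 h2
      rw [swapMap_of_ne h1 h2, swapMap_of_ne h1 h2]

lemma card_swapMap_ne_le [Fintype J] [Fintype N] [DecidableEq N] :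
    (Finset.univ.filter fun i => swapMap x y i ≠ i).card ≤ 2 * Fintype.card J := by
  have : (Finset.univ.filter fun i => swapMap x y i ≠ i)
      ⊆ Finset.univ.image x ∪ Finset.univ.image y := by
    intro i hi
    by_contra hcon
    simp only [Finset.mem_union, Finset.mem_image, Finset.mem_univ, true_and, not_or,
      not_exists] at hcon
    exact (Finset.mem_filter.1 hi).2 (swapMap_of_ne hcon.1 hcon.2)
  refine (Finset.card_le_card this).trans ((Finset.card_union_le _ _).trans ?_)
  have h1 := Finset.card_image_le (s := Finset.univ) (f := x)
  have h2 := Finset.card_image_le (s := Finset.univ) (f := y)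
  rw [Finset.card_univ] at h1 h2
  omega

end Swap

lemma IsBalanced.comp {m n : ℕ} {a₁ a₂ : ℝ} {ζ : Fin n → Fin m} (hζ : IsBalanced a₁ a₂ ζ)
    {f : Fin n → Fin n} (hf : Function.Bijective f) : IsBalanced a₁ a₂ (ζ ∘ f) := by
  intro k
  have : (Finset.univ.filter fun i => (ζ ∘ f) i = k).card
      = (Finset.univ.filter fun i => ζ i = k).card :=
    Finset.card_bij (fun i _ => f i) (fun i hi => by simpa using hi)
      (fun i _ j _ h => hf.1 h) (fun i hi => by
        obtain ⟨j, rfl⟩ := hf.2 i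
        exact ⟨j, by simpa using hi, rfl⟩)
  rw [this]
  exact hζ k

/-- The distance of the rows `k` and `k'` of the pattern `g`, measured on the nodes of `T`. -/
def rowDist {m n : ℕ} (g : Fin m → Fin m → ℝ) (ζ : Fin n → Fin m) (T : Finset (Fin n))
    (k k' : Fin m) : ℝ :=
  ∑ j ∈ T, (g k (ζ j) - g k' (ζ j)) ^ 2

lemma rowDist_comm {m n : ℕ} (g : Fin m → Fin m → ℝ) (ζ : Fin n → Fin m) (T : Finset (Fin n))
    (k k' : Fin m) : rowDist g ζ T k k' = rowDist g ζ T k' k :=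
  Finset.sum_congr rfl fun j _ => by ring

/-- The nodes of `T` keep their labels, so they serve as fixed witnesses: a node of `A` with two
different labels has different edge patterns towards `T`. -/
lemma le_patternDist {m n : ℕ} {g : Fin m → Fin m → ℝ} {ζ ζ₁ ζ₂ : Fin n → Fin m}
    {T A : Finset (Fin n)} {τ : ℝ} (hA : ∀ i ∈ A, i ∉ T) (h1 : ∀ j ∈ T, ζ₁ j = ζ j)
    (h2 : ∀ j ∈ T, ζ₂ j = ζ j) (h : ∀ i ∈ A, τ ≤ rowDist g ζ T (ζ₁ i) (ζ₂ i)) :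
    τ * A.card ≤ patternDist g ζ₁ ζ₂ := by
  have hnn : ∀ i j, 0 ≤ if i = j then 0 else (g (ζ₁ i) (ζ₁ j) - g (ζ₂ i) (ζ₂ j)) ^ 2 :=
    fun i j => by split_ifs <;> positivity
  calc τ * A.card = ∑ _i ∈ A, τ := by simp [mul_comm]
    _ ≤ ∑ i ∈ A, ∑ j, if i = j then 0 else (g (ζ₁ i) (ζ₁ j) - g (ζ₂ i) (ζ₂ j)) ^ 2 := by
        refine Finset.sum_le_sum fun i hi => (h i hi).trans ?_
        refine le_trans (Finset.sum_le_sum fun j hj => ?_)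
          (Finset.sum_le_sum_of_subset_of_nonneg (Finset.subset_univ T) fun j _ _ => hnn i j)
        have hij : i ≠ j := fun hij => hA i hi (by rw [hij]; exact hj)
        rw [if_neg hij, h1 j hj, h2 j hj]
    _ ≤ _ := Finset.sum_le_sum_of_subset_of_nonneg (Finset.subset_univ A) fun i _ _ =>
        Finset.sum_nonneg fun j _ => hnn i j

/-- Left and right nodes which can be exchanged in pairs, together with a pattern for which the
exchanges are visible on the nodes of `T`. -/
structure SwapConfig {m n : ℕ} (ζ : Fin n → Fin m) (h s : ℕ) (τ : ℝ) where
  left : Fin (s * h) → Fin n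
  right : Fin s × Fin h → Fin n
  lab : Fin h → Fin m
  T : Finset (Fin n)
  g : Fin m → Fin m → ℝ
  left_injective : Function.Injective left
  right_injective : Function.Injective right
  left_ne_right : ∀ x y, left x ≠ right y
  label_right : ∀ y, ζ (right y) = lab y.2
  left_notMem : ∀ x, left x ∉ T
  right_notMem : ∀ y, right y ∉ T
  g_symm : ∀ k k', g k k' = g k' k
  g_nonneg : ∀ k k', 0 ≤ g k k'
  g_le_one : ∀ k k', g k k' ≤ 1
  le_dist_lab : ∀ e e', e ≠ e' → τ ≤ rowDist g ζ T (lab e) (lab e')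
  le_dist_left : ∀ x e, τ ≤ rowDist g ζ T (ζ (left x)) (lab e)

namespace SwapConfig

variable {m n h s : ℕ} {ζ : Fin n → Fin m} {τ a₁ a₂ : ℝ}

lemma mul_le (K : SwapConfig ζ h s τ) : s * h ≤ n := by
  simpa using Fintype.card_le_of_injective _ K.left_injective

/-- The family in which each of `u` disjoint pairs of nodes is exchanged or not. -/
theorem nonempty_family_binary (K : SwapConfig ζ h s τ) (hζ : IsBalanced a₁ a₂ ζ) {c : ℝ}
    (hc : 0 < c) (hn : 0 < n) (hτ : c * n ≤ τ) {u : ℕ} (hu : 1 ≤ u) (hus : u ≤ s * h) :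
    Nonempty (LabelFamily (m := m) (n := n) (IsBalanced a₁ a₂) (2 * u) (5 / 8 * u) (c / 200)) := by
  classical
  have hn0 : (0 : ℝ) < n := by exact_mod_cast hn
  have hτ0 : 0 < τ := lt_of_lt_of_le (by positivity) hτ
  have hu1 : (1 : ℝ) ≤ u := by exact_mod_cast hu
  obtain ⟨f⟩ : Nonempty (Fin u ↪ Fin (s * h)) :=
    Function.Embedding.nonempty_of_card_le (by simpa using hus)
  obtain ⟨f'⟩ : Nonempty (Fin u ↪ Fin s × Fin h) :=
    Function.Embedding.nonempty_of_card_le (by simpa using hus)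
  set x : Fin u → Fin n := fun j => K.left (f j)
  set y : Fin u → Fin n := fun j => K.right (f' j)
  have hx : Function.Injective x := K.left_injective.comp f.injective
  have hy : Function.Injective y := K.right_injective.comp f'.injective
  have hxy : ∀ j j', x j ≠ y j' := fun j j' => K.left_ne_right _ _
  set sw : (Fin u → Bool) → Fin n → Fin n := fun θ =>
    swapMap (fun j : {j // θ j = true} => x j) (fun j : {j // θ j = true} => y j) with hsw
  have hx' : ∀ θ : Fin u → Bool, Function.Injective fun j : {j // θ j = true} => x j :=
    fun θ => hx.comp Subtype.val_injective
  have hy' : ∀ θ : Fin u → Bool, Function.Injective fun j : {j // θ j = true} => y j :=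
    fun θ => hy.comp Subtype.val_injective
  have hswx1 : ∀ θ j, θ j = true → sw θ (x j) = y j := fun θ j hj =>
    swapMap_left (hx' θ) (⟨j, hj⟩ : {j // θ j = true})
  have hswx0 : ∀ θ j, θ j = false → sw θ (x j) = x j := fun θ j hj =>
    swapMap_of_ne (fun j' h => by
      have := hx h
      rw [← this, j'.2] at hj
      simp at hj) (fun j' h => hxy _ _ h.symm)
  have hswT : ∀ θ, ∀ i ∈ K.T, sw θ i = i := fun θ i hi =>
    swapMap_of_ne (fun j h => K.left_notMem _ (h ▸ hi)) (fun j h => K.right_notMem _ (h ▸ hi))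
  refine ⟨{
    Θ := Fin u → Bool
    fintype := inferInstance
    nonempty := inferInstance
    base := ζ
    label := fun θ => ζ ∘ sw θ
    g := K.g
    gap := fun θ θ' => τ * hammingDist θ θ'
    -- In units of `τ` the gap is the Hamming distance of the words, so `sum_exp_hammingDist_le`
    -- applies; `V = 2 * u` because an exchange touches two nodes.
    lam := 4 / τ
    d := τ * u / 100
    base_prop := hζ
    label_prop := fun θ => hζ.comp
      (swapMap_involutive (hx' θ) (hy' θ) fun j j' => hxy j j').bijective
    g_symm := K.g_symm
    g_nonneg := K.g_nonneg
    g_le_one := K.g_le_one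
    card_ne_le := fun θ => ?_
    gap_le := fun θ θ' => ?_
    lam_pos := by positivity
    sum_exp_le := fun θ' => ?_
    le_d := ?_
    le_rho := by linarith
    rho_le := ?_ }⟩
  · refine (Finset.card_le_card (t := Finset.univ.filter fun i => sw θ i ≠ i)
      fun i hi => ?_).trans (card_swapMap_ne_le.trans ?_)
    · simp only [Finset.mem_filter, Finset.mem_univ, true_and, Function.comp] at hi ⊢
      exact fun h => hi (by rw [h])
    · have := Fintype.card_subtype_le fun j => θ j = true
      rw [Fintype.card_fin] at this
      omega
  · have hcard : hammingDist θ θ' = ((Finset.univ.filter fun j => θ j ≠ θ' j).image x).card := by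
      rw [Finset.card_image_of_injective _ hx]; rfl
    rw [hcard]
    refine le_patternDist (ζ := ζ) (T := K.T) (fun i hi => ?_)
      (fun j hj => by simp [hswT θ j hj]) (fun j hj => by simp [hswT θ' j hj]) fun i hi => ?_
    · obtain ⟨j, -, rfl⟩ := Finset.mem_image.1 hi
      exact K.left_notMem _
    · obtain ⟨j, hj, rfl⟩ := Finset.mem_image.1 hi
      have hne := (Finset.mem_filter.1 hj).2
      simp only [Function.comp]
      cases h1 : θ j <;> cases h2 : θ' j
      · simp [h1, h2] at hne
      · rw [hswx0 θ j h1, hswx1 θ' j h2, K.label_right]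
        exact K.le_dist_left _ _
      · rw [hswx1 θ j h1, hswx0 θ' j h2, K.label_right, rowDist_comm]
        exact K.le_dist_left _ _
      · simp [h1, h2] at hne
  · have := sum_exp_hammingDist_le θ'
    rw [Fintype.card_fin] at this
    convert this using 3 with θ
    · field_simp
    · field_simp
      ring
  · push_cast
    nlinarith
  · push_cast
    have : (1 : ℝ) ≤ n := by exact_mod_cast hn
    nlinarith

/-- The family in which `b * q` left nodes, chosen from groups of `w` nodes, are exchanged with
`b * q` right nodes, matched by `b` permutations of `q` labels. -/
theorem nonempty_family_perm (K : SwapConfig ζ h s τ) (hζ : IsBalanced a₁ a₂ ζ) {c : ℝ}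
    (hc : 0 < c) (hn : 0 < n) (hτ : c * n ≤ τ) {b q w : ℕ} (hb : 1 ≤ b) (hq : 1 ≤ q)
    (hbs : b ≤ s) (hqh : q ≤ h) (hbqw : b * q * w ≤ s * h) (hwq : 100 ≤ w * q) :
    Nonempty (LabelFamily (m := m) (n := n) (IsBalanced a₁ a₂) (2 * (b * q))
      ((b * q : ℕ) * Real.log (1 + (w * q : ℕ)) / 4) (c / 200)) := by
  classical
  have hn0 : (0 : ℝ) < n := by exact_mod_cast hn
  have hτ0 : 0 < τ := lt_of_lt_of_le (by positivity) hτ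
  have hu1 : (1 : ℝ) ≤ (b * q : ℕ) := by exact_mod_cast Nat.mul_pos hb hq
  have hw0 : 0 < w := Nat.pos_of_ne_zero fun h0 => by simp [h0] at hwq
  have hw0' : (0 : ℝ) < w := by exact_mod_cast hw0
  have hwq' : (100 : ℝ) ≤ (w * q : ℕ) := by exact_mod_cast hwq
  have hwqn : ((w * q : ℕ) : ℝ) ≤ n := by
    have : w * q ≤ n := by
      refine le_trans ?_ (hbqw.trans K.mul_le)
      nlinarith [Nat.zero_le (w * q)]
    exact_mod_cast this
  have hlog : 4 ≤ Real.log (1 + (w * q : ℕ)) := by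
    rw [Real.le_log_iff_exp_le (by positivity)]
    have h1 := Real.exp_one_lt_d9
    have h2 : Real.exp 4 = Real.exp 1 ^ 4 := by rw [← Real.exp_nat_mul]; norm_num
    have h3 : Real.exp 1 ^ 4 ≤ 2.72 ^ 4 := pow_le_pow_left₀ (Real.exp_pos _).le (by linarith) 4
    norm_num at h3
    linarith
  have hlog' : Real.log (1 + (w * q : ℕ)) ≤ n := by
    have := Real.log_le_sub_one_of_pos (x := 1 + (w * q : ℕ)) (by positivity)
    linarith
  obtain ⟨f⟩ : Nonempty ((Fin b × Fin q) × Fin w ↪ Fin (s * h)) :=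
    Function.Embedding.nonempty_of_card_le (by simpa using hbqw)
  let Θ : Type := (Fin b → Equiv.Perm (Fin q)) × (Fin b × Fin q → Fin w)
  have hΘ : Nonempty (Fin w) := ⟨⟨0, hw0⟩⟩
  -- Slot `j` owns `w` left nodes. A member picks one of them and, through its permutation, the
  -- label it receives: about `w * q` options per slot, whose logarithm is the gain over binary
  -- exchanges.
  set x : Θ → Fin b × Fin q → Fin n := fun θ j => K.left (f (j, θ.2 j)) with hxdef
  set y : Θ → Fin b × Fin q → Fin n := fun θ j =>
    K.right (Fin.castLE hbs j.1, Fin.castLE hqh (θ.1 j.1 j.2)) with hydef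
  have hx : ∀ θ, Function.Injective (x θ) := fun θ j j' hjj => by
    have := f.injective (K.left_injective hjj)
    exact (Prod.ext_iff.1 this).1
  have hy : ∀ θ, Function.Injective (y θ) := fun θ j j' hjj => by
    have := K.right_injective hjj
    simp only [Prod.mk.injEq, Fin.castLE_inj] at this
    obtain ⟨h1, h2⟩ := this
    rw [h1] at h2
    exact Prod.ext h1 ((θ.1 j'.1).injective h2)
  have hxy : ∀ θ j j', x θ j ≠ y θ j' := fun θ j j' => K.left_ne_right _ _
  set sw : Θ → Fin n → Fin n := fun θ => swapMap (x θ) (y θ) with hsw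
  have hswT : ∀ θ, ∀ i ∈ K.T, sw θ i = i := fun θ i hi =>
    swapMap_of_ne (fun j h => K.left_notMem _ (h ▸ hi)) (fun j h => K.right_notMem _ (h ▸ hi))
  let agree : Θ → Θ → Fin b × Fin q → Prop := fun θ θ' j =>
    θ.2 j = θ'.2 j ∧ θ.1 j.1 j.2 = θ'.1 j.1 j.2
  set Λ : ℝ := Real.log (1 + (w * q : ℕ)) with hΛ
  have hexpΛ : Real.exp Λ = 1 + (w * q : ℕ) := Real.exp_log (by positivity)
  refine ⟨{
    Θ := Θ
    fintype := inferInstanceAs (Fintype ((Fin b → Equiv.Perm (Fin q)) × (Fin b × Fin q → Fin w)))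
    nonempty := inferInstanceAs
      (Nonempty ((Fin b → Equiv.Perm (Fin q)) × (Fin b × Fin q → Fin w)))
    base := ζ
    label := fun θ => ζ ∘ sw θ
    g := K.g
    gap := fun θ θ' => τ * (Finset.univ.filter fun j => ¬ agree θ θ' j).card
    lam := Λ / τ
    d := τ * (b * q : ℕ) / 2
    base_prop := hζ
    label_prop := fun θ => hζ.comp (swapMap_involutive (hx θ) (hy θ) (hxy θ)).bijective
    g_symm := K.g_symm
    g_nonneg := K.g_nonneg
    g_le_one := K.g_le_one
    card_ne_le := fun θ => ?_
    gap_le := fun θ θ' => ?_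
    lam_pos := div_pos (by linarith) hτ0
    sum_exp_le := fun θ' => ?_
    le_d := ?_
    le_rho := by nlinarith
    rho_le := ?_ }⟩
  · refine (Finset.card_le_card (t := Finset.univ.filter fun i => sw θ i ≠ i)
      fun i hi => ?_).trans (card_swapMap_ne_le.trans (by simp))
    simp only [Finset.mem_filter, Finset.mem_univ, true_and, Function.comp] at hi ⊢
    exact fun h => hi (by rw [h])
  · rw [← Finset.card_image_of_injective _ (hx θ)]
    refine le_patternDist (ζ := ζ) (T := K.T) (fun i hi => ?_)
      (fun j hj => by simp [hswT θ j hj]) (fun j hj => by simp [hswT θ' j hj]) fun i hi => ?_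
    · obtain ⟨j, -, rfl⟩ := Finset.mem_image.1 hi
      exact K.left_notMem _
    · obtain ⟨j, hj, rfl⟩ := Finset.mem_image.1 hi
      have hne := (Finset.mem_filter.1 hj).2
      have e1 : sw θ (x θ j) = y θ j := swapMap_left (hx θ) j
      simp only [Function.comp, e1]
      by_cases hcc : θ.2 j = θ'.2 j
      · have e2 : x θ j = x θ' j := by simp only [hxdef, hcc]
        have e3 : sw θ' (x θ j) = y θ' j := by rw [e2]; exact swapMap_left (hx θ') j
        rw [e3]
        simp only [hydef, K.label_right]
        refine K.le_dist_lab _ _ fun hlab => hne ⟨hcc, ?_⟩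
        simpa using hlab
      -- If the slots use different left nodes, the node picked by `θ` keeps its original label
      -- under `θ'`, since different slots own disjoint groups.
      · have e3 : sw θ' (x θ j) = x θ j := by
          refine swapMap_of_ne (fun j' h' => ?_) (fun j' h' => K.left_ne_right _ _ h'.symm)
          have h3 := f.injective (K.left_injective h')
          simp only [Prod.mk.injEq] at h3
          rw [h3.1] at h3
          exact hcc h3.2.symm
        rw [e3]
        simp only [hydef, K.label_right]
        rw [rowDist_comm]
        exact K.le_dist_left _ _
  · have h1 : ∀ θ : Θ, Real.exp (-(Λ / τ) *
        (τ * ((Finset.univ.filter fun j => ¬ agree θ θ' j).card : ℝ)))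
        = Real.exp (-Λ * (b * q : ℕ)) *
          ∏ j, (if agree θ θ' j then 1 + ((w * q : ℕ) : ℝ) else 1) := by
      intro θ
      have h2 : ((Finset.univ.filter fun j => ¬ agree θ θ' j).card : ℝ)
          = (b * q : ℕ) - ((Finset.univ.filter fun j => agree θ θ' j).card : ℝ) := by
        have := Finset.card_filter_add_card_filter_not (s := Finset.univ) (agree θ θ')
        rw [Finset.card_univ, Fintype.card_prod, Fintype.card_fin, Fintype.card_fin] at this
        rw [← this]; push_cast; ring
      rw [h2, Finset.prod_ite, Finset.prod_const_one, mul_one, Finset.prod_const, ← hexpΛ,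
        ← Real.exp_nat_mul, ← Real.exp_add]
      congr 1
      field_simp
      ring
    rw [Finset.sum_congr rfl fun θ _ => h1 θ, ← Finset.mul_sum]
    refine (mul_le_mul_of_nonneg_left (sum_agree_le hw0 θ' (Nat.cast_nonneg (w * q)))
      (Real.exp_pos _).le).trans ?_
    rw [← mul_assoc, ← Real.exp_add]
    refine mul_le_mul_of_nonneg_right (Real.exp_le_exp.2 ?_) (Nat.cast_nonneg _)
    -- With `y = w * q`, chosen so that `1 + y = exp Λ`, the moment is at most `exp (-Λ b q + b q)`.
    -- Half of `Λ b q` goes to `d` and a quarter to `ρ`; `Λ ≥ 4`, from `w * q ≥ 100`, absorbs the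
    -- rest.
    have e1 : (b : ℝ) * (((w * q : ℕ) : ℝ) / w) = (b * q : ℕ) := by push_cast; field_simp
    have e2 : Λ / τ * (τ * ((b * q : ℕ) : ℝ) / 2) = Λ * (b * q : ℕ) / 2 := by field_simp
    rw [e1, neg_mul (Λ / τ), e2]
    nlinarith
  · push_cast
    push_cast at hu1
    nlinarith
  · push_cast at hu1 ⊢
    nlinarith

end SwapConfig

/-! ### Simplex codes and the patterns they define -/

section Code

lemma zmod_two_eq_one_of_ne_zero {a : ZMod 2} (h : a ≠ 0) : a = 1 := by
  revert a; decide

/-- A nonzero linear form over the field with two elements is equal to `1` on half of the space. -/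
lemma two_mul_card_dotProduct_eq_one {r : ℕ} {a : Fin r → ZMod 2} (ha : a ≠ 0) :
    2 * (Finset.univ.filter fun x : Fin r → ZMod 2 => a ⬝ᵥ x = 1).card = 2 ^ r := by
  obtain ⟨i, hi⟩ := Function.ne_iff.1 ha
  have hi1 : a i = 1 := zmod_two_eq_one_of_ne_zero hi
  have hadd : ∀ x : Fin r → ZMod 2, a ⬝ᵥ (x + Pi.single i 1) = a ⬝ᵥ x + 1 := fun x => by
    rw [dotProduct_add, dotProduct_single, hi1, one_mul]
  have hinv : ∀ x : Fin r → ZMod 2, x + Pi.single i 1 + Pi.single i 1 = x := fun x => by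
    rw [add_assoc, ← Pi.single_add]
    have : (1 + 1 : ZMod 2) = 0 := by decide
    simp [this]
  have h1 : (Finset.univ.filter fun x : Fin r → ZMod 2 => a ⬝ᵥ x = 1).card
      = (Finset.univ.filter fun x : Fin r → ZMod 2 => ¬ a ⬝ᵥ x = 1).card := by
    refine Finset.card_bij' (fun x _ => x + Pi.single i 1) (fun x _ => x + Pi.single i 1)
      (fun x hx => ?_) (fun x hx => ?_) (fun x _ => hinv x) (fun x _ => hinv x)
    · simp only [Finset.mem_filter, Finset.mem_univ, true_and] at hx ⊢
      rw [hadd, hx]; decide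
    · simp only [Finset.mem_filter, Finset.mem_univ, true_and] at hx ⊢
      rw [hadd]
      revert hx
      generalize a ⬝ᵥ x = y
      revert y; decide
  have h2 := Finset.card_filter_add_card_filter_not (s := Finset.univ)
    fun x : Fin r → ZMod 2 => a ⬝ᵥ x = 1
  rw [← h1, Finset.card_univ, Fintype.card_fun, ZMod.card, Fintype.card_fin] at h2
  omega

/-- A matrix with entries in `[0, 1]` whose rows are far from zero and from each other. -/
def IsCode {h : ℕ} (c : Fin h → Fin h → ℝ) : Prop :=
  (∀ e f, 0 ≤ c e f) ∧ (∀ e f, c e f ≤ 1) ∧ (∀ e, (h : ℝ) / 2 ≤ ∑ f, (c e f - 0) ^ 2) ∧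
    ∀ e e', e ≠ e' → (h : ℝ) / 2 ≤ ∑ f, (c e f - c e' f) ^ 2

/-- The simplex code: rows and columns are the nonzero vectors of `𝔽₂ ^ r` and the entries are `a ⬝ᵥ
x`. Distinct rows differ where the nonzero form `a - a'` equals `1`, which is on half of the space;
the removed column `0` never contributes. -/
lemma exists_isCode_pow (r : ℕ) : ∃ c : Fin (2 ^ r - 1) → Fin (2 ^ r - 1) → ℝ, IsCode c := by
  have hcard : Fintype.card {x : Fin r → ZMod 2 // x ≠ 0} = 2 ^ r - 1 := by
    rw [Fintype.card_subtype_compl, Fintype.card_fun, ZMod.card, Fintype.card_fin]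
    simp
  let φ := Fintype.equivFinOfCardEq hcard
  let p : (Fin r → ZMod 2) → (Fin r → ZMod 2) → ℝ := fun a x => if a ⬝ᵥ x = 1 then 1 else 0
  have key : ∀ a a' : Fin r → ZMod 2, a ≠ a' →
      ((2 ^ r - 1 : ℕ) : ℝ) / 2 ≤ ∑ f, (p a (φ.symm f).1 - p a' (φ.symm f).1) ^ 2 := by
    intro a a' haa
    have h1 : ∀ x : Fin r → ZMod 2, (p a x - p a' x) ^ 2 = if (a - a') ⬝ᵥ x = 1 then 1 else 0 := by
      intro x
      simp only [p, sub_dotProduct]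
      generalize a ⬝ᵥ x = y
      generalize a' ⬝ᵥ x = y'
      have hz : ∀ z : ZMod 2, z = 0 ∨ z = 1 := by decide
      have e2 : (0 - 1 : ZMod 2) = 1 := by decide
      rcases hz y with rfl | rfl <;> rcases hz y' with rfl | rfl <;> simp [e2]
    rw [Equiv.sum_comp φ.symm fun x => (p a x.1 - p a' x.1) ^ 2]
    have h2 : ∑ x : {x : Fin r → ZMod 2 // x ≠ 0}, (p a x.1 - p a' x.1) ^ 2
        = ∑ x : Fin r → ZMod 2, (p a x - p a' x) ^ 2 := by
      refine (Finset.sum_map Finset.univ (Function.Embedding.subtype _)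
        fun x : Fin r → ZMod 2 => (p a x - p a' x) ^ 2).symm.trans ?_
      refine Finset.sum_subset (Finset.subset_univ _) fun x _ hx => ?_
      have : x = 0 := by
        by_contra hx0
        exact hx (Finset.mem_map.2 ⟨⟨x, hx0⟩, Finset.mem_univ _, rfl⟩)
      rw [h1, this]; simp
    rw [h2]
    simp_rw [h1]
    rw [Finset.sum_boole]
    have h3 : (2 : ℝ) * ((Finset.univ.filter fun x : Fin r → ZMod 2 =>
        (a - a') ⬝ᵥ x = 1).card : ℝ) = 2 ^ r := by
      exact_mod_cast two_mul_card_dotProduct_eq_one (sub_ne_zero.2 haa)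
    have h4 : ((2 ^ r - 1 : ℕ) : ℝ) ≤ 2 ^ r := by exact_mod_cast Nat.sub_le _ _
    linarith
  refine ⟨fun e f => p (φ.symm e).1 (φ.symm f).1, fun e f => ?_, fun e f => ?_, fun e => ?_,
    fun e e' hee => ?_⟩
  · simp only [p]; split_ifs <;> norm_num
  · simp only [p]; split_ifs <;> norm_num
  · have := key (φ.symm e).1 0 (φ.symm e).2
    simpa [p] using this
  · exact key _ _ fun h => hee (φ.symm.injective (Subtype.ext h))

lemma exists_isCode {M : ℕ} (hM : 1 ≤ M) :
    ∃ h, 1 ≤ h ∧ h ≤ M ∧ M ≤ 2 * h ∧ ∃ c : Fin h → Fin h → ℝ, IsCode c := by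
  have h1 := Nat.pow_log_le_self 2 (show M + 1 ≠ 0 by omega)
  have h2 := Nat.lt_pow_succ_log_self (b := 2) (by norm_num) (M + 1)
  rw [pow_succ] at h2
  refine ⟨2 ^ Nat.log 2 (M + 1) - 1, ?_, ?_, ?_, exists_isCode_pow _⟩ <;> omega

variable {m h : ℕ}

open Classical in
/-- The entry of the code at a pair of classes which are labeled by a row and a column. -/
noncomputable def codeEntry (c : Fin h → Fin h → ℝ) (A B : Fin h → Fin m) (k k' : Fin m) : ℝ :=
  if H : (∃ e, A e = k) ∧ ∃ f, B f = k' then c H.1.choose H.2.choose else 0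

/-- The symmetric pattern given by a code. -/
noncomputable def codePattern (c : Fin h → Fin h → ℝ) (A B : Fin h → Fin m) (k k' : Fin m) : ℝ :=
  max (codeEntry c A B k k') (codeEntry c A B k' k)

variable {c : Fin h → Fin h → ℝ} {A B : Fin h → Fin m}

lemma codePattern_comm (k k' : Fin m) : codePattern c A B k k' = codePattern c A B k' k :=
  max_comm _ _

lemma codeEntry_nonneg (hc : IsCode c) (k k' : Fin m) : 0 ≤ codeEntry c A B k k' := by
  unfold codeEntry; split_ifs
  · exact hc.1 _ _
  · exact le_rfl

lemma codeEntry_le_one (hc : IsCode c) (k k' : Fin m) : codeEntry c A B k k' ≤ 1 := by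
  unfold codeEntry; split_ifs
  · exact hc.2.1 _ _
  · exact zero_le_one

lemma codePattern_nonneg (hc : IsCode c) (k k' : Fin m) : 0 ≤ codePattern c A B k k' :=
  le_max_of_le_left (codeEntry_nonneg hc _ _)

lemma codePattern_le_one (hc : IsCode c) (k k' : Fin m) : codePattern c A B k k' ≤ 1 :=
  max_le (codeEntry_le_one hc _ _) (codeEntry_le_one hc _ _)

lemma codeEntry_eq_zero {k k' : Fin m} (hk : ∀ e, A e ≠ k) : codeEntry c A B k k' = 0 := by
  unfold codeEntry; rw [dif_neg fun H => hk _ H.1.choose_spec]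

/-- Since the row and column classes are disjoint, symmetrizing by the maximum does not disturb the
code. -/
lemma codePattern_apply (hc : IsCode c) (hA : Function.Injective A) (hB : Function.Injective B)
    (hAB : ∀ e f, A e ≠ B f) (e f : Fin h) : codePattern c A B (A e) (B f) = c e f := by
  unfold codePattern
  rw [codeEntry_eq_zero (k := B f) fun e => hAB e f, max_eq_left (codeEntry_nonneg hc _ _)]
  have H : (∃ e', A e' = A e) ∧ ∃ f', B f' = B f := ⟨⟨e, rfl⟩, f, rfl⟩
  unfold codeEntry
  rw [dif_pos H, hA H.1.choose_spec, hB H.2.choose_spec]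

/-- A class which is not a row acts as the zero codeword on the column classes; hence `IsCode` also
asks for rows far from zero. -/
lemma codePattern_eq_zero (hAB : ∀ e f, A e ≠ B f) {k : Fin m} (hk : ∀ e, A e ≠ k) (f : Fin h) :
    codePattern c A B k (B f) = 0 := by
  unfold codePattern
  rw [codeEntry_eq_zero hk, codeEntry_eq_zero fun e => hAB e f, max_self]

end Code

/-! ### Exchange configurations in balanced labelings -/

section Nodes

variable {m n s h : ℕ} {ζ : Fin n → Fin m}

lemma exists_nodes (hs : ∀ k, s ≤ (Finset.univ.filter fun i => ζ i = k).card) :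
    ∃ nd : Fin m × Fin s → Fin n, Function.Injective nd ∧ ∀ x, ζ (nd x) = x.1 := by
  have h1 : ∀ k, Nonempty (Fin s ↪ {i // ζ i = k}) := fun k =>
    Function.Embedding.nonempty_of_card_le (by
      rw [Fintype.card_fin, Fintype.card_subtype]; exact hs k)
  refine ⟨fun x => ((h1 x.1).some x.2).1, fun x y hxy => ?_, fun x => ((h1 x.1).some x.2).2⟩
  have h2 : x.1 = y.1 := by
    rw [← ((h1 x.1).some x.2).2, ← ((h1 y.1).some y.2).2]
    exact congrArg ζ hxy
  obtain ⟨k, t⟩ := x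
  obtain ⟨k', t'⟩ := y
  simp only at h2
  subst h2
  exact Prod.ext rfl ((h1 k).some.injective (Subtype.ext hxy))

variable {nd : Fin m × Fin s → Fin n} {B : Fin h → Fin m}

lemma rowDist_map (hnd : Function.Injective nd) (hζ : ∀ x, ζ (nd x) = x.1)
    (hB : Function.Injective B) (g : Fin m → Fin m → ℝ) (k k' : Fin m) :
    rowDist g ζ (Finset.univ.image fun x : Fin h × Fin s => nd (B x.1, x.2)) k k'
      = s * ∑ f, (g k (B f) - g k' (B f)) ^ 2 := by
  unfold rowDist
  rw [Finset.sum_image fun x _ y _ hxy => by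
    have := hnd hxy
    simp only [Prod.mk.injEq] at this
    exact Prod.ext (hB this.1) this.2, Fintype.sum_prod_type, Finset.mul_sum]
  simp [hζ]

variable {c : Fin h → Fin h → ℝ} {A : Fin h → Fin m}

lemma le_rowDist_code (hnd : Function.Injective nd) (hζ : ∀ x, ζ (nd x) = x.1) (hc : IsCode c)
    (hA : Function.Injective A) (hB : Function.Injective B) (hAB : ∀ e f, A e ≠ B f)
    {e e' : Fin h} (hee : e ≠ e') :
    (s : ℝ) * h / 2 ≤ rowDist (codePattern c A B) ζ
      (Finset.univ.image fun x : Fin h × Fin s => nd (B x.1, x.2)) (A e) (A e') := by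
  rw [rowDist_map hnd hζ hB, mul_div_assoc]
  simp_rw [codePattern_apply hc hA hB hAB]
  exact mul_le_mul_of_nonneg_left (hc.2.2.2 e e' hee) (Nat.cast_nonneg _)

lemma le_rowDist_code_zero (hnd : Function.Injective nd) (hζ : ∀ x, ζ (nd x) = x.1)
    (hc : IsCode c) (hA : Function.Injective A) (hB : Function.Injective B)
    (hAB : ∀ e f, A e ≠ B f) (e : Fin h) {k : Fin m} (hk : ∀ e, A e ≠ k) :
    (s : ℝ) * h / 2 ≤ rowDist (codePattern c A B) ζ
      (Finset.univ.image fun x : Fin h × Fin s => nd (B x.1, x.2)) k (A e) := by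
  rw [rowDist_comm, rowDist_map hnd hζ hB, mul_div_assoc]
  simp_rw [codePattern_apply hc hA hB hAB, codePattern_eq_zero hAB hk]
  exact mul_le_mul_of_nonneg_left (hc.2.2.1 e) (Nat.cast_nonneg _)

end Nodes

section Configs

variable {m n : ℕ} {ζ : Fin n → Fin m} {a₁ a₂ : ℝ}

/-- Three disjoint groups of `h` classes play different roles: nodes of `A₁` are the left nodes,
nodes of `A` carry the code rows, nodes of `B` are the witnesses. Each class contributes `s = ⌈a₁ n
/ m⌉` nodes, so there are order `n` nodes in each role. -/
lemma exists_swapConfig_of_three_le (hζ : IsBalanced a₁ a₂ ζ) (ha₁ : 0 < a₁) (hm : 3 ≤ m)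
    (hmn : 2 * m ≤ n) :
    ∃ h s τ, Nonempty (SwapConfig ζ h s τ) ∧ 1 ≤ h ∧ 1 ≤ s ∧ a₁ / 16 * n ≤ s * h ∧
      (m : ℝ) / 8 ≤ h ∧ a₁ / 16 * n ≤ τ := by
  have hm0 : (0 : ℝ) < m := by exact_mod_cast (by omega : 0 < m)
  have hn0 : (0 : ℝ) < n := by exact_mod_cast (by omega : 0 < n)
  set s : ℕ := ⌈a₁ * ((n : ℝ) / m)⌉₊ with hs
  have hs0 : 0 < s := Nat.ceil_pos.2 (by positivity)
  have hs1 : a₁ * ((n : ℝ) / m) ≤ s := Nat.le_ceil _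
  obtain ⟨nd, hnd, hζnd⟩ := exists_nodes (ζ := ζ) (s := s) fun k => Nat.ceil_le.2 (hζ k).1
  obtain ⟨h, hh1, hhM, hMh, c, hc⟩ := exists_isCode (M := m / 3) (by omega)
  have hmh : (m : ℝ) / 8 ≤ h := by
    rw [div_le_iff₀ (by norm_num)]; exact_mod_cast (by omega : m ≤ h * 8)
  have hsh : a₁ * n / 8 ≤ (s : ℝ) * h := by
    have := mul_le_mul hs1 hmh (by positivity) (Nat.cast_nonneg _)
    refine le_trans (le_of_eq ?_) this
    field_simp
  let A₁ : Fin h → Fin m := fun e => ⟨e, by omega⟩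
  let A : Fin h → Fin m := fun e => ⟨h + e, by omega⟩
  let B : Fin h → Fin m := fun e => ⟨2 * h + e, by omega⟩
  have hA₁ : Function.Injective A₁ := fun e e' hee => by simpa [A₁, Fin.ext_iff] using hee
  have hA : Function.Injective A := fun e e' hee => by simpa [A, Fin.ext_iff] using hee
  have hB : Function.Injective B := fun e e' hee => by simpa [B, Fin.ext_iff] using hee
  have hAB : ∀ e f, A e ≠ B f := fun e f hef => by simp [A, B, Fin.ext_iff] at hef; omega
  have hA₁B : ∀ e f, A₁ e ≠ B f := fun e f hef => by simp [A₁, B, Fin.ext_iff] at hef; omega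
  have hAA₁ : ∀ e f, A e ≠ A₁ f := fun e f hef => by simp [A, A₁, Fin.ext_iff] at hef; omega
  refine ⟨h, s, (s : ℝ) * h / 2, ⟨{
    left := fun x => nd (A₁ (finProdFinEquiv.symm x).2, (finProdFinEquiv.symm x).1)
    right := fun x => nd (A x.2, x.1)
    lab := A
    T := Finset.univ.image fun x : Fin h × Fin s => nd (B x.1, x.2)
    g := codePattern c A B
    left_injective := fun x y hxy => ?_
    right_injective := fun x y hxy => ?_
    left_ne_right := fun x y hxy => ?_
    label_right := fun y => hζnd _
    left_notMem := fun x hx => ?_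
    right_notMem := fun x hx => ?_
    g_symm := codePattern_comm
    g_nonneg := codePattern_nonneg hc
    g_le_one := codePattern_le_one hc
    le_dist_lab := fun e e' hee => le_rowDist_code hnd hζnd hc hA hB hAB hee
    le_dist_left := fun x e => le_rowDist_code_zero hnd hζnd hc hA hB hAB e fun e' => by
      rw [hζnd]; exact hAA₁ _ _ }⟩, hh1, hs0, by linarith [mul_pos ha₁ hn0], hmh,
      by linarith⟩
  · have := hnd hxy
    simp only [Prod.mk.injEq] at this
    exact finProdFinEquiv.symm.injective (Prod.ext this.2 (hA₁ this.1))
  · have := hnd hxy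
    simp only [Prod.mk.injEq] at this
    exact Prod.ext this.2 (hA this.1)
  · have := hnd hxy
    simp only [Prod.mk.injEq] at this
    exact hAA₁ _ _ this.1.symm
  · obtain ⟨y, -, hy⟩ := Finset.mem_image.1 hx
    have := hnd hy
    simp only [Prod.mk.injEq] at this
    exact hA₁B _ _ this.1.symm
  · obtain ⟨y, -, hy⟩ := Finset.mem_image.1 hx
    have := hnd hy
    simp only [Prod.mk.injEq] at this
    exact hAB _ _ this.1.symm

lemma exists_large_class (ζ : Fin n → Fin 2) :
    ∃ p p' : Fin 2, p ≠ p' ∧ n ≤ 2 * (Finset.univ.filter fun i => ζ i = p).card := by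
  have h : (Finset.univ.filter fun i => ζ i = 0).card
      + (Finset.univ.filter fun i => ζ i = 1).card = n := by
    have h1 := Finset.card_filter_add_card_filter_not (s := Finset.univ) fun i => ζ i = 0
    rw [Finset.card_univ, Fintype.card_fin] at h1
    refine Eq.trans ?_ h1
    congr 2
    ext i
    simp only [Finset.mem_filter, Finset.mem_univ, true_and]
    omega
  rcases le_total (Finset.univ.filter fun i => ζ i = 0).card
    (Finset.univ.filter fun i => ζ i = 1).card with h1 | h1
  · exact ⟨1, 0, by decide, by omega⟩
  · exact ⟨0, 1, by decide, by omega⟩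

/-- With two classes there is no third one for the witnesses. The larger class is split instead: one
half supplies left nodes, the other half detects, through the indicator of an edge inside this
class, whether a node belongs to it. -/
lemma exists_swapConfig_two {ζ : Fin n → Fin 2} (hζ : IsBalanced a₁ a₂ ζ) (ha₁ : 0 < a₁)
    (ha₁' : a₁ ≤ 1) (hn : 4 ≤ n) :
    ∃ s τ, Nonempty (SwapConfig ζ 1 s τ) ∧ 1 ≤ s ∧ a₁ / 16 * n ≤ s ∧ a₁ / 16 * n ≤ τ := by
  have hn0 : (0 : ℝ) < n := by exact_mod_cast (by omega : 0 < n)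
  obtain ⟨p, p', hpp, hp⟩ := exists_large_class ζ
  set P := Finset.univ.filter fun i => ζ i = p with hP
  set P' := Finset.univ.filter fun i => ζ i = p' with hP'
  obtain ⟨W, hWP, hW⟩ := Finset.exists_subset_card_eq (show P.card / 2 ≤ P.card by omega)
  have hP'0 : a₁ * ((n : ℝ) / 2) ≤ P'.card := by simpa using (hζ p').1
  have hP'1 : 1 ≤ P'.card := by
    by_contra hcon
    have : P'.card = 0 := by omega
    rw [this, Nat.cast_zero] at hP'0
    have : 0 < a₁ * ((n : ℝ) / 2) := by positivity
    linarith
  set s := min (P.card / 2) P'.card with hs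
  have hs1 : 1 ≤ s := le_min (by omega) hP'1
  obtain ⟨f⟩ : Nonempty (Fin (s * 1) ↪ W) := Function.Embedding.nonempty_of_card_le (by
    rw [Fintype.card_fin, Fintype.card_coe, hW, mul_one]; exact min_le_left _ _)
  obtain ⟨f'⟩ : Nonempty (Fin s × Fin 1 ↪ P') := Function.Embedding.nonempty_of_card_le (by
    rw [Fintype.card_prod, Fintype.card_fin, Fintype.card_fin, Fintype.card_coe, mul_one]
    exact min_le_right _ _)
  have hζf : ∀ x, ζ (f x) = p := fun x => (Finset.mem_filter.1 (hWP (f x).2)).2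
  have hζf' : ∀ x, ζ (f' x) = p' := fun x => (Finset.mem_filter.1 (f' x).2).2
  refine ⟨s, ((P \ W).card : ℝ), ⟨{
    left := fun x => f x
    right := fun x => f' x
    lab := fun _ => p'
    T := P \ W
    g := fun k k' => if k = p ∧ k' = p then 1 else 0
    left_injective := fun x y hxy => f.injective (Subtype.ext hxy)
    right_injective := fun x y hxy => f'.injective (Subtype.ext hxy)
    left_ne_right := fun x y hxy => hpp (by rw [← hζf x, hxy, hζf'])
    label_right := fun y => hζf' y
    left_notMem := fun x hx => (Finset.mem_sdiff.1 hx).2 (f x).2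
    right_notMem := fun x hx => hpp (by
      rw [← hζf' x, (Finset.mem_filter.1 (Finset.mem_sdiff.1 hx).1).2])
    g_symm := fun k k' => by simp only [and_comm]
    g_nonneg := fun k k' => by split_ifs <;> norm_num
    g_le_one := fun k k' => by split_ifs <;> norm_num
    le_dist_lab := fun e e' hee => absurd (Subsingleton.elim e e') hee
    le_dist_left := fun x e => ?_ }⟩, hs1, ?_, ?_⟩
  · unfold rowDist
    rw [← nsmul_one, ← Finset.sum_const]
    refine Finset.sum_le_sum fun j hj => ?_
    have hj' : ζ j = p := (Finset.mem_filter.1 (Finset.mem_sdiff.1 hj).1).2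
    rw [hζf, hj']
    simp [hpp.symm]
  · rw [hs, Nat.cast_min]
    refine le_min ?_ (by nlinarith)
    have : n ≤ 6 * (P.card / 2) := by omega
    have : (n : ℝ) ≤ 6 * (P.card / 2 : ℕ) := by exact_mod_cast this
    nlinarith
  · rw [Finset.card_sdiff_of_subset hWP, hW]
    have : n ≤ 4 * (P.card - P.card / 2) := by omega
    have : (n : ℝ) ≤ 4 * (P.card - P.card / 2 : ℕ) := by exact_mod_cast this
    nlinarith

lemma exists_swapConfig (hζ : IsBalanced a₁ a₂ ζ) (ha₁ : 0 < a₁) (ha₁' : a₁ ≤ 1) (hm : 2 ≤ m)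
    (hmn : 2 * m ≤ n) :
    ∃ h s τ, Nonempty (SwapConfig ζ h s τ) ∧ 1 ≤ h ∧ 1 ≤ s ∧ a₁ / 16 * n ≤ s * h ∧
      a₁ / 16 * m ≤ h ∧ a₁ / 16 * n ≤ τ := by
  rcases hm.eq_or_lt with rfl | hm
  · obtain ⟨s, τ, hK, hs, hsn, hτ⟩ := exists_swapConfig_two hζ ha₁ ha₁' (by omega)
    exact ⟨1, s, τ, hK, le_rfl, hs, by simpa using hsn, by push_cast; linarith, hτ⟩
  · obtain ⟨h, s, τ, hK, hh, hs, hsn, hhm, hτ⟩ :=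
      exists_swapConfig_of_three_le hζ ha₁ (by omega) hmn
    have : (0 : ℝ) ≤ m := Nat.cast_nonneg _
    exact ⟨h, s, τ, hK, hh, hs, hsn, by nlinarith, hτ⟩

end Configs

/-! ### Families with at least two changing nodes -/

/-- The choice of the shape of the exchanges for a given number `v` of exchanges. -/
lemma exists_shape {m n h s v n₀ : ℕ} {c : ℝ} (hc : 0 < c) (hc1 : c ≤ 1) (hh : 1 ≤ h) (hs : 1 ≤ s)
    (hv : 1 ≤ v) (hvn : 2 * v ≤ n) (hvn₀ : 2 * v ≤ n₀) (hmn : m ≤ n) (hsh : c * n ≤ s * h)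
    (hhm : c * m ≤ h) :
    ∃ b q w : ℕ, 1 ≤ b ∧ 1 ≤ q ∧ 1 ≤ w ∧ b ≤ s ∧ q ≤ h ∧ b * q * w ≤ s * h ∧ b * q ≤ v ∧
      c / 2 * v ≤ (b * q : ℕ) ∧
      (m : ℝ) * n / n₀ ≤ (2 / c ^ 2 * (w * q : ℕ)) ^ 2 := by
  have hn₀ : (2 : ℝ) ≤ n₀ := by exact_mod_cast (by omega : 2 ≤ n₀)
  have hv0 : (1 : ℝ) ≤ v := by exact_mod_cast hv
  have hvn' : (2 : ℝ) * v ≤ n := by exact_mod_cast hvn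
  have hvn₀' : (2 : ℝ) * v ≤ n₀ := by exact_mod_cast hvn₀
  have hmn' : (m : ℝ) ≤ n := by exact_mod_cast hmn
  have hc2 : c ^ 2 ≤ c := by nlinarith
  have hc2' : c ^ 2 ≤ 1 := by nlinarith
  have hc20 : 0 < c ^ 2 := by positivity
  -- With few exchanges one block of distinct labels suffices and `w * q` is of order `n`; its
  -- square dominates `m * n`, and a square costs only a factor `2` in the logarithm. Otherwise all
  -- `h` labels are used in each of `b` blocks, and `w * h` is at least of order `m * n / n₀`.
  rcases le_or_gt v h with hvh | hvh
  · have hw1 : 1 ≤ s * h / v := (Nat.one_le_div_iff (by omega)).2 (hvh.trans (by nlinarith))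
    have hdm := Nat.div_add_mod (s * h) v
    have hml := Nat.mod_lt (s * h) (show v > 0 by omega)
    have hw2 : s * h ≤ 2 * (s * h / v * v) := by nlinarith
    refine ⟨1, v, s * h / v, le_rfl, hv, hw1, hs, hvh,
      by rw [one_mul]; exact Nat.mul_div_le _ _, by omega,
      by rw [one_mul]; nlinarith, ?_⟩
    have hw3 : (s : ℝ) * h ≤ 2 * ((s * h / v * v : ℕ) : ℝ) := by exact_mod_cast hw2
    set W : ℝ := ((s * h / v * v : ℕ) : ℝ)
    have h1 : (n : ℝ) ≤ 2 / c ^ 2 * W := by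
      rw [div_mul_eq_mul_div, le_div_iff₀ hc20]
      have : (0 : ℝ) ≤ n := Nat.cast_nonneg _
      nlinarith
    calc (m : ℝ) * n / n₀ ≤ m * n := div_le_self (by positivity) (by linarith)
      _ ≤ n * n := by gcongr
      _ = (n : ℝ) ^ 2 := (sq _).symm
      _ ≤ _ := pow_le_pow_left₀ (Nat.cast_nonneg _) h1 2
  · set b := min s (v / h) with hb
    have hvh1 : 1 ≤ v / h := (Nat.one_le_div_iff (by omega)).2 hvh.le
    have hb1 : 1 ≤ b := le_min hs hvh1
    have hbs : b ≤ s := min_le_left _ _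
    have hw1 : 1 ≤ s / b := (Nat.one_le_div_iff (by omega)).2 hbs
    have hbh : b * h ≤ v := (Nat.mul_le_mul_right h (min_le_right _ _)).trans (Nat.div_mul_le_self v h)
    have hsb := Nat.div_mul_le_self s b
    have hdm := Nat.div_add_mod s b
    have hml := Nat.mod_lt s (show b > 0 by omega)
    have hdm' := Nat.div_add_mod v h
    have hml' := Nat.mod_lt v (show h > 0 by omega)
    generalize s / b = w at hw1 hsb hdm
    have hbhn : ((b * h : ℕ) : ℝ) ≤ v := by exact_mod_cast hbh
    refine ⟨b, h, w, hb1, hh, hw1, hbs, le_rfl, ?_, hbh, ?_, ?_⟩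
    · calc b * h * w = w * b * h := by ring
        _ ≤ s * h := Nat.mul_le_mul_right h hsb
    · rcases le_total s (v / h) with h1 | h1
      · rw [hb, min_eq_left h1]; push_cast; nlinarith
      · rw [hb, min_eq_right h1]
        have h2 : v ≤ 2 * (v / h * h) := by nlinarith
        have h3 : (v : ℝ) ≤ 2 * ((v / h * h : ℕ) : ℝ) := by exact_mod_cast h2
        nlinarith
    · have hw2 : s ≤ 2 * (w * b) := by nlinarith
      have hw3 : (s : ℝ) ≤ 2 * (w * b) := by exact_mod_cast hw2
      have hw1' : (1 : ℝ) ≤ w := by exact_mod_cast hw1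
      have hh1' : (1 : ℝ) ≤ h := by exact_mod_cast hh
      have hwh : (1 : ℝ) ≤ w * h := one_le_mul_of_one_le_of_one_le hw1' hh1'
      have h1 : (m : ℝ) * n / n₀ ≤ w * h / c ^ 2 := by
        rw [div_le_div_iff₀ (by linarith) hc20]
        have e1 : (c * m) * (c * n) ≤ h * (s * h) :=
          mul_le_mul hhm hsh (by positivity) (by positivity)
        have e2 : (h : ℝ) * (s * h) ≤ h * (2 * (w * b) * h) := by gcongr
        have e3 : (h : ℝ) * (2 * (w * b) * h) = w * h * (2 * ((b * h : ℕ) : ℝ)) := by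
          push_cast; ring
        have e4 : w * h * (2 * ((b * h : ℕ) : ℝ)) ≤ w * h * n₀ :=
          mul_le_mul_of_nonneg_left (by linarith) (by positivity)
        have e5 : (m : ℝ) * n * c ^ 2 = (c * m) * (c * n) := by ring
        linarith
      have h2 : 1 ≤ w * h / c ^ 2 := by
        rw [one_le_div hc20]; linarith
      refine h1.trans ?_
      have e5 : (2 / c ^ 2 * ((w * h : ℕ) : ℝ)) = 2 * (w * h / c ^ 2) := by
        push_cast; ring
      rw [e5]
      generalize (w : ℝ) * h / c ^ 2 = X at h2
      nlinarith

/-- Families of balanced labelings at distance at most `n₀` from a balanced base, if at least two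
nodes may change. -/
theorem exists_family_of_two_le {a₁ : ℝ} (ha₁ : 0 < a₁) (ha₁' : a₁ ≤ 1) :
    ∃ C : ℝ, 0 < C ∧ ∀ (a₂ : ℝ) (m n n₀ : ℕ) (ζ : Fin n → Fin m), IsBalanced a₁ a₂ ζ → 2 ≤ m →
      2 * m ≤ n → 2 ≤ n₀ → n₀ ≤ n → ∃ (V : ℕ) (ρ : ℝ), V ≤ n₀ ∧
        C * (n₀ * Real.log (m * n * Real.exp 1 / n₀)) ≤ ρ ∧
        Nonempty (LabelFamily (m := m) (n := n) (IsBalanced a₁ a₂) V ρ (a₁ / 16 / 200)) := by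
  set c : ℝ := a₁ / 16 with hc
  have hc0 : 0 < c := by positivity
  have hc1 : c ≤ 1 := by linarith
  set K : ℝ := 1 + 2 * Real.log (2 / c ^ 2) with hK
  have hlogc : 0 ≤ Real.log (2 / c ^ 2) := Real.log_nonneg (by
    rw [one_le_div (by positivity)]; nlinarith)
  have hK1 : 1 ≤ K := by linarith
  refine ⟨c / (24 * (K + 10)), by positivity, ?_⟩
  intro a₂ m n n₀ ζ hζ hm hmn hn₀ hn₀n
  obtain ⟨h, s, τ, ⟨F⟩, hh, hs, hsh, hhm, hτ⟩ := exists_swapConfig hζ ha₁ ha₁' hm hmn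
  obtain ⟨b, q, w, hb, hq, hw, hbs, hqh, hbqw, hbqv, hbqc, hwq⟩ :=
    exists_shape (v := n₀ / 2) (n₀ := n₀) (m := m) (n := n) hc0 hc1 hh hs (by omega) (by omega)
      (by omega) (by omega) hsh hhm
  have hm0 : (0 : ℝ) < m := by exact_mod_cast (by omega : 0 < m)
  have hn0 : (0 : ℝ) < n := by exact_mod_cast (by omega : 0 < n)
  have hn₀0 : (0 : ℝ) < n₀ := by exact_mod_cast (by omega : 0 < n₀)
  have hwq0 : (1 : ℝ) ≤ (w * q : ℕ) := by exact_mod_cast Nat.mul_pos hw hq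
  set Λ : ℝ := Real.log (m * n * Real.exp 1 / n₀) with hΛ
  have hΛle : Λ ≤ K + 2 * Real.log (w * q : ℕ) := by
    have e1 : (m : ℝ) * n * Real.exp 1 / n₀ = m * n / n₀ * Real.exp 1 := by ring
    rw [hΛ, e1, Real.log_mul (by positivity) (Real.exp_pos 1).ne', Real.log_exp]
    have e2 := Real.log_le_log (by positivity) hwq
    rw [Real.log_pow, Real.log_mul (by positivity) (by positivity)] at e2
    push_cast at e2 ⊢
    linarith
  have hu : c * n₀ / 6 ≤ (b * q : ℕ) := by
    refine le_trans ?_ hbqc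
    have : (n₀ : ℝ) ≤ 3 * (n₀ / 2 : ℕ) := by exact_mod_cast (by omega : n₀ ≤ 3 * (n₀ / 2))
    nlinarith
  have hn1 : 0 < n := by omega
  -- If `w * q < 100`, the logarithm in the rate is bounded and binary exchanges already give the
  -- order `n₀`.
  rcases le_or_gt 100 (w * q) with h100 | h100
  · refine ⟨2 * (b * q), _, by omega, ?_,
      F.nonempty_family_perm hζ hc0 hn1 hτ hb hq hbs hqh hbqw h100⟩
    have e1 : Real.log (w * q : ℕ) ≤ Real.log (1 + (w * q : ℕ)) :=
      Real.log_le_log (by linarith) (by linarith)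
    have e2 : 1 ≤ Real.log (1 + (w * q : ℕ)) := by
      have h100' : (100 : ℝ) ≤ (w * q : ℕ) := by exact_mod_cast h100
      rw [Real.le_log_iff_exp_le (by positivity)]
      linarith [Real.exp_one_lt_d9]
    set Y := Real.log (1 + (w * q : ℕ)) with hY
    have e3 : Λ ≤ (K + 10) * Y := by nlinarith
    calc c / (24 * (K + 10)) * (n₀ * Λ) ≤ c / (24 * (K + 10)) * (n₀ * ((K + 10) * Y)) := by
          gcongr
      _ = c * n₀ / 6 * Y / 4 := by field_simp; ring
      _ ≤ _ := by gcongr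
  · refine ⟨2 * (b * q), _, by omega, ?_,
      F.nonempty_family_binary hζ hc0 hn1 hτ (Nat.mul_pos hb hq) (by nlinarith)⟩
    have e1 : Real.log (w * q : ℕ) ≤ 5 := by
      rw [Real.log_le_iff_le_exp (by linarith)]
      have h100' : ((w * q : ℕ) : ℝ) ≤ 100 := by exact_mod_cast h100.le
      have e2 : Real.exp 5 = Real.exp 1 ^ 5 := by rw [← Real.exp_nat_mul]; norm_num
      have e3 : (2.7 : ℝ) ^ 5 ≤ Real.exp 1 ^ 5 :=
        pow_le_pow_left₀ (by norm_num) (by linarith [Real.exp_one_gt_d9]) 5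
      norm_num at e3
      linarith
    have e3 : Λ ≤ K + 10 := by linarith
    calc c / (24 * (K + 10)) * (n₀ * Λ) ≤ c / (24 * (K + 10)) * (n₀ * (K + 10)) := by
          gcongr
      _ = c * n₀ / 6 / 4 := by field_simp; ring
      _ ≤ _ := by linarith

/-! ### Families in which a single node moves -/

section Single

variable {m n : ℕ} {ζ : Fin n → Fin m} {a₁ a₂ : ℝ}

/-- The class `k` can lose a node. -/
def IsDonor (a₁ : ℝ) (ζ : Fin n → Fin m) (k : Fin m) : Prop :=
  a₁ * ((n : ℝ) / m) ≤ ((Finset.univ.filter fun i => ζ i = k).card : ℝ) - 1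

/-- The class `k` can gain a node. -/
def IsRecipient (a₂ : ℝ) (ζ : Fin n → Fin m) (k : Fin m) : Prop :=
  ((Finset.univ.filter fun i => ζ i = k).card : ℝ) + 1 ≤ a₂ * ((n : ℝ) / m)

lemma filter_update_self {i : Fin n} {k : Fin m} :
    (Finset.univ.filter fun j => Function.update ζ i k j = k)
      = insert i (Finset.univ.filter fun j => ζ j = k) := by
  ext j
  by_cases h : j = i <;> simp [Function.update_apply, h]

lemma filter_update_of_eq {i : Fin n} {k : Fin m} (hk : ζ i ≠ k) :
    (Finset.univ.filter fun j => Function.update ζ i k j = ζ i)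
      = (Finset.univ.filter fun j => ζ j = ζ i).erase i := by
  ext j
  by_cases h : j = i <;> simp [Function.update_apply, h, hk.symm]

lemma filter_update_of_ne {i : Fin n} {k k' : Fin m} (hk : k' ≠ k) (hi : k' ≠ ζ i) :
    (Finset.univ.filter fun j => Function.update ζ i k j = k')
      = Finset.univ.filter fun j => ζ j = k' := by
  ext j
  by_cases h : j = i <;> simp [Function.update_apply, h, hk.symm, hi.symm]

lemma card_filter_update_self {i : Fin n} {k : Fin m} (hk : ζ i ≠ k) :
    (Finset.univ.filter fun j => Function.update ζ i k j = k).card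
      = (Finset.univ.filter fun j => ζ j = k).card + 1 := by
  rw [filter_update_self, Finset.card_insert_of_notMem (by simpa using hk)]

lemma card_filter_update_of_eq {i : Fin n} {k : Fin m} (hk : ζ i ≠ k) :
    (Finset.univ.filter fun j => Function.update ζ i k j = ζ i).card + 1
      = (Finset.univ.filter fun j => ζ j = ζ i).card := by
  rw [filter_update_of_eq hk, Finset.card_erase_add_one (by simp)]

lemma IsBalanced.update (hζ : IsBalanced a₁ a₂ ζ) {i : Fin n} {k : Fin m} (hk : ζ i ≠ k)
    (hD : IsDonor a₁ ζ (ζ i)) (hR : IsRecipient a₂ ζ k) :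
    IsBalanced a₁ a₂ (Function.update ζ i k) := by
  intro k'
  by_cases h1 : k' = k
  · subst h1
    rw [card_filter_update_self hk]
    push_cast
    exact ⟨(hζ _).1.trans (by linarith), hR⟩
  · by_cases h2 : k' = ζ i
    · subst h2
      have := card_filter_update_of_eq hk
      have h3 : ((Finset.univ.filter fun j => Function.update ζ i k j = ζ i).card : ℝ)
          = (Finset.univ.filter fun j => ζ j = ζ i).card - 1 := by
        rw [← this]; push_cast; ring
      rw [h3]
      exact ⟨hD, by linarith [(hζ (ζ i)).2]⟩
    · rw [filter_update_of_ne h1 h2]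
      exact hζ k'

lemma IsBalanced.isDonor_of_update {i : Fin n} {k : Fin m} (hk : ζ i ≠ k)
    (h : IsBalanced a₁ a₂ (Function.update ζ i k)) : IsDonor a₁ ζ (ζ i) := by
  have h1 := (h (ζ i)).1
  unfold IsDonor
  rw [← card_filter_update_of_eq hk]
  push_cast
  linarith

lemma IsBalanced.isRecipient_of_update {i : Fin n} {k : Fin m} (hk : ζ i ≠ k)
    (h : IsBalanced a₁ a₂ (Function.update ζ i k)) : IsRecipient a₂ ζ k := by
  have h1 := (h k).2
  rw [card_filter_update_self hk] at h1
  unfold IsRecipient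
  exact_mod_cast h1

/-- A class which cannot lose a node is strictly smaller than the donor `k`; after gaining one node
it is still no larger than `k`, hence within the upper bound. -/
lemma IsBalanced.isDonor_or_isRecipient (hζ : IsBalanced a₁ a₂ ζ) {k : Fin m}
    (hk : IsDonor a₁ ζ k) (k' : Fin m) : IsDonor a₁ ζ k' ∨ IsRecipient a₂ ζ k' := by
  by_contra! hcon
  unfold IsDonor IsRecipient at hcon
  unfold IsDonor at hk
  obtain ⟨h1, h2⟩ := hcon
  rw [not_le] at h1 h2
  have h3 : (Finset.univ.filter fun i => ζ i = k').card
      < (Finset.univ.filter fun i => ζ i = k).card := by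
    have : ((Finset.univ.filter fun i => ζ i = k').card : ℝ)
      < (Finset.univ.filter fun i => ζ i = k).card := by linarith
    exact_mod_cast this
  have h4 : ((Finset.univ.filter fun i => ζ i = k').card : ℝ) + 1
      ≤ (Finset.univ.filter fun i => ζ i = k).card := by exact_mod_cast h3
  linarith [(hζ k).2]

/-- The family in which at most one node changes its class. -/
theorem nonempty_family_single {O : Type} [Fintype O] [Nonempty O] (hζ : IsBalanced a₁ a₂ ζ)
    (node : O → Fin n) (lab : O → Fin m) {T : Finset (Fin n)} {g : Fin m → Fin m → ℝ} {c τ : ℝ}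
    (hbal : ∀ o, IsBalanced a₁ a₂ (Function.update ζ (node o) (lab o)))
    (hT : ∀ o, node o ∉ T) (hg : ∀ k k', g k k' = g k' k) (hg0 : ∀ k k', 0 ≤ g k k')
    (hg1 : ∀ k k', g k k' ≤ 1) (hdist : ∀ o, τ ≤ rowDist g ζ T (ζ (node o)) (lab o))
    (hdist' : ∀ o o', o ≠ o' → node o = node o' → τ ≤ rowDist g ζ T (lab o) (lab o'))
    (hO : Fintype.card O ≤ n) (hc : 0 < c) (hτ : c * n ≤ τ) :
    Nonempty (LabelFamily (m := m) (n := n) (IsBalanced a₁ a₂) 1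
      (0.87 * Real.log (Fintype.card O + 1)) (c / 200)) := by
  classical
  have hO1 : 1 ≤ Fintype.card O := Fintype.card_pos
  have hO1' : (1 : ℝ) ≤ Fintype.card O := by exact_mod_cast hO1
  have hOn : (Fintype.card O : ℝ) ≤ n := by exact_mod_cast hO
  have hn0 : (0 : ℝ) < n := by linarith
  have hτ0 : 0 < τ := lt_of_lt_of_le (by positivity) hτ
  set M : ℝ := Fintype.card O + 1 with hM
  have hM0 : 0 < M := by linarith
  have hlogM : 0.6931 ≤ Real.log M := by
    refine le_trans (by linarith [Real.log_two_gt_d9]) (Real.log_le_log (by norm_num) (?_ : 2 ≤ M))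
    linarith
  have hlogM' : Real.log M ≤ n := (Real.log_le_sub_one_of_pos hM0).trans (by linarith)
  set label : Option O → Fin n → Fin m := fun θ =>
    θ.elim ζ fun o => Function.update ζ (node o) (lab o) with hlabel
  have hlabT : ∀ θ, ∀ j ∈ T, label θ j = ζ j := by
    intro θ j hj
    cases θ with
    | none => rfl
    | some o => exact Function.update_of_ne (fun h => hT o (by rw [← h]; exact hj)) _ _
  have hsep : ∀ θ θ', θ ≠ θ' → ∃ i, i ∉ T ∧ τ ≤ rowDist g ζ T (label θ i) (label θ' i) := by
    intro θ θ' hne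
    cases θ with
    | none =>
      cases θ' with
      | none => exact absurd rfl hne
      | some o => exact ⟨node o, hT o, by simpa [hlabel] using hdist o⟩
    | some o =>
      cases θ' with
      | none => exact ⟨node o, hT o, by rw [rowDist_comm]; simpa [hlabel] using hdist o⟩
      | some o' =>
        refine ⟨node o, hT o, ?_⟩
        by_cases hnode : node o = node o'
        · have := hdist' o o' (fun h => hne (by rw [h])) hnode
          simpa [hlabel, ← hnode] using this
        · rw [rowDist_comm]
          simpa [hlabel, Function.update_of_ne hnode] using hdist o
  refine ⟨{
    Θ := Option O
    fintype := inferInstance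
    nonempty := inferInstance
    base := ζ
    label := label
    g := g
    gap := fun θ θ' => if θ = θ' then 0 else τ
    -- Every wrong member contributes `exp (-4) / M`, so the moment sum is at most `1 + exp (-4)`.
    -- The constants `0.87` and `τ / 100` leave `exp (0.12 * log M - 0.04)`, which suffices even for
    -- `M = 2`; `0.87 * log 2` still exceeds `3 / 5`.
    lam := (4 + Real.log M) / τ
    d := τ / 100
    base_prop := hζ
    label_prop := fun θ => ?_
    g_symm := hg
    g_nonneg := hg0
    g_le_one := hg1
    card_ne_le := fun θ => ?_
    gap_le := fun θ θ' => ?_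
    lam_pos := by positivity
    sum_exp_le := fun θ' => ?_
    le_d := ?_
    le_rho := by linarith
    rho_le := by push_cast; linarith }⟩
  · cases θ with
    | none => exact hζ
    | some o => exact hbal o
  · cases θ with
    | none => simp [hlabel]
    | some o =>
      refine (Finset.card_le_card (t := {node o}) fun i hi => ?_).trans (by simp)
      rw [Finset.mem_singleton]
      by_contra hio
      exact (Finset.mem_filter.1 hi).2 (Function.update_of_ne hio _ _)
  · split_ifs with h
    · exact Finset.sum_nonneg fun i _ => Finset.sum_nonneg fun j _ => by split_ifs <;> positivity
    · obtain ⟨i, hi, hd⟩ := hsep θ θ' h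
      have := le_patternDist (g := g) (A := {i}) (ζ := ζ) (T := T) (τ := τ) (ζ₁ := label θ)
        (ζ₂ := label θ') (by simpa using hi) (hlabT θ) (hlabT θ') (by simpa using hd)
      simpa using this
  · have e1 : ∀ θ : Option O, Real.exp (-((4 + Real.log M) / τ) * (if θ = θ' then 0 else τ))
        = if θ = θ' then 1 else Real.exp (-4) / M := by
      intro θ
      split_ifs
      · simp
      · have : -((4 + Real.log M) / τ) * τ = -4 - Real.log M := by field_simp; ring
        rw [this, Real.exp_sub, Real.exp_log hM0]
    simp_rw [e1]
    have e2 : ∀ θ : Option O, (if θ = θ' then (1 : ℝ) else Real.exp (-4) / M)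
        ≤ (if θ = θ' then (1 : ℝ) else 0) + Real.exp (-4) / M := by
      intro θ
      have : 0 ≤ Real.exp (-4) / M := by positivity
      split_ifs <;> linarith
    refine (Finset.sum_le_sum fun θ _ => e2 θ).trans ?_
    have e3 : ((Fintype.card (Option O) : ℕ) : ℝ) = M := by rw [Fintype.card_option]; simp [hM]
    rw [Finset.sum_add_distrib, Finset.sum_const, Finset.card_univ, nsmul_eq_mul, e3,
      mul_div_cancel₀ _ hM0.ne', Finset.sum_ite_eq' , if_pos (Finset.mem_univ _)]
    have e4 : Real.exp (-((4 + Real.log M) / τ) * (τ / 100) - 0.87 * Real.log M) * M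
        = Real.exp (0.12 * Real.log M - 0.04) := by
      nth_rewrite 3 [← Real.exp_log hM0]
      rw [← Real.exp_add]
      congr 1
      field_simp
      ring
    rw [e4]
    have e5 := Real.add_one_le_exp (Real.exp (-4))
    rw [add_comm]
    refine e5.trans (Real.exp_le_exp.2 ?_)
    linarith [exp_neg_four_le]
  · push_cast
    linarith

/-- The family in which one of the nodes of `W` moves to the class `b`. -/
lemma nonempty_family_move (hζ : IsBalanced a₁ a₂ ζ) {b : Fin m} (hb : IsRecipient a₂ ζ b)
    {W T : Finset (Fin n)} {B : Finset (Fin m)} (hW : W.Nonempty)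
    (hWD : ∀ i ∈ W, IsDonor a₁ ζ (ζ i)) (hWb : ∀ i ∈ W, ζ i ≠ b) (hWT : ∀ i ∈ W, i ∉ T)
    (hTB : ∀ j ∈ T, ζ j ∈ B) (hB : b ∈ B → ∀ i ∈ W, ζ i ∉ B) {c : ℝ} (hc : 0 < c)
    (hcT : c * n ≤ T.card) :
    Nonempty (LabelFamily (m := m) (n := n) (IsBalanced a₁ a₂) 1
      (0.87 * Real.log (W.card + 1)) (c / 200)) := by
  classical
  have : Nonempty W := hW.to_subtype
  have h := nonempty_family_single (O := W) (T := T) hζ (fun i => i.1) (fun _ => b)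
    (g := fun k k' => if (k = b ∧ k' ∈ B) ∨ (k' = b ∧ k ∈ B) then 1 else 0) (τ := T.card)
    (fun i => hζ.update (hWb i.1 i.2) (hWD i.1 i.2) hb) (fun i => hWT i.1 i.2)
    (fun k k' => by simp only [or_comm]) (fun k k' => by split_ifs <;> norm_num)
    (fun k k' => by split_ifs <;> norm_num) (fun i => ?_)
    (fun i i' hii h => absurd (Subtype.ext h) hii)
    (by simpa using Finset.card_le_univ W) hc hcT
  · simpa using h
  · unfold rowDist
    rw [← nsmul_one, ← Finset.sum_const]
    refine Finset.sum_le_sum fun j hj => ?_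
    have h1 := hTB j hj
    have h2 : ¬ ((ζ i.1 = b ∧ ζ j ∈ B) ∨ (ζ j = b ∧ ζ i.1 ∈ B)) := by
      rintro (⟨h3, -⟩ | ⟨h3, h4⟩)
      · exact hWb i.1 i.2 h3
      · exact hB (h3 ▸ h1) i.1 i.2 h4
    beta_reduce
    rw [if_neg h2, if_pos (Or.inl ⟨rfl, h1⟩)]
    norm_num

/-- The uncertainty is which node of the classes in `D` moved to `b`. The bound on `|D|` leaves at
least `m / 3` classes outside `D` and `b` as witnesses. -/
lemma exists_family_move_of_classes (hζ : IsBalanced a₁ a₂ ζ) (ha₁ : 0 < a₁) (hm : 3 ≤ m)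
    (hmn : 2 * m ≤ n) {b : Fin m} (hb : IsRecipient a₂ ζ b) {D : Finset (Fin m)} (hD : D.Nonempty)
    (hDd : ∀ k ∈ D, IsDonor a₁ ζ k) (hbD : b ∉ D) (hDm : D.card ≤ (m - 1) / 2) :
    ∃ M : ℕ, 2 ≤ M ∧ D.card * (a₁ * (n / m)) ≤ M ∧ Nonempty (LabelFamily (m := m) (n := n)
      (IsBalanced a₁ a₂) 1 (0.87 * Real.log M) (a₁ / 16 / 200)) := by
  have hm0 : (0 : ℝ) < m := by exact_mod_cast (by omega : 0 < m)
  have hn0 : (0 : ℝ) < n := by exact_mod_cast (by omega : 0 < n)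
  have hcard : ∀ E : Finset (Fin m), E.card * (a₁ * ((n : ℝ) / m))
      ≤ ((Finset.univ.filter fun i => ζ i ∈ E).card : ℝ) := by
    intro E
    rw [Finset.card_eq_sum_card_fiberwise (f := ζ) (t := E) fun i hi => by simpa using hi]
    push_cast
    rw [← nsmul_eq_mul]
    refine Finset.card_nsmul_le_sum _ _ _ fun k hk => (hζ k).1.trans (Nat.cast_le.2 ?_)
    refine Finset.card_le_card fun i hi => ?_
    simp only [Finset.mem_filter, Finset.mem_univ, true_and] at hi ⊢
    exact ⟨by rw [hi]; exact hk, hi⟩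
  have hq : 0 < a₁ * ((n : ℝ) / m) := by positivity
  set W : Finset (Fin n) := Finset.univ.filter fun i => ζ i ∈ D with hW
  set B : Finset (Fin m) := (insert b D)ᶜ with hB
  have hWpos : 1 ≤ W.card := by
    have h1 : (1 : ℝ) ≤ D.card := by exact_mod_cast hD.card_pos
    have h2 : (0 : ℝ) < W.card := lt_of_lt_of_le (by positivity) (hcard D)
    exact_mod_cast h2
  have hBcard : m ≤ 3 * B.card := by
    rw [hB, Finset.card_compl, Finset.card_insert_of_notMem hbD, Fintype.card_fin]
    omega
  have h := nonempty_family_move (W := W) (T := Finset.univ.filter fun i => ζ i ∈ B) (B := B)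
    (c := a₁ / 16) hζ hb (Finset.card_pos.1 hWpos) (fun i hi => hDd _ (Finset.mem_filter.1 hi).2)
    (fun i hi h => hbD (h ▸ (Finset.mem_filter.1 hi).2))
    (fun i hi h => by
      have h1 := (Finset.mem_filter.1 hi).2
      have h2 := (Finset.mem_filter.1 h).2
      rw [hB, Finset.mem_compl] at h2
      exact h2 (Finset.mem_insert_of_mem h1))
    (fun j hj => (Finset.mem_filter.1 hj).2)
    (fun h => by simp [hB] at h) (by positivity)
    (by
      refine le_trans ?_ (hcard B)
      have h1 : (m : ℝ) ≤ 3 * B.card := by exact_mod_cast hBcard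
      have h2 : a₁ * n / 3 ≤ B.card * (a₁ * ((n : ℝ) / m)) := by
        have := mul_le_mul_of_nonneg_right h1 hq.le
        have e : (m : ℝ) * (a₁ * (n / m)) = a₁ * n := by field_simp
        linarith
      nlinarith [mul_pos ha₁ hn0])
  refine ⟨W.card + 1, by omega, (hcard D).trans (by push_cast; linarith), ?_⟩
  push_cast
  exact h

/-- The uncertainty is which recipient class a single node joined; the code rows separate the
possible labels from each other and from the original one. This gives order `m` options even when
the donor class is small. -/
lemma exists_family_relabel (hζ : IsBalanced a₁ a₂ ζ) (ha₁ : 0 < a₁) (hm : 4 ≤ m)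
    (hmn : 2 * m ≤ n) {i₀ : Fin n} (hi₀ : IsDonor a₁ ζ (ζ i₀)) {R : Finset (Fin m)}
    (hR : ∀ k ∈ R, IsRecipient a₂ ζ k) (hRm : m ≤ 2 * R.card) :
    ∃ M : ℕ, 2 ≤ M ∧ m ≤ 8 * M ∧ Nonempty (LabelFamily (m := m) (n := n)
      (IsBalanced a₁ a₂) 1 (0.87 * Real.log M) (a₁ / 16 / 200)) := by
  have hm0 : (0 : ℝ) < m := by exact_mod_cast (by omega : 0 < m)
  have hn0 : (0 : ℝ) < n := by exact_mod_cast (by omega : 0 < n)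
  set s : ℕ := ⌈a₁ * ((n : ℝ) / m)⌉₊ with hs
  have hs1 : a₁ * ((n : ℝ) / m) ≤ s := Nat.le_ceil _
  obtain ⟨nd, hnd, hζnd⟩ := exists_nodes (ζ := ζ) (s := s) fun k => Nat.ceil_le.2 (hζ k).1
  have hRe : R.card - 1 ≤ (R.erase (ζ i₀)).card := Finset.pred_card_le_card_erase
  obtain ⟨h, hh1, hhM, hMh, c, hc⟩ :=
    exists_isCode (M := min (R.erase (ζ i₀)).card ((m - 1) / 2)) (by omega)
  obtain ⟨U, hUR, hU⟩ := Finset.exists_subset_card_eq (hhM.trans (min_le_left _ _))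
  have hζU : ζ i₀ ∉ U := fun h => by simpa using hUR h
  have hcompl : h ≤ (insert (ζ i₀) U)ᶜ.card := by
    rw [Finset.card_compl, Finset.card_insert_of_notMem hζU, Fintype.card_fin, hU]
    omega
  obtain ⟨f⟩ : Nonempty (Fin h ↪ U) := Function.Embedding.nonempty_of_card_le (by
    rw [Fintype.card_fin, Fintype.card_coe, hU])
  obtain ⟨f'⟩ : Nonempty (Fin h ↪ ((insert (ζ i₀) U)ᶜ : Finset (Fin m))) :=
    Function.Embedding.nonempty_of_card_le (by rw [Fintype.card_fin, Fintype.card_coe]; exact hcompl)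
  set A : Fin h → Fin m := fun e => (f e).1 with hAdef
  set B : Fin h → Fin m := fun e => (f' e).1 with hBdef
  have hA : Function.Injective A := Subtype.val_injective.comp f.injective
  have hB : Function.Injective B := Subtype.val_injective.comp f'.injective
  have hBn : ∀ e, B e ∉ insert (ζ i₀) U := fun e => Finset.mem_compl.1 (f' e).2
  have hAB : ∀ e e', A e ≠ B e' := fun e e' h =>
    hBn e' (by rw [← h]; exact Finset.mem_insert_of_mem (f e).2)
  have hAi : ∀ e, A e ≠ ζ i₀ := fun e h => hζU (by rw [← h]; exact (f e).2)
  have hAR : ∀ e, A e ∈ R := fun e => (Finset.mem_erase.1 (hUR (f e).2)).2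
  have hmh : (m : ℝ) ≤ 8 * h := by exact_mod_cast (by omega : m ≤ 8 * h)
  have : Nonempty (Fin h) := ⟨⟨0, hh1⟩⟩
  have hF := nonempty_family_single (O := Fin h) hζ (fun _ => i₀) A
    (T := Finset.univ.image fun x : Fin h × Fin s => nd (B x.1, x.2)) (g := codePattern c A B)
    (τ := (s : ℝ) * h / 2) (c := a₁ / 16)
    (fun e => hζ.update (hAi e).symm hi₀ (hR _ (hAR e)))
    (fun _ hT => by
      obtain ⟨x, -, hx⟩ := Finset.mem_image.1 hT
      refine hBn x.1 ?_
      have : ζ i₀ = B x.1 := by rw [← hx]; exact hζnd _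
      rw [← this]
      exact Finset.mem_insert_self _ _)
    codePattern_comm (codePattern_nonneg hc) (codePattern_le_one hc)
    (fun e => le_rowDist_code_zero hnd hζnd hc hA hB hAB e hAi)
    (fun e e' hee _ => le_rowDist_code hnd hζnd hc hA hB hAB hee)
    (by rw [Fintype.card_fin]; omega) (by positivity)
    (by
      have h1 := mul_le_mul hs1 hmh hm0.le (Nat.cast_nonneg _)
      have e : a₁ * ((n : ℝ) / m) * m = a₁ * n := by field_simp
      rw [e] at h1
      linarith)
  refine ⟨h + 1, by omega, by omega, ?_⟩
  rw [Fintype.card_fin] at hF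
  push_cast
  exact hF

lemma exists_family_move_two {ζ : Fin n → Fin 2} (hζ : IsBalanced a₁ a₂ ζ) (ha₁ : 0 < a₁)
    (ha₁' : a₁ ≤ 1) (hn : 4 ≤ n) {a b : Fin 2} (hab : a ≠ b) (ha : IsDonor a₁ ζ a)
    (hb : IsRecipient a₂ ζ b) :
    ∃ M : ℕ, 2 ≤ M ∧ a₁ * n / 6 ≤ M ∧ Nonempty (LabelFamily (m := 2) (n := n)
      (IsBalanced a₁ a₂) 1 (0.87 * Real.log M) (a₁ / 16 / 200)) := by
  have hn0 : (0 : ℝ) < n := by exact_mod_cast (by omega : 0 < n)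
  obtain ⟨p, p', hpp, hp⟩ := exists_large_class ζ
  set P := Finset.univ.filter fun i => ζ i = p with hP
  by_cases hpa : p = a
  · subst hpa
    obtain ⟨W, hWP, hW⟩ := Finset.exists_subset_card_eq (show P.card / 2 ≤ P.card by omega)
    have hζW : ∀ i ∈ W, ζ i = p := fun i hi => (Finset.mem_filter.1 (hWP hi)).2
    have h := nonempty_family_move (W := W) (T := P \ W) (B := {p}) (c := a₁ / 16) hζ hb
      (Finset.card_pos.1 (by omega)) (fun i hi => by rw [hζW i hi]; exact ha)
      (fun i hi => by rw [hζW i hi]; exact hab) (fun i hi h => (Finset.mem_sdiff.1 h).2 hi)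
      (fun j hj => by simpa [hP] using (Finset.mem_sdiff.1 hj).1)
      (fun h => absurd (Finset.mem_singleton.1 h).symm hab) (by positivity)
      (by
        rw [Finset.card_sdiff_of_subset hWP, hW]
        have : (n : ℝ) ≤ 4 * (P.card - P.card / 2 : ℕ) := by
          exact_mod_cast (by omega : n ≤ 4 * (P.card - P.card / 2))
        nlinarith)
    refine ⟨W.card + 1, by omega, ?_, by push_cast; exact h⟩
    have : (n : ℝ) ≤ 6 * (W.card + 1 : ℕ) := by exact_mod_cast (by omega : n ≤ 6 * (W.card + 1))
    nlinarith
  · have hpb : p = b := by omega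
    subst hpb
    set W := Finset.univ.filter fun i => ζ i = a with hW
    have hWn : a₁ * ((n : ℝ) / 2) ≤ W.card := by simpa using (hζ a).1
    have hW1 : 1 ≤ W.card := by
      have : (0 : ℝ) < W.card := lt_of_lt_of_le (by positivity) hWn
      exact_mod_cast this
    have h := nonempty_family_move (W := W) (T := P) (B := {p}) (c := a₁ / 16) hζ hb
      (Finset.card_pos.1 hW1) (fun i hi => by rw [(Finset.mem_filter.1 hi).2]; exact ha)
      (fun i hi => by rw [(Finset.mem_filter.1 hi).2]; exact hab)
      (fun i hi h => hab (by rw [← (Finset.mem_filter.1 hi).2, (Finset.mem_filter.1 h).2]))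
      (fun j hj => by simpa [hP] using hj)
      (fun _ i hi h => hab (by
        rw [← (Finset.mem_filter.1 hi).2, Finset.mem_singleton.1 h])) (by positivity)
      (by
        have : (n : ℝ) ≤ 2 * P.card := by exact_mod_cast hp
        nlinarith)
    refine ⟨W.card + 1, by omega, ?_, by push_cast; exact h⟩
    push_cast
    nlinarith

/-- Since `log (m n e)` is of order `log n`, order `√n` options suffice. If at least half of the
classes are donors, order `n` nodes can move. Otherwise more than half are recipients: for `m² ≤ n`
one donor class has order `n / m ≥ √n` nodes, and for `m² > n` there are order `m ≥ √n` target
classes. -/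
lemma exists_family_of_update (hζ : IsBalanced a₁ a₂ ζ) (ha₁ : 0 < a₁) (ha₁' : a₁ ≤ 1)
    (hm : 2 ≤ m) (hmn : 2 * m ≤ n) {i₀ : Fin n} {b : Fin m} (hib : ζ i₀ ≠ b)
    (hbal : IsBalanced a₁ a₂ (Function.update ζ i₀ b)) :
    ∃ M : ℕ, 2 ≤ M ∧ a₁ ^ 2 * n ≤ 64 * (M : ℝ) ^ 2 ∧ Nonempty (LabelFamily (m := m) (n := n)
      (IsBalanced a₁ a₂) 1 (0.87 * Real.log M) (a₁ / 16 / 200)) := by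
  classical
  have hm0 : (0 : ℝ) < m := by exact_mod_cast (by omega : 0 < m)
  have hn1 : (1 : ℝ) ≤ n := by exact_mod_cast (by omega : 1 ≤ n)
  have hD := IsBalanced.isDonor_of_update hib hbal
  have hR := IsBalanced.isRecipient_of_update hib hbal
  have hlin : ∀ M : ℕ, a₁ * n ≤ 8 * M → a₁ ^ 2 * n ≤ 64 * (M : ℝ) ^ 2 := by
    intro M h
    have h1 := pow_le_pow_left₀ (by positivity) h 2
    nlinarith [mul_nonneg (sq_nonneg a₁) (sub_nonneg.2 hn1)]
  rcases hm.eq_or_lt with rfl | hm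
  · obtain ⟨M, hM, hMn, hF⟩ := exists_family_move_two hζ ha₁ ha₁' (by omega) hib hD hR
    exact ⟨M, hM, hlin M (by nlinarith), hF⟩
  set DD : Finset (Fin m) := Finset.univ.filter fun k => IsDonor a₁ ζ k with hDD
  set RR : Finset (Fin m) := Finset.univ.filter fun k => IsRecipient a₂ ζ k with hRR
  have hDR : m ≤ DD.card + RR.card := by
    refine le_trans (le_of_eq ?_) (Finset.card_union_le DD RR)
    have : DD ∪ RR = Finset.univ := by
      ext k
      simpa [hDD, hRR] using hζ.isDonor_or_isRecipient hD k
    rw [this, Finset.card_univ, Fintype.card_fin]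
  by_cases hDm : m ≤ 2 * DD.card
  · have hiD : ζ i₀ ∈ DD.erase b := by simp [hDD, hib, hD]
    have hDe : DD.card - 1 ≤ (DD.erase b).card := Finset.pred_card_le_card_erase
    have hpos : 0 < (DD.erase b).card := Finset.card_pos.2 ⟨_, hiD⟩
    obtain ⟨E, hE, hEc⟩ := Finset.exists_subset_card_eq
      (min_le_left (DD.erase b).card ((m - 1) / 2))
    obtain ⟨M, hM, hMn, hF⟩ := exists_family_move_of_classes (D := E) hζ ha₁ (by omega) hmn hR
      (Finset.card_pos.1 (by omega))
      (fun k hk => (Finset.mem_filter.1 (Finset.mem_erase.1 (hE hk)).2).2)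
      (fun h => (Finset.mem_erase.1 (hE h)).1 rfl) (by omega)
    refine ⟨M, hM, hlin M ?_, hF⟩
    have h1 : (m : ℝ) ≤ 8 * E.card := by exact_mod_cast (by omega : m ≤ 8 * E.card)
    have h2 : (m : ℝ) * (a₁ * (n / m)) ≤ 8 * E.card * (a₁ * (n / m)) :=
      mul_le_mul_of_nonneg_right h1 (by positivity)
    have e : (m : ℝ) * (a₁ * (n / m)) = a₁ * n := by field_simp
    linarith
  · by_cases hmn2 : m ^ 2 ≤ n ∨ m = 3
    · obtain ⟨M, hM, hMn, hF⟩ := exists_family_move_of_classes (D := {ζ i₀}) hζ ha₁ (by omega) hmn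
        hR (Finset.singleton_nonempty _)
        (fun k hk => by rw [Finset.mem_singleton.1 hk]; exact hD)
        (by simpa using hib.symm) (by simp; omega)
      refine ⟨M, hM, ?_, hF⟩
      have hM' : (2 : ℝ) ≤ M := by exact_mod_cast hM
      have ha2 : a₁ ^ 2 ≤ 1 := by nlinarith
      by_cases hmn3 : m ^ 2 ≤ n
      · have h1 : (m : ℝ) ^ 2 ≤ n := by exact_mod_cast hmn3
        rw [Finset.card_singleton, Nat.cast_one, one_mul, ← mul_div_assoc,
          div_le_iff₀ hm0] at hMn
        have h2 := pow_le_pow_left₀ (by positivity) hMn 2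
        have h3 : (a₁ * (n : ℝ)) ^ 2 ≤ (M : ℝ) ^ 2 * n := by
          refine h2.trans ?_
          rw [mul_pow]
          exact mul_le_mul_of_nonneg_left h1 (by positivity)
        have h4 : a₁ ^ 2 * n ≤ (M : ℝ) ^ 2 := by
          refine le_of_mul_le_mul_right ?_ (by linarith : (0 : ℝ) < n)
          linarith [h3]
        nlinarith
      -- Here `m = 3` and `n < m²`, so any `M ≥ 2` is enough.
      · have h3 : n ≤ 9 := by
          rcases hmn2 with h | h
          · exact absurd h hmn3
          · subst h; omega
        have h4 : (n : ℝ) ≤ 9 := by exact_mod_cast h3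
        nlinarith
    · push Not at hmn2
      obtain ⟨M, hM, hMm, hF⟩ := exists_family_relabel (R := RR) hζ ha₁ (by omega) hmn hD
        (fun k hk => (Finset.mem_filter.1 hk).2) (by omega)
      refine ⟨M, hM, ?_, hF⟩
      have h1 : (n : ℝ) ≤ (m : ℝ) ^ 2 := by exact_mod_cast hmn2.1.le
      have h2 : (m : ℝ) ≤ 8 * M := by exact_mod_cast hMm
      have h3 := pow_le_pow_left₀ hm0.le h2 2
      have ha2 : a₁ ^ 2 ≤ 1 := by nlinarith
      nlinarith

/-- Families of balanced labelings in which at most one node changes its class. -/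
theorem exists_family_one {a₁ : ℝ} (ha₁ : 0 < a₁) (ha₁' : a₁ ≤ 1) :
    ∃ C : ℝ, 0 < C ∧ ∀ (a₂ : ℝ) (m n : ℕ) (ζ : Fin n → Fin m) (i₀ : Fin n) (b : Fin m),
      IsBalanced a₁ a₂ ζ → IsBalanced a₁ a₂ (Function.update ζ i₀ b) → ζ i₀ ≠ b → 2 ≤ m →
      2 * m ≤ n → ∃ ρ : ℝ, C * Real.log (m * n * Real.exp 1) ≤ ρ ∧
        Nonempty (LabelFamily (m := m) (n := n) (IsBalanced a₁ a₂) 1 ρ (a₁ / 16 / 200)) := by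
  set K : ℝ := 1 + 2 * Real.log (64 / a₁ ^ 2) with hK
  have hK1 : 1 ≤ K := by
    have : 0 ≤ Real.log (64 / a₁ ^ 2) := Real.log_nonneg (by
      rw [one_le_div (by positivity)]; nlinarith)
    linarith
  refine ⟨0.87 / (2 * K + 4), by positivity, ?_⟩
  intro a₂ m n ζ i₀ b hζ hbal hib hm hmn
  obtain ⟨M, hM, hMn, hF⟩ := exists_family_of_update hζ ha₁ ha₁' hm hmn hib hbal
  refine ⟨_, ?_, hF⟩
  have hm0 : (0 : ℝ) < m := by exact_mod_cast (by omega : 0 < m)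
  have hn0 : (0 : ℝ) < n := by exact_mod_cast (by omega : 0 < n)
  have hmn' : (m : ℝ) ≤ n := by exact_mod_cast (by omega : m ≤ n)
  have hM' : (2 : ℝ) ≤ M := by exact_mod_cast hM
  have hlogM : 1 / 2 ≤ Real.log M := by
    refine le_trans (by linarith [Real.log_two_gt_d9]) (Real.log_le_log (by norm_num) hM')
  have h1 : Real.log (m * n * Real.exp 1) ≤ 1 + 2 * Real.log n := by
    rw [Real.log_mul (by positivity) (Real.exp_pos 1).ne', Real.log_exp,
      Real.log_mul hm0.ne' hn0.ne']
    linarith [Real.log_le_log hm0 hmn']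
  have h2 : Real.log n ≤ Real.log (64 / a₁ ^ 2) + 2 * Real.log M := by
    have h3 : (n : ℝ) ≤ 64 / a₁ ^ 2 * (M : ℝ) ^ 2 := by
      rw [div_mul_eq_mul_div, le_div_iff₀ (by positivity)]; linarith
    have h4 := Real.log_le_log hn0 h3
    rw [Real.log_mul (by positivity) (by positivity), Real.log_pow] at h4
    push_cast at h4
    exact h4
  have h5 : Real.log (m * n * Real.exp 1) ≤ (2 * K + 4) * Real.log M := by nlinarith
  calc 0.87 / (2 * K + 4) * Real.log (m * n * Real.exp 1)
      ≤ 0.87 / (2 * K + 4) * ((2 * K + 4) * Real.log M) := by gcongr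
    _ = 0.87 * Real.log M := by field_simp

end Single

/-! ### The three terms of the rate -/

/-- A non-constant family of labelings changes between two consecutive times. -/
lemma exists_consecutive_ne {L : ℕ} {X : Type*} {z : Fin L → X} (h : ∃ l l', z l ≠ z l') :
    ∃ l l' : Fin L, (l' : ℕ) = l + 1 ∧ z l ≠ z l' := by
  by_contra! hcon
  obtain ⟨l, l', hll⟩ := h
  have hL : 0 < L := l.pos
  have key : ∀ (k : ℕ) (hk : k < L), z ⟨k, hk⟩ = z ⟨0, hL⟩ := by
    intro k
    induction k with
    | zero => intro _; rfl
    | succ k ih =>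
      intro hk
      rw [← ih (by omega)]
      exact (hcon ⟨k, by omega⟩ ⟨k + 1, hk⟩ rfl).symm
  exact hll ((key l l.2).trans (key l' l'.2).symm)

lemma exists_update_of_card_ne_le_one {m n : ℕ} {ζ ζ' : Fin n → Fin m} (hne : ζ ≠ ζ')
    (hcard : (Finset.univ.filter fun i => ζ i ≠ ζ' i).card ≤ 1) :
    ∃ i, ζ i ≠ ζ' i ∧ Function.update ζ i (ζ' i) = ζ' := by
  obtain ⟨i, hi⟩ := Function.ne_iff.1 hne
  refine ⟨i, hi, funext fun j => ?_⟩
  by_cases hj : j = i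
  · subst hj; simp
  · rw [Function.update_of_ne hj]
    by_contra hcon
    exact hj (Finset.card_le_one.1 hcard j (by simpa using hcon) i (by simpa using hi))

section Terms

variable {ν₀ K₀ a₁ a₂ : ℝ}

/-- The lower bound from the unknown labels, with clusterings constant in time. -/
theorem exists_hasLowerBound_labels (hν₀ : 1 / 2 < ν₀) (hK₀ : 0 < K₀) (ha₁ : 0 < a₁)
    (ha₁' : a₁ ≤ 1) :
    ∃ C : ℝ, 0 < C ∧ ∀ (a₂ : ℝ) (m n n₀ L : ℕ) (H : Matrix (Fin L) (Fin L) ℝ) (ζ : Fin n → Fin m),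
      TransformCond H → 2 ≤ L → 2 ≤ m → 2 * m ≤ n → IsBalanced a₁ a₂ ζ →
      HasLowerBound m n n₀ H ν₀ K₀ a₁ a₂ (C * (Real.log m / (n * L))) := by
  obtain ⟨C, hC, h⟩ := exists_family_of_two_le ha₁ ha₁'
  refine ⟨a₁ / 16 / 200 / 2400 * C, by positivity, ?_⟩
  intro a₂ m n n₀ L H ζ hH hL hm hmn hζ
  -- The labeling is constant in time, so all `n` nodes may differ from the base; with `n` in place
  -- of `n₀` the logarithm becomes `log m + 1`.
  obtain ⟨V, ρ, -, hρ, ⟨F⟩⟩ := h a₂ m n n ζ hζ hm hmn (by omega) le_rfl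
  refine (F.hasLowerBound_static hL hH hν₀ hK₀ n₀).mono ?_
  have hm0 : (0 : ℝ) < m := by exact_mod_cast (by omega : 0 < m)
  have hn0 : (0 : ℝ) < n := by exact_mod_cast (by omega : 0 < n)
  have hL0 : (0 : ℝ) < L := by exact_mod_cast (by omega : 0 < L)
  have e1 : (m : ℝ) * n * Real.exp 1 / n = m * Real.exp 1 := by field_simp
  rw [e1, Real.log_mul hm0.ne' (Real.exp_pos 1).ne', Real.log_exp] at hρ
  have h2 : C * (n * Real.log m) ≤ ρ := by
    have : 0 ≤ C * (n : ℝ) := by positivity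
    nlinarith
  rw [le_div_iff₀ (by positivity)]
  have e2 : a₁ / 16 / 200 / 2400 * C * (Real.log m / (n * L)) * ((n : ℝ) ^ 2 * L)
      = a₁ / 16 / 200 / 2400 * (C * (n * Real.log m)) := by field_simp
  rw [e2]
  have := mul_le_mul_of_nonneg_left h2 (by positivity : 0 ≤ a₁ / 16 / 200 / 2400)
  linarith

/-- The lower bound from the changes of the labels over time. -/
theorem exists_hasLowerBound_changes (hν₀ : 1 / 2 < ν₀) (hK₀ : 0 < K₀) (ha₁ : 0 < a₁)
    (ha₁' : a₁ ≤ 1) :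
    ∃ C : ℝ, 0 < C ∧ ∀ (a₂ : ℝ) (m n n₀ L : ℕ) (H : Matrix (Fin L) (Fin L) ℝ) (z : Clustering m n L),
      TransformCond H → 2 ≤ L → 2 ≤ m → 2 * m ≤ n → 1 ≤ n₀ → n₀ ≤ n →
      z ∈ balancedClusterings m n n₀ L a₁ a₂ → (∃ l l', z l ≠ z l') →
      HasLowerBound m n n₀ H ν₀ K₀ a₁ a₂
        (C * (n₀ / (n : ℝ) ^ 2 * Real.log (m * n * Real.exp 1 / n₀))) := by
  obtain ⟨C, hC, h⟩ := exists_family_of_two_le ha₁ ha₁'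
  obtain ⟨C', hC', h'⟩ := exists_family_one ha₁ ha₁'
  refine ⟨a₁ / 16 / 200 / 7200 * min C C', by positivity, ?_⟩
  intro a₂ m n n₀ L H z hH hL hm hmn hn₀ hn₀n hz hne
  have hm0 : (1 : ℝ) ≤ m := by exact_mod_cast (by omega : 1 ≤ m)
  have hn0 : (0 : ℝ) < n := by exact_mod_cast (by omega : 0 < n)
  have hn₀0 : (0 : ℝ) < n₀ := by exact_mod_cast (by omega : 0 < n₀)
  have hn₀n' : (n₀ : ℝ) ≤ n := by exact_mod_cast hn₀n
  have hlog : 0 ≤ Real.log (m * n * Real.exp 1 / n₀) := by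
    refine Real.log_nonneg ?_
    rw [one_le_div hn₀0]
    have := Real.add_one_le_exp 1
    calc (n₀ : ℝ) ≤ 1 * n * 1 := by linarith
      _ ≤ m * n * Real.exp 1 := by gcongr; linarith
  have key : ∃ (V : ℕ) (ρ : ℝ), V ≤ n₀ ∧
      min C C' * (n₀ * Real.log (m * n * Real.exp 1 / n₀)) ≤ ρ ∧
      Nonempty (LabelFamily (m := m) (n := n) (IsBalanced a₁ a₂) V ρ (a₁ / 16 / 200)) := by
    rcases hn₀.eq_or_lt with rfl | hn₀2
    -- Two consecutive different labelings of the given family differ in exactly one node, which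
    -- yields an admissible single move.
    · obtain ⟨l, l', hl, hll⟩ := exists_consecutive_ne hne
      obtain ⟨i, hi, hu⟩ := exists_update_of_card_ne_le_one hll (hz.1 l l' hl)
      obtain ⟨ρ, hρ, hF⟩ := h' a₂ m n (z l) i (z l' i) (hz.2 l) (by rw [hu]; exact hz.2 l') hi hm hmn
      refine ⟨1, ρ, le_rfl, le_trans ?_ hρ, hF⟩
      rw [Nat.cast_one, one_mul, div_one]
      rw [Nat.cast_one, div_one] at hlog
      exact mul_le_mul_of_nonneg_right (min_le_right _ _) hlog
    · obtain ⟨V, ρ, hV, hρ, hF⟩ := h a₂ m n n₀ (z ⟨0, by omega⟩) (hz.2 _) hm hmn hn₀2 hn₀n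
      exact ⟨V, ρ, hV, le_trans (mul_le_mul_of_nonneg_right (min_le_left _ _) (by positivity)) hρ,
        hF⟩
  obtain ⟨V, ρ, hV, hρ, ⟨F⟩⟩ := key
  refine (F.hasLowerBound_dynamic hL hH hν₀ hK₀ (by positivity) hV).mono ?_
  rw [le_div_iff₀ (by positivity)]
  have e2 : a₁ / 16 / 200 / 7200 * min C C' * (n₀ / (n : ℝ) ^ 2 *
      Real.log (m * n * Real.exp 1 / n₀)) * (n : ℝ) ^ 2
      = a₁ / 16 / 200 / 7200 * (min C C' * (n₀ * Real.log (m * n * Real.exp 1 / n₀))) := by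
    field_simp
  rw [e2]
  have := mul_le_mul_of_nonneg_left hρ (by positivity : 0 ≤ a₁ / 16 / 200 / 7200)
  linarith

lemma hasLowerBound_of_nonpos {m n n₀ L : ℕ} {H : Matrix (Fin L) (Fin L) ℝ} (hH : TransformCond H)
    (hν₀ : 1 / 2 < ν₀) (hK₀ : 0 < K₀) {z : Clustering m n L}
    (hz : z ∈ balancedClusterings m n n₀ L a₁ a₂) {t : ℝ} (ht : t ≤ 0) :
    HasLowerBound m n n₀ H ν₀ K₀ a₁ a₂ t := by
  intro Λ'
  refine ⟨_, const_mem_smoothClass hH hν₀ hK₀ (fun _ _ => 0) fun _ _ => rfl, z, hz, ?_⟩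
  have h1 : {B | t ≤ normError (Λ' B) (probTensor (fun _ _ _ => (0 : I)) z)} = Set.univ := by
    ext B
    simp only [Set.mem_ofPred_eq, Set.mem_univ, iff_true]
    exact ht.trans (div_nonneg (Finset.sum_nonneg fun i _ => Finset.sum_nonneg fun j _ =>
      Finset.sum_nonneg fun l _ => sq_nonneg _) (by positivity))
  rw [h1]
  unfold networkLaw
  rw [MeasureTheory.measure_univ, ENNReal.div_le_iff (by norm_num) (by norm_num)]
  norm_num

end Terms

end DSBM

/-! ### Combination of the three bounds -/

theorem theorem4 (ν₀ K₀ a₁ a₂ : ℝ) (hν₀ : 1 / 2 < ν₀) (hK₀ : 0 < K₀)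
    (ha₁ : 0 < a₁) (ha₁' : a₁ ≤ 1) (ha₂ : 1 ≤ a₂) :
    ∃ C : ℝ, 0 < C ∧
      ∀ (m n n₀ L : ℕ) (H : Matrix (Fin L) (Fin L) ℝ),
        DSBM.TransformCond H → 2 ≤ L → 1 ≤ m → 2 * m ≤ n → n₀ ≤ n →
        (∃ z ∈ DSBM.balancedClusterings m n n₀ L a₁ a₂, n₀ ≠ 0 → ∃ l l', z l ≠ z l') →
        (1 / 4 : ℝ≥0∞) ≤
          ⨅ Λ' : DSBM.Estimator n L,
            ⨆ G ∈ DSBM.smoothClass m H ν₀ K₀,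
              ⨆ z ∈ DSBM.balancedClusterings m n n₀ L a₁ a₂,
                DSBM.networkLaw (DSBM.probTensor G z)
                  {B | C * DSBM.rate m n n₀ L ν₀ ≤
                    DSBM.normError (Λ' B) (DSBM.probTensor G z)} := by
  obtain ⟨C₁, hC₁, h₁⟩ := DSBM.exists_hasLowerBound_smooth hν₀ hK₀ ha₂
  obtain ⟨C₂, hC₂, h₂⟩ := DSBM.exists_hasLowerBound_labels hν₀ hK₀ ha₁ ha₁'
  obtain ⟨C₃, hC₃, h₃⟩ := DSBM.exists_hasLowerBound_changes hν₀ hK₀ ha₁ ha₁'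
  set C := min C₁ (min C₂ C₃) with hC
  have hC0 : 0 < C := lt_min hC₁ (lt_min hC₂ hC₃)
  refine ⟨C / 3, by positivity, ?_⟩
  intro m n n₀ L H hH hL hm hmn hn₀ ⟨z, hz, hne⟩
  -- For `r < 0` a smaller constant gives a larger threshold, but the bound is then trivial; this
  -- avoids proving that each term is nonnegative.
  have hsingle : ∀ r Cr : ℝ, C ≤ Cr → DSBM.HasLowerBound m n n₀ H ν₀ K₀ a₁ a₂ (Cr * r) →
      DSBM.HasLowerBound m n n₀ H ν₀ K₀ a₁ a₂ (C * r) := by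
    intro r Cr hCr h
    rcases le_total 0 r with hr | hr
    · exact h.mono (mul_le_mul_of_nonneg_right hCr hr)
    · exact DSBM.hasLowerBound_of_nonpos hH hν₀ hK₀ hz (mul_nonpos_of_nonneg_of_nonpos hC0.le hr)
  have hz0 := hz.2 ⟨0, by omega⟩
  have k₁ := hsingle _ _ (min_le_left _ _) (h₁ a₁ m n n₀ L H _ hH hL hm hmn hz0)
  have k₂ : DSBM.HasLowerBound m n n₀ H ν₀ K₀ a₁ a₂ (C * (Real.log m / (n * L))) := by
    rcases hm.eq_or_lt with rfl | hm2
    · exact DSBM.hasLowerBound_of_nonpos hH hν₀ hK₀ hz (by simp)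
    · exact hsingle _ _ ((min_le_right _ _).trans (min_le_left _ _))
        (h₂ a₂ m n n₀ L H _ hH hL hm2 hmn hz0)
  have k₃ : DSBM.HasLowerBound m n n₀ H ν₀ K₀ a₁ a₂
      (C * (n₀ / (n : ℝ) ^ 2 * Real.log (m * n * Real.exp 1 / n₀))) := by
    rcases Nat.eq_zero_or_pos n₀ with rfl | hn₀1
    · exact DSBM.hasLowerBound_of_nonpos hH hν₀ hK₀ hz (by simp)
    -- With one class every family of labelings is constant, against the assumption for `n₀ ≥ 1`.
    · have hm2 : 2 ≤ m := by
        obtain ⟨l, l', hll⟩ := hne hn₀1.ne'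
        by_contra hcon
        have : m = 1 := by omega
        subst this
        exact hll (Subsingleton.elim _ _)
      exact hsingle _ _ ((min_le_right _ _).trans (min_le_right _ _))
        (h₃ a₂ m n n₀ L H z hH hL hm2 hmn hn₀1 hn₀ hz (hne hn₀1.ne'))
  have key : DSBM.HasLowerBound m n n₀ H ν₀ K₀ a₁ a₂ (C / 3 * DSBM.rate m n n₀ L ν₀) := by
    unfold DSBM.rate
    generalize min (1 / (L : ℝ) * (((m : ℝ) / n) ^ 2) ^ (2 * ν₀ / (2 * ν₀ + 1)))
      (((m : ℝ) / n) ^ 2) = r₁ at *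
    generalize Real.log m / (n * L) = r₂ at *
    generalize (n₀ : ℝ) / (n : ℝ) ^ 2 * Real.log (m * n * Real.exp 1 / n₀) = r₃ at *
    -- A third of the sum is at most the largest term, so the bound for that term suffices.
    rcases le_total r₁ r₂ with h12 | h12 <;> rcases le_total r₂ r₃ with h23 | h23 <;>
      rcases le_total r₁ r₃ with h13 | h13
    all_goals first
      | exact k₁.mono (by nlinarith)
      | exact k₂.mono (by nlinarith)
      | exact k₃.mono (by nlinarith)
  refine le_iInf fun Λ' => ?_
  obtain ⟨G, hG, z', hz', hle⟩ := key Λ'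
  exact le_iSup₂_of_le G hG (le_iSup₂_of_le z' hz' hle)
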